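/- **Setting.** A strip packing instance consists of a strip of width $W$ and finitely many items $i\in I$ with positive integral widths $w_i\le W$ and heights $h_i$; $\mathrm{OPT}$ is the minimal height of a feasible packing (lower left corners at integral points, no overlaps). Let $1/\varepsilon\in\mathbb N$ with $\varepsilon\le 1/24$, $\delta=\varepsilon^k$ for some $k\in\mathbb N_{\ge1}$, and $0<\mu<\delta$. Put $L=\{h_i\ge\delta\mathrm{OPT},\,w_i\ge\delta W\}$, $T=\{i\notin L: h_i\ge(1/3+\varepsilon)\mathrm{OPT}\}$, $V=\{i\notin T: h_i\ge\delta\mathrm{OPT},\,w_i\le\mu W\}$, $H=\{h_i\le\mu\mathrm{OPT},\,w_i\ge\delta W\}$, $S=\{h_i\le\mu\mathrm{OPT},\,w_i\le\mu W\}$ (large, tall, vertical, horizontal, small); all remaining items are removed. A *rounded packing* is a packing without overlaps of $L\cup T\cup V\cup H\cup S$ in the area $W\times(1+2\varepsilon)\mathrm{OPT}$ (integral $x$-coordinates, real $y$-coordinates) in which the height of each $i\in L\cup T\cup V$ with $\varepsilon^{l}\mathrm{OPT}\le h_i<\varepsilon^{l-1}\mathrm{OPT}$, $l\in\mathbb N$,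 is rounded up to the next multiple of $\varepsilon^{l+1}\mathrm{OPT}$ and its bottom lies at such a multiple, the other items keeping their heights. A *box partition* of a rounded packing is a partition of $W\times(1+2\varepsilon)\mathrm{OPT}$ into boxes (with integral $x$-coordinates) from three sets $\mathcal B_L,\mathcal B_H,\mathcal B_{T\cup V}$, where $\mathcal B_L$ consists of the rectangles of the large items; $\mathcal B_H$ of at most $(1+2\varepsilon)/(\varepsilon\delta^2)$ boxes of height $\varepsilon\delta\mathrm{OPT}$, each meeting some item of $H$ and meeting only items of $H\cup S$; $\mathcal B_{T\cup V}$ of at most $3(1+2\varepsilon)/(\varepsilon\delta^2)$ boxes meeting only items of $T\cup V\cup S$; and no item of $H$ is cut by a vertical box border and no item of $T\cup V$ by a horizontal one. An *enlargement* of a box partition is obtained by moving boxes upwards and increasing heights of boxes in $\mathcal B_{T\cup V}$ (horizontal extents, and the sizes of the boxes in $\mathcal B_L\cup\mathcal B_H$, stay unchanged) so that the boxes remain disjoint and lie in $W\times(1+5\varepsilon)\mathrm{OPT}$. **Statement.** There is an absolute constant $C$ such that in every such setting a rounded packing with a box partition exists, and for every rounded packing and every box partition of it there is an enlargement such that the area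 covered by the enlarged boxes $\mathcal B_{T\cup V}$ can be partitioned into at most $C/(\varepsilon^3\delta^2)$ boxes $\mathcal B_T$ and at most $C/(\varepsilon^3\delta^2)$ boxes $\mathcal B_V$ (all with integral $x$-coordinates) with the following properties. 1. All tall items, with their heights rounded up to multiples of $\varepsilon\mathrm{OPT}$, can be packed without overlap at integral $x$-coordinates into the boxes $\mathcal B_T$, such that each box $B\in\mathcal B_T$ contains only items whose rounded height equals the height of $B$. 2. All vertical items (with the heights of the rounded packing) can be packed fractionally into the boxes $\mathcal B_V$ together with one additional box $V_0$ of height $(1/3+\varepsilon)\mathrm{OPT}$ and width $(1-2\varepsilon)W$: each vertical item is cut by vertical lines into finitely many slices of its full height and of integral widths, and each slice is placed, without overlaps, inside one of these boxes. -/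

import Mathlib

namespace StripPacking

/-- An instance of strip packing: a strip of width `W` and items with positive integral widths and
heights, each of which fits into the strip. -/
structure Instance (ι : Type*) where
  W : ℕ
  w : ι → ℕ
  h : ι → ℕ
  w_pos : ∀ i, 0 < w i
  h_pos : ∀ i, 0 < h i
  w_le : ∀ i, w i ≤ W

/-- `(a, b)` is an inner point of item `i` when its lower left corner is placed at `(x i, y i)`. -/
def Instance.Inner {ι : Type*} (I : Instance ι) (x y : ι → ℕ) (i : ι) (a b : ℕ) : Prop :=
  x i ≤ a ∧ a < x i + I.w i ∧ y i ≤ b ∧ b < y i + I.h i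

/-- Feasible packings: all items lie in the strip and no two of them share an inner point. -/
def Instance.Feasible {ι : Type*} (I : Instance ι) (x y : ι → ℕ) : Prop :=
  (∀ i, x i + I.w i ≤ I.W) ∧
    ∀ i j, i ≠ j → ¬ ∃ a b, I.Inner x y i a b ∧ I.Inner x y j a b

/-- The height `max_i (y i + h i)` of a packing. -/
def Instance.packingHeight {ι : Type*} [Fintype ι] (I : Instance ι) (y : ι → ℕ) : ℕ :=
  Finset.univ.sup fun i => y i + I.h i

/-- `OPT` is the height of an optimal packing. -/
def Instance.IsOptimalHeight {ι : Type*} [Fintype ι] (I : Instance ι) (OPT : ℕ) : Prop :=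
  IsLeast {H | ∃ x y, I.Feasible x y ∧ I.packingHeight y = H} OPT

/-- An instance together with the numbers with respect to which its items are classified. -/
structure Setting (ι : Type*) extends Instance ι where
  OPT : ℕ
  ε : ℝ
  δ : ℝ
  μ : ℝ

section Classification

/-- Large items. -/
def Setting.IsL {ι : Type*} (σ : Setting ι) (i : ι) : Prop :=
  σ.δ * σ.OPT ≤ σ.h i ∧ σ.δ * σ.W ≤ σ.w i

/-- Tall items. -/
def Setting.IsT {ι : Type*} (σ : Setting ι) (i : ι) : Prop :=
  ¬ σ.IsL i ∧ (1 / 3 + σ.ε) * σ.OPT ≤ σ.h i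

/-- Vertical items. -/
def Setting.IsV {ι : Type*} (σ : Setting ι) (i : ι) : Prop :=
  ¬ σ.IsT i ∧ σ.δ * σ.OPT ≤ σ.h i ∧ (σ.w i : ℝ) ≤ σ.μ * σ.W

/-- Horizontal items. -/
def Setting.IsH {ι : Type*} (σ : Setting ι) (i : ι) : Prop :=
  (σ.h i : ℝ) ≤ σ.μ * σ.OPT ∧ σ.δ * σ.W ≤ σ.w i

/-- Small items. -/
def Setting.IsS {ι : Type*} (σ : Setting ι) (i : ι) : Prop :=
  (σ.h i : ℝ) ≤ σ.μ * σ.OPT ∧ (σ.w i : ℝ) ≤ σ.μ * σ.W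

/-- The items that are not medium sized; the medium sized ones are removed. -/
def Setting.Kept {ι : Type*} (σ : Setting ι) (i : ι) : Prop :=
  σ.IsL i ∨ σ.IsT i ∨ σ.IsV i ∨ σ.IsH i ∨ σ.IsS i

end Classification

/-- An axis-parallel box with lower left corner `(x, y)`, width `w` and height `h`. Horizontal
coordinates are integral, as in the original packing; vertical ones are real, since packings are
stretched vertically. -/
structure Box where
  x : ℕ
  w : ℕ
  y : ℝ
  h : ℝ

/-- The points of a box (half-open). -/
def Box.region (B : Box) : Set (ℝ × ℝ) :=
  Set.Ico (B.x : ℝ) (B.x + B.w) ×ˢ Set.Ico B.y (B.y + B.h)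

/-- The horizontal extent of `A` lies in that of `B`. -/
def Box.XWithin (A B : Box) : Prop := B.x ≤ A.x ∧ A.x + A.w ≤ B.x + B.w

/-- The vertical extent of `A` lies in that of `B`. -/
def Box.YWithin (A B : Box) : Prop := B.y ≤ A.y ∧ A.y + A.h ≤ B.y + B.h

/-- `A` is placed inside `B`. -/
def Box.Within (A B : Box) : Prop := A.XWithin B ∧ A.YWithin B

/-- `A` and `B` overlap. -/
def Box.Overlap (A B : Box) : Prop := (A.region ∩ B.region).Nonempty

/-- New heights and positions of the items (meaningful for the kept items only). -/
structure Rounding (ι : Type*) where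
  height : ι → ℝ
  x : ι → ℕ
  y : ι → ℝ

/-- The rectangle occupied by an item in the rounded packing. -/
def Setting.itemBox {ι : Type*} (σ : Setting ι) (q : Rounding ι) (i : ι) : Box :=
  ⟨q.x i, σ.w i, q.y i, q.height i⟩

/-- `q` is a rounded packing of all items that are not medium sized, of height at most
`(1 + 2ε) OPT`: an item of `L ∪ T ∪ V` with `ε ^ l * OPT ≤ h < ε ^ (l - 1) * OPT` has its height
rounded up to the next multiple of `ε ^ (l + 1) * OPT` and is placed at a height that is such a
multiple; the other items keep their heights. -/
structure Setting.IsRounded {ι : Type*} (σ : Setting ι) (q : Rounding ι) : Prop where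
  x_le : ∀ i, σ.Kept i → q.x i + σ.w i ≤ σ.W
  y_nonneg : ∀ i, σ.Kept i → 0 ≤ q.y i
  y_le : ∀ i, σ.Kept i → q.y i + q.height i ≤ (1 + 2 * σ.ε) * σ.OPT
  not_overlap : ∀ i j, σ.Kept i → σ.Kept j → i ≠ j →
    ¬ (σ.itemBox q i).Overlap (σ.itemBox q j)
  rounded : ∀ i, σ.IsL i ∨ σ.IsT i ∨ σ.IsV i → ∀ l : ℕ,
    σ.ε ^ l * σ.OPT ≤ σ.h i → σ.ε * σ.h i < σ.ε ^ l * σ.OPT →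
      q.height i = ⌈σ.h i / (σ.ε ^ (l + 1) * σ.OPT)⌉₊ * (σ.ε ^ (l + 1) * σ.OPT) ∧
      ∃ m : ℕ, q.y i = m * (σ.ε ^ (l + 1) * σ.OPT)
  unchanged : ∀ i, σ.IsH i ∨ σ.IsS i → q.height i = σ.h i

/-- A family of boxes consisting of one box for each large item, `nH` boxes for horizontal items
and `nTV` boxes for tall and vertical items. -/
abbrev Setting.BoxFamily {ι : Type*} (σ : Setting ι) (nH nTV : ℕ) : Type _ :=
  {i // σ.IsL i} ⊕ Fin nH ⊕ Fin nTV → Box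

/-- The box for a large item. -/
abbrev Setting.BoxFamily.boxL {ι : Type*} {σ : Setting ι} {nH nTV : ℕ}
    (P : σ.BoxFamily nH nTV) (i : {i // σ.IsL i}) : Box := P (Sum.inl i)

/-- A box for horizontal items. -/
abbrev Setting.BoxFamily.boxH {ι : Type*} {σ : Setting ι} {nH nTV : ℕ}
    (P : σ.BoxFamily nH nTV) (a : Fin nH) : Box := P (Sum.inr (Sum.inl a))

/-- A box for tall and vertical items. -/
abbrev Setting.BoxFamily.boxTV {ι : Type*} {σ : Setting ι} {nH nTV : ℕ}
    (P : σ.BoxFamily nH nTV) (a : Fin nTV) : Box := P (Sum.inr (Sum.inr a))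

/-- The boxes `P` partition the area `W × (1 + 2ε) OPT` of the rounded packing `q` into the sets
`B_L`, `B_H` and `B_{T ∪ V}`. An item is cut by a vertical (horizontal) border of a box if and only
if it overlaps that box without lying in its horizontal (vertical) extent. -/
structure Setting.IsBoxPartition {ι : Type*} (σ : Setting ι) (q : Rounding ι) {nH nTV : ℕ}
    (P : σ.BoxFamily nH nTV) : Prop where
  pos : ∀ a, 0 < (P a).w ∧ 0 < (P a).h
  disjoint : ∀ a b, a ≠ b → Disjoint (P a).region (P b).region
  union : ⋃ a, (P a).region =
    Set.Ico (0 : ℝ) σ.W ×ˢ Set.Ico (0 : ℝ) ((1 + 2 * σ.ε) * σ.OPT)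
  card_H : (nH : ℝ) ≤ (1 + 2 * σ.ε) / (σ.ε * σ.δ ^ 2)
  card_TV : (nTV : ℝ) ≤ 3 * (1 + 2 * σ.ε) / (σ.ε * σ.δ ^ 2)
  boxL : ∀ i, P.boxL i = σ.itemBox q i
  boxH_height : ∀ a, (P.boxH a).h = σ.ε * σ.δ * σ.OPT
  boxH_some : ∀ a, ∃ i, σ.IsH i ∧ (σ.itemBox q i).Overlap (P.boxH a)
  boxH_only : ∀ a i, σ.Kept i → (σ.itemBox q i).Overlap (P.boxH a) → σ.IsH i ∨ σ.IsS i
  boxTV_only : ∀ a i, σ.Kept i → (σ.itemBox q i).Overlap (P.boxTV a) →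
    σ.IsT i ∨ σ.IsV i ∨ σ.IsS i
  uncut_H : ∀ a i, σ.IsH i → (σ.itemBox q i).Overlap (P a) → (σ.itemBox q i).XWithin (P a)
  uncut_TV : ∀ a i, σ.IsT i ∨ σ.IsV i → (σ.itemBox q i).Overlap (P a) →
    (σ.itemBox q i).YWithin (P a)

/-- `P'` arises from `P` when the height of the packing area is increased by `3ε OPT`: boxes are
only moved upwards, and boxes for tall and vertical items may in addition be made higher. -/
structure Setting.IsEnlargement {ι : Type*} (σ : Setting ι) {nH nTV : ℕ}
    (P P' : σ.BoxFamily nH nTV) : Prop where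
  x_eq : ∀ a, (P' a).x = (P a).x
  w_eq : ∀ a, (P' a).w = (P a).w
  y_le : ∀ a, (P a).y ≤ (P' a).y
  hL_eq : ∀ i, (P'.boxL i).h = (P.boxL i).h
  hH_eq : ∀ a, (P'.boxH a).h = (P.boxH a).h
  hTV_le : ∀ a, (P.boxTV a).h ≤ (P'.boxTV a).h
  top_le : ∀ a, (P' a).y + (P' a).h ≤ (1 + 5 * σ.ε) * σ.OPT
  disjoint : ∀ a b, a ≠ b → Disjoint (P' a).region (P' b).region

/-- The height of a tall item, rounded up to the next multiple of `ε * OPT`. -/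
noncomputable def Setting.tallHeight {ι : Type*} (σ : Setting ι) (q : Rounding ι) (i : ι) : ℝ :=
  ⌈q.height i / (σ.ε * σ.OPT)⌉₊ * (σ.ε * σ.OPT)

/-- `BT` and `BV` together partition the area of the boxes for tall and vertical items in `P`. -/
structure Setting.IsSubdivision {ι : Type*} (σ : Setting ι) {nH nTV nT nV : ℕ}
    (P : σ.BoxFamily nH nTV) (BT : Fin nT → Box) (BV : Fin nV → Box) : Prop where
  disjoint_T : ∀ a b, a ≠ b → Disjoint (BT a).region (BT b).region
  disjoint_V : ∀ a b, a ≠ b → Disjoint (BV a).region (BV b).region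
  disjoint_TV : ∀ a b, Disjoint (BT a).region (BV b).region
  union : (⋃ a, (BT a).region) ∪ (⋃ a, (BV a).region) = ⋃ a, (P.boxTV a).region

/-- All tall items, with their heights rounded up to multiples of `ε * OPT`, can be packed into the
boxes `BT`, where each box contains only items whose height is the height of the box. -/
def Setting.PacksTall {ι : Type*} (σ : Setting ι) (q : Rounding ι) {nT : ℕ}
    (BT : Fin nT → Box) : Prop :=
  ∃ (s : {i // σ.IsT i} → Box) (c : {i // σ.IsT i} → Fin nT),
    (∀ i, (s i).w = σ.w i ∧ (s i).h = σ.tallHeight q i) ∧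
    (∀ i, (s i).Within (BT (c i)) ∧ (s i).h = (BT (c i)).h) ∧
    ∀ i j, i ≠ j → ¬ (s i).Overlap (s j)

/-- The slice `A`, in coordinates relative to the lower left corner of the extra box `V₀` of width
`(1 - 2ε) W` and height `(1/3 + ε) OPT`, lies inside `V₀`. -/
def Setting.WithinV0 {ι : Type*} (σ : Setting ι) (A : Box) : Prop :=
  (A.x : ℝ) + A.w ≤ (1 - 2 * σ.ε) * σ.W ∧
    0 ≤ A.y ∧ A.y + A.h ≤ (1 / 3 + σ.ε) * σ.OPT

open Classical in
/-- All vertical items (with rounded heights) can be packed fractionally into the boxes `BV` and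
the extra box `V₀`: each item is cut by vertical lines into finitely many slices of its full
height, the widths of which are integral and add up to the width of the item, each slice `s k` is
placed inside a container (`some b` stands for `BV b`, and `none` for `V₀`), and slices in the same
container do not overlap. -/
def Setting.PacksVerticalFractionally {ι : Type*} (σ : Setting ι) (q : Rounding ι) {nV : ℕ}
    (BV : Fin nV → Box) : Prop :=
  ∃ (m : ℕ) (item : Fin m → ι) (s : Fin m → Box) (c : Fin m → Option (Fin nV)),
    (∀ k, σ.IsV (item k) ∧ (s k).h = q.height (item k)) ∧
    (∀ i, σ.IsV i → ∑ k with item k = i, (s k).w = σ.w i) ∧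
    (∀ k b, c k = some b → (s k).Within (BV b)) ∧
    (∀ k, c k = none → σ.WithinV0 (s k)) ∧
    ∀ k k', k ≠ k' → c k = c k' → ¬ (s k).Overlap (s k')

end StripPacking

/-! ### Boxes and integral columns -/

namespace StripPacking

/-! Write τ = (1/3 + ε)OPT (`tallMin`) and u = εOPT (`unit`). The packing area has height (1 +
2ε)OPT < 3τ, so no column contains three tall items. In a box of `B_{T ∪ V}`, each unit column thus
has at most one tall item in a bottom row (starting less than τ above the floor of the box) and at
most one in a top row.

Enlargement. A point at height y is lifted by 0, 2u or 3u, according to whether y < τ, τ ≤ y < 2τ or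
2τ ≤ y (`shift`, `stretch`). The map is monotone, so the boxes stay disjoint. Climbing by τ gains at
least u, which pays for rounding a tall item. A box with two tall items in one column gains 3u,
while its two rows need at most 2u more; a spare u remains in that column.

Rearrangement. A tall item lying horizontally inside its box is pushed to the floor or the ceiling.
One that sticks out of the box keeps its columns and is only lifted. The columns of the two rows are
then permuted separately, where a column is described by a key whose main entry is the height it
uses up. If one row is sorted increasingly and the other decreasingly, facing columns still fit
together, by pigeonhole (`rearr_sort`). The items that stick out require the corner columns to stay,
which forbids one global sort. Cutting the row at columns incompatible with a corner, and inducting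
on the number of keys below the corner key, gives O(K²) changes of keys for K keys (`rearr_all`).
Here K = O(1/ε): the multiples of u and four corner keys.

Vertical items. They are cut into slices of width 1. A slice under or above an item that sticks out
stays in that pocket; the other slices of a column form one stack. If the column has at most one
tall item, its stack either travels with a filler key in an unoccupied row or, when the tall item is
very high, stays facing it. Stacks of columns with two tall items must go to the free middle part of
some column. The permutations preserve the total free height of the relevant columns, and the spare
u per column shows that all but a fraction 1 - 2ε of the width of the box can be served
(`exists_matching`); this is where ε ≤ 1/24 is needed. The remaining stacks stand side by side in
`V₀`. Each is lower than τ, and the boxes they come from are at least 2τ high, so these boxes occupy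
disjoint horizontal ranges of total width at most W (`card_unsaved_le`).

Counting. Each of the O(1/(εδ²)) boxes yields O(1/ε²) blocks, and each item that sticks out gets a
box of its own.

Existence of a rounded packing and of a box partition is a separate argument. An optimal packing is
scaled vertically by 1 + 2ε, which leaves each item room for rounding. Then the area is divided into
rows of height εδOPT, and the corners of the regions free of large and horizontal items are charged
to runs of blocked cells, of which a row has at most 1/δ (`card_freeBlocks_le`). -/

open Classical in
-- Horizontal extents are integral, so only the unit column `⌊p⌋₊` matters. Overlaps and unions can
-- therefore be tested at integral abscissas.
theorem Box.mem_region_iff (B : Box) (p v : ℝ) :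
    (p, v) ∈ B.region ↔ 0 ≤ p ∧ B.x ≤ ⌊p⌋₊ ∧ ⌊p⌋₊ < B.x + B.w ∧ B.y ≤ v ∧ v < B.y + B.h := by
  simp only [Box.region, Set.mem_prod, Set.mem_Ico]
  constructor
  · rintro ⟨⟨h1, h2⟩, h3, h4⟩
    have h0 : (0 : ℝ) ≤ p := le_trans (Nat.cast_nonneg _) h1
    refine ⟨h0, Nat.le_floor h1, ?_, h3, h4⟩
    rw [Nat.floor_lt h0]
    exact_mod_cast h2
  · rintro ⟨h0, h1, h2, h3, h4⟩
    rw [Nat.floor_lt h0] at h2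
    exact ⟨⟨(Nat.le_floor_iff h0).1 h1, by exact_mod_cast h2⟩, h3, h4⟩

theorem Box.natCast_mem_region_iff (B : Box) (x : ℕ) (v : ℝ) :
    ((x : ℝ), v) ∈ B.region ↔ B.x ≤ x ∧ x < B.x + B.w ∧ B.y ≤ v ∧ v < B.y + B.h := by
  rw [Box.mem_region_iff]
  simp

theorem Box.overlap_iff (A B : Box) :
    A.Overlap B ↔ ∃ (x : ℕ) (v : ℝ), (A.x ≤ x ∧ x < A.x + A.w ∧ A.y ≤ v ∧ v < A.y + A.h) ∧
      (B.x ≤ x ∧ x < B.x + B.w ∧ B.y ≤ v ∧ v < B.y + B.h) := by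
  constructor
  · rintro ⟨⟨p, v⟩, h1, h2⟩
    rw [Box.mem_region_iff] at h1 h2
    exact ⟨⌊p⌋₊, v, h1.2, h2.2⟩
  · rintro ⟨x, v, h1, h2⟩
    exact ⟨((x : ℝ), v), (A.natCast_mem_region_iff x v).2 h1, (B.natCast_mem_region_iff x v).2 h2⟩

theorem Box.disjoint_iff (A B : Box) :
    Disjoint A.region B.region ↔ ¬ A.Overlap B := by
  rw [Set.disjoint_iff_inter_eq_empty, Box.Overlap, Set.not_nonempty_iff_eq_empty]

/-! ### Maximal runs of consecutive numbers -/

/-- The first element of the maximal run of consecutive numbers satisfying `p` that contains `x`. -/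
noncomputable def runLo (p : ℕ → Prop) (x : ℕ) : ℕ :=
  sInf {a | a ≤ x ∧ ∀ y, a ≤ y → y ≤ x → p y}

/-- The end of the maximal run of consecutive numbers satisfying `p` that contains `x`. -/
noncomputable def runHi (p : ℕ → Prop) (x : ℕ) : ℕ :=
  sInf {b | x < b ∧ ¬ p b}

section Run

variable {p : ℕ → Prop} {x : ℕ}

theorem runLo_mem (hx : p x) : runLo p x ≤ x ∧ ∀ y, runLo p x ≤ y → y ≤ x → p y :=
  Nat.sInf_mem (s := {a | a ≤ x ∧ ∀ y, a ≤ y → y ≤ x → p y})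
    ⟨x, le_rfl, fun _ h1 h2 => le_antisymm h2 h1 ▸ hx⟩

theorem runLo_le (hx : p x) : runLo p x ≤ x := (runLo_mem hx).1

theorem runLo_start (hx : p x) : runLo p x = 0 ∨ ¬ p (runLo p x - 1) := by
  by_contra! h
  have h1 := runLo_mem hx
  have : runLo p x ≤ runLo p x - 1 := by
    refine Nat.sInf_le ⟨by omega, fun y hy1 hy2 => ?_⟩
    rcases Nat.lt_or_ge y (runLo p x) with h3 | h3
    · have : y = runLo p x - 1 := by omega
      rw [this]; exact h.2
    · exact h1.2 y h3 hy2
  omega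

theorem runHi_mem (hb : ∃ b, x < b ∧ ¬ p b) : x < runHi p x ∧ ¬ p (runHi p x) :=
  Nat.sInf_mem (s := {b | x < b ∧ ¬ p b}) hb

theorem runHi_all (hx : p x) {y : ℕ} (h1 : x ≤ y) (h2 : y < runHi p x) : p y := by
  by_contra h
  rcases h1.eq_or_lt with rfl | h1
  · exact h hx
  · exact absurd (Nat.sInf_le (s := {b | x < b ∧ ¬ p b}) ⟨h1, h⟩) (not_le.2 h2)

theorem run_all (hx : p x) {y : ℕ} (h1 : runLo p x ≤ y) (h2 : y < runHi p x) : p y := by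
  rcases le_total x y with h | h
  · exact runHi_all hx h h2
  · exact (runLo_mem hx).2 y h1 h

theorem runLo_le_of_all {a : ℕ} (ha : a ≤ x) (h : ∀ y, a ≤ y → y ≤ x → p y) : runLo p x ≤ a :=
  Nat.sInf_le ⟨ha, h⟩

theorem le_runHi_of_all (hb : ∃ b, x < b ∧ ¬ p b) {b : ℕ} (h : ∀ y, x ≤ y → y < b → p y) :
    b ≤ runHi p x := by
  by_contra! h1
  have := runHi_mem hb
  exact this.2 (h _ this.1.le h1)

theorem runLo_eq_of_start (hx : p x) {a : ℕ} (ha : a ≤ x) (h : ∀ y, a ≤ y → y ≤ x → p y)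
    (hs : a = 0 ∨ ¬ p (a - 1)) : runLo p x = a := by
  refine le_antisymm (runLo_le_of_all ha h) ?_
  by_contra! h1
  rcases hs with rfl | hs
  · omega
  · exact hs ((runLo_mem hx).2 _ (by omega) (by omega))

theorem runHi_eq_of_all {b : ℕ} (hb : x < b) (h : ∀ y, x ≤ y → y < b → p y) (hn : ¬ p b) :
    runHi p x = b :=
  le_antisymm (Nat.sInf_le ⟨hb, hn⟩) (le_runHi_of_all ⟨b, hb, hn⟩ h)

theorem run_congr (hb : ∃ b, x < b ∧ ¬ p b) (hx : p x) {y : ℕ} (h1 : runLo p x ≤ y)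
    (h2 : y < runHi p x) : runLo p y = runLo p x ∧ runHi p y = runHi p x :=
  ⟨runLo_eq_of_start (run_all hx h1 h2) h1 (fun z hz1 hz2 => run_all hx hz1 (by omega))
    (runLo_start hx),
  runHi_eq_of_all h2 (fun z hz1 hz2 => run_all hx (by omega) hz2) (runHi_mem hb).2⟩

open Classical in
/-- The first elements of the maximal runs of `p` below `W`. -/
noncomputable def runStarts (p : ℕ → Prop) (W : ℕ) : Finset ℕ :=
  {x ∈ Finset.range W | p x ∧ (x = 0 ∨ ¬ p (x - 1))}

open Classical in
-- The maximal runs are disjoint. An interval on which `p` holds and which covers the first element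
-- of a run cannot begin earlier, so it lies in the run, and the run has length at least `w`.
theorem card_runStarts_mul_le {W : ℕ} {w : ℝ} (hp : ∀ x, p x → x < W)
    (hw : ∀ x, p x → ∃ a b : ℕ, a ≤ x ∧ x < b ∧ (∀ y, a ≤ y → y < b → p y) ∧
      w ≤ (b : ℝ) - a) :
    ((runStarts p W).card : ℝ) * w ≤ (({x ∈ Finset.range W | p x}).card : ℝ) := by
  have hb : ∀ x, x < W → ∃ b, x < b ∧ ¬ p b := fun x hx => ⟨W, hx, fun h => (hp _ h).false⟩
  have hdisj : Set.PairwiseDisjoint (runStarts p W : Set ℕ)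
      (fun s => Finset.Ico s (runHi p s)) := by
    intro s hs t ht hst
    simp only [runStarts, Finset.coe_filter, Finset.mem_range, Set.mem_ofPred_eq] at hs ht
    have key : ∀ u s : ℕ, p s → (u = 0 ∨ ¬ p (u - 1)) → s < u → runHi p s ≤ u := by
      intro u s hps hu hsu
      by_contra! h
      rcases hu with rfl | hu
      · omega
      · exact hu (runHi_all hps (by omega) (by omega))
    rw [Function.onFun, Finset.disjoint_left]
    intro y hy1 hy2
    rw [Finset.mem_Ico] at hy1 hy2
    rcases lt_or_gt_of_ne hst with h | h
    · have := key t s hs.2.1 ht.2.2 h; omega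
    · have := key s t ht.2.1 hs.2.2 h; omega
  have hsub : (runStarts p W).biUnion (fun s => Finset.Ico s (runHi p s)) ⊆
      {x ∈ Finset.range W | p x} := by
    intro y hy
    simp only [runStarts, Finset.mem_biUnion, Finset.mem_filter, Finset.mem_range,
      Finset.mem_Ico] at hy ⊢
    obtain ⟨s, ⟨hs1, hs2, hs3⟩, h1, h2⟩ := hy
    have := runHi_all hs2 h1 h2
    exact ⟨hp _ this, this⟩
  have h1 := Finset.card_le_card hsub
  rw [Finset.card_biUnion hdisj] at h1
  refine le_trans ?_ (Nat.cast_le.2 h1)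
  rw [Nat.cast_sum, ← nsmul_eq_mul]
  refine Finset.card_nsmul_le_sum _ _ _ fun s hs => ?_
  simp only [runStarts, Finset.mem_filter, Finset.mem_range] at hs
  obtain ⟨a, b, ha, hsb, hall, hwab⟩ := hw s hs.2.1
  have hsa : a = s := by
    by_contra h
    rcases hs.2.2 with h0 | h0
    · omega
    · exact h0 (hall _ (by omega) (by omega))
  subst hsa
  have h2 := le_runHi_of_all (hb a hs.1) hall
  rw [Nat.card_Ico, Nat.cast_sub (by omega)]
  have : (b : ℝ) ≤ runHi p a := Nat.cast_le.2 h2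
  linarith

open Classical in
theorem card_runEnds_le (p : ℕ → Prop) (W : ℕ) :
    ({x ∈ Finset.range W | 0 < x ∧ p (x - 1) ∧ ¬ p x}).card ≤ (runStarts p W).card := by
  refine Finset.card_le_card_of_injOn (fun x => runLo p (x - 1)) ?_ ?_
  · intro x hx
    simp only [Finset.coe_filter, Finset.mem_range, Set.mem_ofPred_eq, runStarts] at hx ⊢
    have h1 := runLo_mem hx.2.2.1
    exact ⟨by omega, h1.2 _ le_rfl h1.1, runLo_start hx.2.2.1⟩
  · intro x hx y hy hxy
    simp only [Finset.coe_filter, Finset.mem_range, Set.mem_ofPred_eq] at hx hy hxy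
    have h1 := runLo_mem hx.2.2.1
    have h2 := runLo_mem hy.2.2.1
    by_contra hne
    rcases lt_or_gt_of_ne hne with h | h
    · exact hx.2.2.2 (h2.2 x (by omega) (by omega))
    · exact hy.2.2.2 (h1.2 y (by omega) (by omega))

end Run

/-! ### Rearranging two facing rows -/

/-- `p` permutes the columns `l, …, r - 1` of a row with keys `b`, such that adjacent columns with
equal keys remain adjacent, and afterwards the key changes only at positions in `S`. -/
structure IsRow {α : Type*} (b : ℕ → α) (l r : ℕ) (p : ℕ → ℕ) (S : Finset ℕ) : Prop where
  mapsTo : ∀ x, l ≤ x → x < r → l ≤ p x ∧ p x < r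
  inj : ∀ x y, l ≤ x → x < r → l ≤ y → y < r → p x = p y → x = y
  rigid : ∀ x, l ≤ x → x + 1 < r → b x = b (x + 1) → p (x + 1) = p x + 1
  breaks : ∀ x y, l ≤ x → x < r → l ≤ y → y < r → p y = p x + 1 → p y ∉ S → b x = b y

/-- The two rows `b` and `t` can be rearranged between `l` and `r` such that columns remain
compatible; the four propositions tell which corner columns keep their places. -/
def Rearr {α β : Type*} (R : α → β → Prop) (b : ℕ → α) (t : ℕ → β) (l r : ℕ)
    (fbl ftl fbr ftr : Prop) (M : ℕ) : Prop :=
  ∃ (pb pt : ℕ → ℕ) (S : Finset ℕ), S.card ≤ M ∧ IsRow b l r pb S ∧ IsRow t l r pt S ∧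
    (∀ x y, l ≤ x → x < r → l ≤ y → y < r → pb x = pt y → R (b x) (t y)) ∧
    (fbl → pb l = l) ∧ (ftl → pt l = l) ∧ (fbr → pb (r - 1) = r - 1) ∧ (ftr → pt (r - 1) = r - 1)

/-! ### Stable sorting of columns -/

section StableSort

variable {γ : Type*} [LinearOrder γ]

/-- Column `z` precedes column `x` when columns are sorted stably by `f`. -/
def Precedes (f : ℕ → γ) (z x : ℕ) : Prop := f z < f x ∨ (f z = f x ∧ z < x)

open Classical in
/-- The position of column `x` when the columns from `l` to `r - 1` are sorted stably by `f`. -/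
noncomputable def sortPos (f : ℕ → γ) (l r x : ℕ) : ℕ :=
  l + ({z ∈ Finset.Ico l r | Precedes f z x}).card

variable {f : ℕ → γ} {l r : ℕ}

theorem Precedes.trans {x y z : ℕ} (h1 : Precedes f x y) (h2 : Precedes f y z) :
    Precedes f x z := by
  rcases h1 with h1 | ⟨h1, h1'⟩ <;> rcases h2 with h2 | ⟨h2, h2'⟩
  · exact Or.inl (h1.trans h2)
  · exact Or.inl (h2 ▸ h1)
  · exact Or.inl (h1 ▸ h2)
  · exact Or.inr ⟨h1.trans h2, h1'.trans h2'⟩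

theorem not_precedes_self (x : ℕ) : ¬ Precedes f x x := by
  rintro (h | ⟨_, h⟩)
  · exact lt_irrefl _ h
  · exact lt_irrefl _ h

theorem precedes_total {x y : ℕ} (h : x ≠ y) : Precedes f x y ∨ Precedes f y x := by
  unfold Precedes
  rcases lt_trichotomy (f x) (f y) with h1 | h1 | h1
  · exact Or.inl (Or.inl h1)
  · rcases lt_or_gt_of_ne h with h2 | h2
    · exact Or.inl (Or.inr ⟨h1, h2⟩)
    · exact Or.inr (Or.inr ⟨h1.symm, h2⟩)
  · exact Or.inr (Or.inl h1)

theorem sortPos_lt {x y : ℕ} (hx : l ≤ x) (hxr : x < r) (h : Precedes f x y) :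
    sortPos f l r x < sortPos f l r y := by
  classical
  unfold sortPos
  refine Nat.add_lt_add_left (Finset.card_lt_card ?_) _
  rw [Finset.ssubset_iff_of_subset]
  · exact ⟨x, by simp [hx, hxr, h], by simp [not_precedes_self]⟩
  · intro z hz
    simp only [Finset.mem_filter] at hz ⊢
    exact ⟨hz.1, hz.2.trans h⟩

theorem sortPos_lt_iff {x y : ℕ} (hx : l ≤ x) (hxr : x < r) (hy : l ≤ y) (hyr : y < r) :
    sortPos f l r x < sortPos f l r y ↔ Precedes f x y := by
  refine ⟨fun h => ?_, sortPos_lt hx hxr⟩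
  have hne : x ≠ y := by rintro rfl; exact lt_irrefl _ h
  rcases precedes_total (f := f) hne with h1 | h1
  · exact h1
  · exact absurd (sortPos_lt hy hyr h1) (not_lt.2 h.le)

theorem sortPos_mem {x : ℕ} (hx : l ≤ x) (hxr : x < r) :
    l ≤ sortPos f l r x ∧ sortPos f l r x < r := by
  classical
  refine ⟨Nat.le_add_right _ _, ?_⟩
  have : ({z ∈ Finset.Ico l r | Precedes f z x}).card < (Finset.Ico l r).card := by
    refine Finset.card_lt_card ?_
    rw [Finset.ssubset_iff_of_subset (Finset.filter_subset _ _)]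
    exact ⟨x, by simp [hx, hxr], by simp [not_precedes_self]⟩
  rw [Nat.card_Ico] at this
  unfold sortPos
  omega

open Classical in
theorem sortPos_add_card {x : ℕ} (hx : l ≤ x) (hxr : x < r) :
    sortPos f l r x + ({z ∈ Finset.Ico l r | ¬ Precedes f z x}).card = r := by
  unfold sortPos
  rw [add_assoc, Finset.card_filter_add_card_filter_not, Nat.card_Ico]
  omega

theorem sortPos_first (h : ∀ x, l ≤ x → x < r → f l ≤ f x) :
    sortPos f l r l = l := by
  classical
  unfold sortPos
  rw [Finset.card_eq_zero.2, add_zero]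
  refine Finset.filter_eq_empty_iff.2 fun z hz => ?_
  rw [Finset.mem_Ico] at hz
  rintro (h1 | ⟨_, h1⟩)
  · exact absurd h1 (not_lt.2 (h z hz.1 hz.2))
  · omega

theorem sortPos_last (hlr : l < r) (h : ∀ x, l ≤ x → x < r → f x ≤ f (r - 1)) :
    sortPos f l r (r - 1) = r - 1 := by
  classical
  have h1 := sortPos_add_card (f := f) (l := l) (r := r) (x := r - 1) (by omega) (by omega)
  have h2 : ({z ∈ Finset.Ico l r | ¬ Precedes f z (r - 1)}) = {r - 1} := by
    ext z
    simp only [Finset.mem_filter, Finset.mem_Ico, Finset.mem_singleton]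
    constructor
    · rintro ⟨⟨hz1, hz2⟩, h3⟩
      by_contra hne
      exact h3 ((h z hz1 hz2).lt_or_eq.imp id fun h4 => ⟨h4, by omega⟩)
    · rintro rfl
      exact ⟨⟨by omega, by omega⟩, not_precedes_self _⟩
  rw [h2, Finset.card_singleton] at h1
  omega

/-- After sorting, each key occupies consecutive positions, and only its first column can follow a
column with another key. This gives at most one break per key. Stability keeps neighbours with equal
keys adjacent, so items are not torn apart. -/
theorem exists_sort_isRow (f : ℕ → γ) (l r : ℕ) (A : Finset γ)
    (hA : ∀ x, l ≤ x → x < r → f x ∈ A) :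
    ∃ S : Finset ℕ, S.card ≤ A.card ∧ IsRow f l r (sortPos f l r) S := by
  classical
  set Y := {y ∈ Finset.Ico l r | ∃ x, l ≤ x ∧ x < r ∧ sortPos f l r y = sortPos f l r x + 1 ∧
    f x ≠ f y} with hY
  refine ⟨Y.image (sortPos f l r), ?_, ⟨fun x hx hxr => sortPos_mem hx hxr, ?_, ?_, ?_⟩⟩
  · refine Finset.card_image_le.trans ?_
    refine Finset.card_le_card_of_injOn f ?_ ?_
    · intro y hy
      have hy' := (Finset.mem_filter.1 (Finset.mem_coe.1 hy)).1
      exact Finset.mem_coe.2 (hA y (Finset.mem_Ico.1 hy').1 (Finset.mem_Ico.1 hy').2)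
    · have key : ∀ y1 y2, l ≤ y1 → y1 < r → l ≤ y2 → y2 < r →
          (∃ x, l ≤ x ∧ x < r ∧ sortPos f l r y2 = sortPos f l r x + 1 ∧ f x ≠ f y2) →
          f y1 = f y2 → ¬ y1 < y2 := by
        rintro y1 y2 h1 h1' h2 h2' ⟨x, hx, hxr, hp, hne⟩ heq hlt
        have h3 := sortPos_lt (f := f) (l := l) (r := r) h1 h1' (Or.inr ⟨heq, hlt⟩)
        have h4 : Precedes f x y2 := (sortPos_lt_iff hx hxr h2 h2').1 (by omega)
        have h5 : ¬ Precedes f x y1 := fun h => by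
          have := sortPos_lt (f := f) (l := l) (r := r) hx hxr h
          omega
        rcases h4 with h4 | h4
        · exact h5 (Or.inl (heq ▸ h4))
        · exact hne h4.1
      intro y1 hy1 y2 hy2 heq
      have hy1 := Finset.mem_filter.1 (Finset.mem_coe.1 hy1)
      have hy2 := Finset.mem_filter.1 (Finset.mem_coe.1 hy2)
      have hy1' := Finset.mem_Ico.1 hy1.1
      have hy2' := Finset.mem_Ico.1 hy2.1
      have k1 := key y1 y2 hy1'.1 hy1'.2 hy2'.1 hy2'.2 hy2.2 heq
      have k2 := key y2 y1 hy2'.1 hy2'.2 hy1'.1 hy1'.2 hy1.2 heq.symm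
      omega
  · intro x y hx hxr hy hyr h
    by_contra hne
    rcases precedes_total (f := f) hne with h1 | h1
    · exact absurd (sortPos_lt hx hxr h1) (by rw [h]; exact lt_irrefl _)
    · exact absurd (sortPos_lt hy hyr h1) (by rw [h]; exact lt_irrefl _)
  · intro x hx hxr h
    have : ({z ∈ Finset.Ico l r | Precedes f z (x + 1)}) =
        insert x ({z ∈ Finset.Ico l r | Precedes f z x}) := by
      ext z
      rw [Finset.mem_filter, Finset.mem_insert, Finset.mem_filter]
      simp only [Finset.mem_Ico, Precedes, ← h]
      constructor
      · rintro ⟨h1, h2 | ⟨h2, h3⟩⟩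
        · exact Or.inr ⟨h1, Or.inl h2⟩
        · rcases Nat.lt_succ_iff_lt_or_eq.1 h3 with h4 | h4
          · exact Or.inr ⟨h1, Or.inr ⟨h2, h4⟩⟩
          · exact Or.inl h4
      · rintro (rfl | ⟨h1, h2 | ⟨h2, h3⟩⟩)
        · exact ⟨⟨hx, by omega⟩, Or.inr ⟨rfl, by omega⟩⟩
        · exact ⟨h1, Or.inl h2⟩
        · exact ⟨h1, Or.inr ⟨h2, by omega⟩⟩
    unfold sortPos
    rw [this, Finset.card_insert_of_notMem, add_assoc]
    simp [not_precedes_self]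
  · intro x y hx hxr hy hyr h hS
    by_contra hne
    exact hS (Finset.mem_image.2 ⟨y, Finset.mem_filter.2
      ⟨Finset.mem_Ico.2 ⟨hy, hyr⟩, x, hx, hxr, h, hne⟩, rfl⟩)

end StableSort

/-! ### Rearrangements that respect the corner columns -/

section Reorder

variable {α β : Type*} {R : α → β → Prop} {b : ℕ → α} {t : ℕ → β} {l r : ℕ}

theorem IsRow.mono {γ : Type*} {f : ℕ → γ} {l r : ℕ} {p : ℕ → ℕ} {S S' : Finset ℕ}
    (h : IsRow f l r p S) (hS : S ⊆ S') : IsRow f l r p S' :=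
  ⟨h.mapsTo, h.inj, h.rigid, fun x y h1 h2 h3 h4 h5 h6 =>
    h.breaks x y h1 h2 h3 h4 h5 fun h7 => h6 (hS h7)⟩

theorem IsRow.congr {γ δ : Type*} {f : ℕ → γ} {g : ℕ → δ} {l r : ℕ} {p : ℕ → ℕ} {S : Finset ℕ}
    (h : IsRow f l r p S)
    (h1 : ∀ x, l ≤ x → x + 1 < r → g x = g (x + 1) → f x = f (x + 1))
    (h2 : ∀ x y, l ≤ x → x < r → l ≤ y → y < r → f x = f y → g x = g y) :
    IsRow g l r p S :=
  ⟨h.mapsTo, h.inj, fun x hx hxr hg => h.rigid x hx hxr (h1 x hx hxr hg),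
    fun x y a1 a2 a3 a4 a5 a6 => h2 x y a1 a2 a3 a4 (h.breaks x y a1 a2 a3 a4 a5 a6)⟩

theorem Rearr.mono {fbl ftl fbr ftr fbl' ftl' fbr' ftr' : Prop} {M M' : ℕ}
    (h : Rearr R b t l r fbl ftl fbr ftr M) (h1 : fbl' → fbl) (h2 : ftl' → ftl) (h3 : fbr' → fbr)
    (h4 : ftr' → ftr) (hM : M ≤ M') : Rearr R b t l r fbl' ftl' fbr' ftr' M' := by
  obtain ⟨pb, pt, S, a1, a2, a3, a4, a5, a6, a7, a8⟩ := h
  exact ⟨pb, pt, S, a1.trans hM, a2, a3, a4, fun h => a5 (h1 h), fun h => a6 (h2 h),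
    fun h => a7 (h3 h), fun h => a8 (h4 h)⟩

theorem Rearr.swap {fbl ftl fbr ftr : Prop} {M : ℕ}
    (h : Rearr (flip R) t b l r ftl fbl ftr fbr M) : Rearr R b t l r fbl ftl fbr ftr M := by
  obtain ⟨pb, pt, S, a1, a2, a3, a4, a5, a6, a7, a8⟩ := h
  exact ⟨pt, pb, S, a1, a3, a2, fun x y h1 h2 h3 h4 h5 => a4 y x h3 h4 h1 h2 h5.symm, a6, a5,
    a8, a7⟩

/-- The two parts are rearranged independently. The only danger is an item that crosses the cut; if
the keys on both sides of it agree, both adjacent columns must stay in place. Much of the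
bookkeeping about fixed corners below serves this condition. -/
theorem IsRow.append {γ : Type*} {f : ℕ → γ} {l m r : ℕ} {p q : ℕ → ℕ} {S T : Finset ℕ}
    (hlm : l < m) (hmr : m < r) (h1 : IsRow f l m p S) (h2 : IsRow f m r q T)
    (hc : f (m - 1) = f m → p (m - 1) = m - 1 ∧ q m = m) :
    IsRow f l r (fun x => if x < m then p x else q x) (insert m (S ∪ T)) := by
  refine ⟨?_, ?_, ?_, ?_⟩
  · intro x hx hxr
    split_ifs with h
    · have := h1.mapsTo x hx h; omega
    · have := h2.mapsTo x (by omega) hxr; omega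
  · intro x y hx hxr hy hyr
    split_ifs with h h' h'
    · exact h1.inj x y hx h hy h'
    · have := h1.mapsTo x hx h
      have := h2.mapsTo y (by omega) hyr
      omega
    · have := h2.mapsTo x (by omega) hxr
      have := h1.mapsTo y hy h'
      omega
    · exact h2.inj x y (by omega) hxr (by omega) hyr
  · intro x hx hxr hf
    by_cases h : x + 1 < m
    · rw [if_pos h, if_pos (by omega)]
      exact h1.rigid x hx h hf
    · by_cases h' : x < m
      · have hxm : x = m - 1 := by omega
        have hxm' : x + 1 = m := by omega
        rw [hxm', hxm] at hf
        rw [if_neg h, if_pos h', hxm', hxm, (hc hf).1, (hc hf).2]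
        omega
      · rw [if_neg h, if_neg h']
        exact h2.rigid x (by omega) hxr hf
  · intro x y hx hxr hy hyr
    split_ifs with h h' h' <;> intro he hS <;>
      simp only [Finset.mem_insert, Finset.mem_union, not_or] at hS
    · exact h1.breaks x y hx h' hy h he hS.2.1
    · have := h1.mapsTo y hy h
      have := h2.mapsTo x (by omega) hxr
      omega
    · have := h2.mapsTo y (by omega) hyr
      have := h1.mapsTo x hx h'
      omega
    · exact h2.breaks x y (by omega) hxr (by omega) hyr he hS.2.2

theorem Rearr.append {fbl ftl fbr ftr fbm ftm fbm' ftm' : Prop} {M M' m : ℕ}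
    (hlm : l < m) (hmr : m < r)
    (h1 : Rearr R b t l m fbl ftl fbm ftm M) (h2 : Rearr R b t m r fbm' ftm' fbr ftr M')
    (hb : b (m - 1) = b m → fbm ∧ fbm') (ht : t (m - 1) = t m → ftm ∧ ftm') :
    Rearr R b t l r fbl ftl fbr ftr (M + M' + 1) := by
  obtain ⟨pb, pt, S, a1, a2, a3, a4, a5, a6, a7, a8⟩ := h1
  obtain ⟨qb, qt, T, c1, c2, c3, c4, c5, c6, c7, c8⟩ := h2
  refine ⟨_, _, insert m (S ∪ T), ?_,
    a2.append hlm hmr c2 fun h => ⟨a7 (hb h).1, c5 (hb h).2⟩,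
    a3.append hlm hmr c3 fun h => ⟨a8 (ht h).1, c6 (ht h).2⟩, ?_, ?_, ?_, ?_, ?_⟩
  · have := Finset.card_insert_le m (S ∪ T)
    have := Finset.card_union_le S T
    omega
  · intro x y hx hxr hy hyr
    split_ifs with h h' h' <;> intro he
    · exact a4 x y hx h hy h' he
    · have := a2.mapsTo x hx h
      have := c3.mapsTo y (by omega) hyr
      omega
    · have := c2.mapsTo x (by omega) hxr
      have := a3.mapsTo y hy h'
      omega
    · exact c4 x y (by omega) hxr (by omega) hyr he
  · intro h; rw [if_pos hlm]; exact a5 h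
  · intro h; rw [if_pos hlm]; exact a6 h
  · intro h; rw [if_neg (by omega)]; exact c7 h
  · intro h; rw [if_neg (by omega)]; exact c8 h

open Classical in
/-- The key of a column, replaced by `⊥` in the first run of equal keys. -/
noncomputable def firstKey (b : ℕ → α) (l : ℕ) (F : Prop) (x : ℕ) : WithBot α :=
  if F ∧ ∀ y, l ≤ y → y ≤ x → b y = b l then ⊥ else (b x : WithBot α)

open Classical in
/-- The key of a column, replaced by `⊥` in the last run of equal keys. -/
noncomputable def lastKey (b : ℕ → α) (r : ℕ) (F : Prop) (x : ℕ) : WithBot α :=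
  if F ∧ ∀ y, x ≤ y → y < r → b y = b (r - 1) then ⊥ else (b x : WithBot α)

theorem firstKey_congr {F : Prop} {x : ℕ} (hx : l ≤ x) (h : b x = b (x + 1)) :
    firstKey b l F x = firstKey b l F (x + 1) := by
  unfold firstKey
  have : (F ∧ ∀ y, l ≤ y → y ≤ x → b y = b l) ↔ (F ∧ ∀ y, l ≤ y → y ≤ x + 1 → b y = b l) := by
    refine and_congr_right fun _ => ⟨fun h1 y hy1 hy2 => ?_, fun h1 y hy1 hy2 => h1 y hy1 (by omega)⟩
    rcases Nat.le_succ_iff.1 hy2 with h2 | h2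
    · exact h1 y hy1 h2
    · rw [h2, ← h]; exact h1 x hx le_rfl
  split_ifs with h1 h2 h2
  · rfl
  · exact absurd (this.1 h1) h2
  · exact absurd (this.2 h2) h1
  · rw [h]

theorem lastKey_congr {F : Prop} {x : ℕ} (hx : x + 1 < r) (h : b x = b (x + 1)) :
    lastKey b r F x = lastKey b r F (x + 1) := by
  unfold lastKey
  have : (F ∧ ∀ y, x ≤ y → y < r → b y = b (r - 1)) ↔
      (F ∧ ∀ y, x + 1 ≤ y → y < r → b y = b (r - 1)) := by
    refine and_congr_right fun _ => ⟨fun h1 y hy1 hy2 => h1 y (by omega) hy2, fun h1 y hy1 hy2 => ?_⟩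
    rcases hy1.eq_or_lt with h2 | h2
    · rw [← h2, h]; exact h1 (x + 1) le_rfl hx
    · exact h1 y h2 hy2
  split_ifs with h1 h2 h2
  · rfl
  · exact absurd (this.1 h1) h2
  · exact absurd (this.2 h2) h1
  · rw [h]

theorem eq_of_firstKey_eq {F : Prop} {x y : ℕ} (hx : l ≤ x) (hy : l ≤ y)
    (h : firstKey b l F x = firstKey b l F y) : b x = b y := by
  unfold firstKey at h
  split_ifs at h with h1 h2 h2
  · rw [h1.2 x hx le_rfl, h2.2 y hy le_rfl]
  · exact absurd h.symm WithBot.coe_ne_bot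
  · exact absurd h WithBot.coe_ne_bot
  · exact WithBot.coe_injective h

theorem eq_of_lastKey_eq {F : Prop} {x y : ℕ} (hx : x < r) (hy : y < r)
    (h : lastKey b r F x = lastKey b r F y) : b x = b y := by
  unfold lastKey at h
  split_ifs at h with h1 h2 h2
  · rw [h1.2 x le_rfl hx, h2.2 y le_rfl hy]
  · exact absurd h.symm WithBot.coe_ne_bot
  · exact absurd h WithBot.coe_ne_bot
  · exact WithBot.coe_injective h

theorem rearr_const (h : ∀ x, l ≤ x → x < r → R (b x) (t x))
    (hc : ∀ x, l ≤ x → x < r → b x = b l ∧ t x = t l) :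
    Rearr R b t l r True True True True 0 := by
  refine ⟨id, id, ∅, le_rfl, ⟨fun x hx hxr => ⟨hx, hxr⟩, fun x y _ _ _ _ h => h, fun _ _ _ _ => rfl,
    fun x y hx hxr hy hyr _ _ => ?_⟩, ⟨fun x hx hxr => ⟨hx, hxr⟩, fun x y _ _ _ _ h => h,
    fun _ _ _ _ => rfl, fun x y hx hxr hy hyr _ _ => ?_⟩, fun x y hx hxr _ _ he => ?_,
    fun _ => rfl, fun _ => rfl, fun _ => rfl, fun _ => rfl⟩
  · rw [(hc x hx hxr).1, (hc y hy hyr).1]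
  · rw [(hc x hx hxr).2, (hc y hy hyr).2]
  · have he : x = y := he
    exact he ▸ h x hx hxr

section Main

variable [LinearOrder α] [LinearOrder β] {A : Finset α} {B : Finset β} {K : ℕ}

/-- The bottom row is sorted increasingly and the top row decreasingly. A corner column that is
extremal in this order stays by itself. The other two corners can be forced to stay by giving their
runs the key `⊥`; this is harmless if the corner key is compatible with the whole opposite row. -/
theorem rearr_sort (hR : ∀ a a' c c', a' ≤ a → c' ≤ c → R a c → R a' c') (hlr : l < r)
    (h : ∀ x, l ≤ x → x < r → R (b x) (t x))
    (hA : ∀ x, l ≤ x → x < r → b x ∈ A) (hB : ∀ x, l ≤ x → x < r → t x ∈ B)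
    (hAK : A.card ≤ K) (hBK : B.card ≤ K) {fbl ftr : Prop}
    (hbl : fbl → ∀ x, l ≤ x → x < r → R (b l) (t x))
    (htr : ftr → ∀ x, l ≤ x → x < r → R (b x) (t (r - 1))) :
    Rearr R b t l r fbl (∀ x, l ≤ x → x < r → t x ≤ t l) (∀ x, l ≤ x → x < r → b x ≤ b (r - 1))
      ftr (2 * K + 2) := by
  classical
  obtain ⟨S, hS, hrow⟩ := exists_sort_isRow (firstKey b l fbl) l r
    (insert ⊥ (A.image fun a : α => (a : WithBot α))) (fun x hx hxr => by
      unfold firstKey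
      split_ifs
      · exact Finset.mem_insert_self _ _
      · exact Finset.mem_insert_of_mem (Finset.mem_image_of_mem _ (hA x hx hxr)))
  obtain ⟨T, hT, hrow'⟩ := exists_sort_isRow (fun x => OrderDual.toDual (lastKey t r ftr x)) l r
    (insert (OrderDual.toDual ⊥) (B.image fun a : β => OrderDual.toDual (a : WithBot β)))
    (fun x hx hxr => by
      unfold lastKey
      split_ifs
      · exact Finset.mem_insert_self _ _
      · exact Finset.mem_insert_of_mem (Finset.mem_image_of_mem _ (hB x hx hxr)))
  refine ⟨_, _, S ∪ T, ?_,
    (hrow.mono Finset.subset_union_left).congr (fun x hx _ hb => firstKey_congr hx hb)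
      (fun x y hx _ hy _ hf => eq_of_firstKey_eq hx hy hf),
    (hrow'.mono Finset.subset_union_right).congr
      (fun x _ hxr hb => congrArg OrderDual.toDual (lastKey_congr hxr hb))
      (fun x y _ hx _ hy hf => eq_of_lastKey_eq hx hy (OrderDual.toDual.injective hf)),
    ?_, ?_, ?_, ?_, ?_⟩
  · have h1 := hS.trans ((Finset.card_insert_le _ _).trans (Nat.succ_le_succ Finset.card_image_le))
    have h2 := hT.trans ((Finset.card_insert_le _ _).trans (Nat.succ_le_succ Finset.card_image_le))
    have := Finset.card_union_le S T
    rw [Nat.succ_eq_add_one] at h1 h2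
    omega
  · intro x y hx hxr hy hyr he
    -- Columns in a run forced to the end carry the corner key, so they are compatible by
    -- hypothesis. For the others the pigeonhole argument applies.
    by_cases hx1 : fbl ∧ ∀ y, l ≤ y → y ≤ x → b y = b l
    · rw [hx1.2 x hx le_rfl]; exact hbl hx1.1 y hy hyr
    by_cases hy1 : ftr ∧ ∀ z, y ≤ z → z < r → t z = t (r - 1)
    · rw [hy1.2 y le_rfl hyr]; exact htr hy1.1 x hx hxr
    have e1 := sortPos_add_card (f := firstKey b l fbl) hx hxr
    set Z1 := {z ∈ Finset.Ico l r | ¬ Precedes (firstKey b l fbl) z x} with hZ1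
    set Z2 := insert y {z ∈ Finset.Ico l r |
      Precedes (fun x => OrderDual.toDual (lastKey t r ftr x)) z y} with hZ2
    have e3 : Z2.card + l = sortPos (fun x => OrderDual.toDual (lastKey t r ftr x)) l r y + 1 := by
      rw [hZ2, Finset.card_insert_of_notMem (by simp [not_precedes_self])]
      unfold sortPos
      omega
    have hsub : Z1 ∪ Z2 ⊆ Finset.Ico l r := by
      refine Finset.union_subset (Finset.filter_subset _ _)
        (Finset.insert_subset (Finset.mem_Ico.2 ⟨hy, hyr⟩) (Finset.filter_subset _ _))
    -- With p the common new position, the bottom columns not before `x` number r - p, and the top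
    -- columns up to and including `y` number p - l + 1. Together this exceeds r - l, so some old
    -- column `z` is counted twice. Both of its keys are at least those of `x` and `y`, and it was
    -- compatible.
    have hne : (Z1 ∩ Z2).Nonempty := by
      rw [← Finset.card_pos]
      have h1 := Finset.card_union_add_card_inter Z1 Z2
      have h2 := Finset.card_le_card hsub
      rw [Nat.card_Ico] at h2
      have := (hrow.mapsTo x hx hxr)
      omega
    obtain ⟨z, hz⟩ := hne
    rw [Finset.mem_inter, hZ1, Finset.mem_filter, Finset.mem_Ico] at hz
    obtain ⟨⟨⟨hz1, hz2⟩, hz3⟩, hz4⟩ := hz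
    have hbz : b x ≤ b z := by
      have h1 : firstKey b l fbl x ≤ firstKey b l fbl z := by
        by_contra h1
        exact hz3 (Or.inl (not_le.1 h1))
      unfold firstKey at h1
      rw [if_neg hx1] at h1
      split_ifs at h1 with h2
      · exact absurd (le_bot_iff.1 h1) WithBot.coe_ne_bot
      · exact WithBot.coe_le_coe.1 h1
    have htz : t y ≤ t z := by
      have h1 : lastKey t r ftr y ≤ lastKey t r ftr z := by
        rcases Finset.mem_insert.1 hz4 with rfl | h5
        · exact le_rfl
        · rcases (Finset.mem_filter.1 h5).2 with h6 | h6
          · exact (OrderDual.toDual_lt_toDual.1 h6).le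
          · exact (OrderDual.toDual.injective h6.1).ge
      unfold lastKey at h1
      rw [if_neg hy1] at h1
      split_ifs at h1 with h2
      · exact absurd (le_bot_iff.1 h1) WithBot.coe_ne_bot
      · exact WithBot.coe_le_coe.1 h1
    exact hR _ _ _ _ hbz htz (h z hz1 hz2)
  · intro hf
    refine sortPos_first fun x hx hxr => ?_
    unfold firstKey
    rw [if_pos ⟨hf, fun y h1 h2 => by rw [le_antisymm h2 h1]⟩]
    exact bot_le
  · intro hf
    refine sortPos_first fun x hx hxr => OrderDual.toDual_le_toDual.2 ?_
    unfold lastKey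
    split_ifs with h1 h2 h2
    · exact le_rfl
    · exact bot_le
    · exact absurd ⟨h2.1, fun y hy1 hy2 => h2.2 y (by omega) hy2⟩ h1
    · exact WithBot.coe_le_coe.2 (hf x hx hxr)
  · intro hf
    refine sortPos_last hlr fun x hx hxr => ?_
    unfold firstKey
    split_ifs with h1 h2 h2
    · exact le_rfl
    · exact bot_le
    · exact absurd ⟨h2.1, fun y hy1 hy2 => h2.2 y hy1 (by omega)⟩ h1
    · exact WithBot.coe_le_coe.2 (hf x hx hxr)
  · intro hf
    refine sortPos_last hlr fun x hx hxr => OrderDual.toDual_le_toDual.2 ?_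
    unfold lastKey
    rw [if_pos ⟨hf, fun y h1 h2 => by rw [show y = r - 1 by omega]⟩]
    exact bot_le

/-- The bottom row is made to rise to its maximum and then to fall. Cutting behind the maximal
column fixes one more corner for free on the left; the right part is the mirror image, with the
roles of the rows exchanged. -/
theorem rearr_bottom_bottom (hR : ∀ a a' c c', a' ≤ a → c' ≤ c → R a c → R a' c') (hlr : l < r)
    (h : ∀ x, l ≤ x → x < r → R (b x) (t x))
    (hA : ∀ x, l ≤ x → x < r → b x ∈ A) (hB : ∀ x, l ≤ x → x < r → t x ∈ B)
    (hAK : A.card ≤ K) (hBK : B.card ≤ K) {fbl fbr : Prop}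
    (hbl : fbl → ∀ x, l ≤ x → x < r → R (b l) (t x))
    (hbr : fbr → ∀ x, l ≤ x → x < r → R (b (r - 1)) (t x)) :
    Rearr R b t l r fbl False fbr False (4 * K + 5) := by
  -- The last maximal column is chosen, so the bottom key changes at the cut and only the top row
  -- may continue across it. The top key at `z` is compatible with every bottom key, since `b z` is
  -- maximal.
  obtain ⟨z, hz, hmax⟩ := Finset.exists_max_image (Finset.Ico l r) (fun x => toLex (b x, x))
    ⟨l, Finset.mem_Ico.2 ⟨le_rfl, hlr⟩⟩
  rw [Finset.mem_Ico] at hz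
  have hmax1 : ∀ x, l ≤ x → x < r → b x < b z ∨ (b x = b z ∧ x ≤ z) := fun x hx hxr =>
    Prod.Lex.le_iff.1 (hmax x (Finset.mem_Ico.2 ⟨hx, hxr⟩))
  have hle : ∀ x, l ≤ x → x < r → b x ≤ b z := fun x hx hxr =>
    (hmax1 x hx hxr).elim le_of_lt fun h => h.1.le
  by_cases hzr : z + 1 = r
  · have hz' : r - 1 = z := by omega
    refine (rearr_sort (fbl := fbl) (ftr := False) hR hlr h hA hB hAK hBK hbl
      (fun h => h.elim)).mono id (fun h => h.elim) (fun _ => ?_) id (by omega)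
    rw [hz']; exact hle
  · have h1 := rearr_sort (l := l) (r := z + 1) (fbl := fbl) (ftr := True) hR (by omega)
      (fun x hx hxr => h x hx (by omega)) (fun x hx hxr => hA x hx (by omega))
      (fun x hx hxr => hB x hx (by omega)) hAK hBK (fun hf x hx hxr => hbl hf x hx (by omega))
      (fun _ x hx hxr => hR _ _ _ _ (hle x hx (by omega)) le_rfl (h z hz.1 hz.2))
    have h2 := (rearr_sort (R := flip R) (b := t) (t := b) (l := z + 1) (r := r)
      (fbl := t z = t (z + 1)) (ftr := fbr) (fun a a' c c' h1 h2 h3 => hR _ _ _ _ h2 h1 h3)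
      (by omega) (fun x hx hxr => h x (by omega) hxr) (fun x hx hxr => hB x (by omega) hxr)
      (fun x hx hxr => hA x (by omega) hxr) hBK hAK
      (fun he x hx hxr => hR _ _ _ _ (hle x (by omega) hxr) he.ge (h z hz.1 hz.2))
      (fun hf x hx hxr => hbr hf x (by omega) hxr)).swap
    refine (h1.append (by omega) (by omega) h2 ?_ ?_).mono id (fun h => h.elim) id
      (fun h => h.elim) (by omega)
    · intro he
      rcases hmax1 (z + 1) (by omega) (by omega) with h3 | h3
      · exact absurd he h3.ne'
      · omega
    · exact fun he => ⟨trivial, he⟩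

theorem rearr_top_top (hR : ∀ a a' c c', a' ≤ a → c' ≤ c → R a c → R a' c') (hlr : l < r)
    (h : ∀ x, l ≤ x → x < r → R (b x) (t x))
    (hA : ∀ x, l ≤ x → x < r → b x ∈ A) (hB : ∀ x, l ≤ x → x < r → t x ∈ B)
    (hAK : A.card ≤ K) (hBK : B.card ≤ K) {ftl ftr : Prop}
    (htl : ftl → ∀ x, l ≤ x → x < r → R (b x) (t l))
    (htr : ftr → ∀ x, l ≤ x → x < r → R (b x) (t (r - 1))) :
    Rearr R b t l r False ftl False ftr (4 * K + 5) :=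
  (rearr_bottom_bottom (R := flip R) (fun _ _ _ _ h1 h2 h3 => hR _ _ _ _ h2 h1 h3) hlr h hB hA hBK
    hAK htl htr).swap

/-- If the top right key is incompatible with some bottom column, the row is cut behind the last
such column `z`. To the right of the cut the corner key is compatible with everything. On the left
the new corner key `t z` is strictly smaller, so the number of keys below the corner decreases and
the induction ends after at most `K` cuts. -/
theorem rearr_right_top (hR : ∀ a a' c c', a' ≤ a → c' ≤ c → R a c → R a' c')
    (hAK : A.card ≤ K) (hBK : B.card ≤ K) {fbl ftl : Prop} (hlf : ¬ (fbl ∧ ftl)) (m : ℕ) :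
    ∀ r, l < r → (∀ x, l ≤ x → x < r → R (b x) (t x)) →
    (∀ x, l ≤ x → x < r → b x ∈ A) → (∀ x, l ≤ x → x < r → t x ∈ B) →
    (fbl → ∀ x, l ≤ x → x < r → R (b l) (t x)) →
    (ftl → ∀ x, l ≤ x → x < r → R (b x) (t l)) →
    (B.filter (· < t (r - 1))).card ≤ m →
    Rearr R b t l r fbl ftl False True ((m + 1) * (4 * K + 6)) := by
  induction m using Nat.strong_induction_on with
  | _ m ih =>
  intro r hlr h hA hB hbl htl hm
  by_cases hu : ∀ x, l ≤ x → x < r → R (b x) (t (r - 1))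
  · have hM : 4 * K + 6 ≤ (m + 1) * (4 * K + 6) := Nat.le_mul_of_pos_left _ (by omega)
    -- At most one left corner is to be kept. A bottom one fits a monotone sort, a top one the
    -- rearrangement that fixes both top corners.
    by_cases hf : fbl
    · exact (rearr_sort hR hlr h hA hB hAK hBK hbl (fun _ : True => hu)).mono id
        (fun h => absurd ⟨hf, h⟩ hlf) (fun h => h.elim) id (by omega)
    · exact (rearr_top_top hR hlr h hA hB hAK hBK htl (fun _ : True => hu)).mono
        (fun h => absurd h hf) id id id (by omega)
  · push Not at hu
    obtain ⟨x0, hx0, hx0r, hx0R⟩ := hu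
    classical
    obtain ⟨z, hz, hzmax⟩ := Finset.exists_max_image
      {x ∈ Finset.Ico l r | ¬ R (b x) (t (r - 1))} id ⟨x0, by simp [hx0, hx0r, hx0R]⟩
    simp only [Finset.mem_filter, Finset.mem_Ico, id] at hz hzmax
    obtain ⟨⟨hz1, hz2⟩, hz3⟩ := hz
    have hu : ∀ x, z < x → x < r → R (b x) (t (r - 1)) := by
      intro x hx hxr
      by_contra hc
      have := hzmax x ⟨⟨by omega, hxr⟩, hc⟩
      omega
    have hzr : z + 1 < r := by
      by_contra hc
      rw [show r - 1 = z by omega] at hz3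
      exact hz3 (h z hz1 hz2)
    have hlt : t z < t (r - 1) := by
      by_contra hc
      exact hz3 (hR _ _ _ _ le_rfl (not_lt.1 hc) (h z hz1 hz2))
    have hcard : (B.filter (· < t z)).card < (B.filter (· < t (r - 1))).card := by
      refine Finset.card_lt_card ?_
      rw [Finset.ssubset_iff_of_subset]
      · exact ⟨t z, by simp [hB z hz1 hz2, hlt], by simp⟩
      · intro a ha
        rw [Finset.mem_filter] at ha ⊢
        exact ⟨ha.1, ha.2.trans hlt⟩
    have h1 := ih (m - 1) (by omega) (z + 1) (by omega) (fun x hx hxr => h x hx (by omega))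
      (fun x hx hxr => hA x hx (by omega)) (fun x hx hxr => hB x hx (by omega))
      (fun hf x hx hxr => hbl hf x hx (by omega)) (fun hf x hx hxr => htl hf x hx (by omega))
      (by rw [Nat.add_sub_cancel]; omega)
    have h2 := rearr_top_top (l := z + 1) (r := r) (ftl := t z = t (z + 1)) (ftr := True) hR hzr
      (fun x hx hxr => h x (by omega) hxr) (fun x hx hxr => hA x (by omega) hxr)
      (fun x hx hxr => hB x (by omega) hxr) hAK hBK
      (fun he x hx hxr => hR _ _ _ _ le_rfl (he ▸ hlt.le) (hu x (by omega) hxr))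
      (fun _ x hx hxr => hu x (by omega) hxr)
    refine (h1.append (by omega) hzr h2 ?_ ?_).mono id id id id ?_
    -- The bottom key changes at the cut: `b (z + 1)` is compatible with `t (r - 1)` and `b z` is
    -- not.
    · intro he
      rw [Nat.add_sub_cancel] at he
      exact absurd (he ▸ hu (z + 1) (by omega) hzr) hz3
    · exact fun he => ⟨trivial, he⟩
    · have : (m - 1 + 1) * (4 * K + 6) + (4 * K + 6) ≤ (m + 1) * (4 * K + 6) := by
        rw [show m - 1 + 1 = m by omega, add_mul, one_mul]
      omega

theorem rearr_right (hR : ∀ a a' c c', a' ≤ a → c' ≤ c → R a c → R a' c') (hlr : l < r)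
    (h : ∀ x, l ≤ x → x < r → R (b x) (t x))
    (hA : ∀ x, l ≤ x → x < r → b x ∈ A) (hB : ∀ x, l ≤ x → x < r → t x ∈ B)
    (hAK : A.card ≤ K) (hBK : B.card ≤ K) {fbl ftl fbr ftr : Prop} (hlf : ¬ (fbl ∧ ftl))
    (hrf : ¬ (fbr ∧ ftr))
    (hbl : fbl → ∀ x, l ≤ x → x < r → R (b l) (t x))
    (htl : ftl → ∀ x, l ≤ x → x < r → R (b x) (t l)) :
    Rearr R b t l r fbl ftl fbr ftr ((K + 1) * (4 * K + 6)) := by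
  by_cases hf : fbr
  · exact (rearr_right_top (R := flip R) (fun _ _ _ _ h1 h2 h3 => hR _ _ _ _ h2 h1 h3) hBK hAK
      (fun h => hlf h.symm) K r hlr h hB hA htl hbl
      ((Finset.card_filter_le _ _).trans hAK)).swap.mono id id (fun _ => trivial)
      (fun h => hrf ⟨hf, h⟩) le_rfl
  · exact (rearr_right_top hR hAK hBK hlf K r hlr h hA hB hbl htl
      ((Finset.card_filter_le _ _).trans hBK)).mono id id hf (fun _ => trivial) le_rfl

/-- This is the mirror image of `rearr_right_top`. When the left corner key has become compatible
with the whole opposite row, `rearr_right` takes over and deals with the right corner. -/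
theorem rearr_left_top (hR : ∀ a a' c c', a' ≤ a → c' ≤ c → R a c → R a' c')
    (hAK : A.card ≤ K) (hBK : B.card ≤ K) {fbr ftr : Prop} (hrf : ¬ (fbr ∧ ftr)) (m : ℕ) :
    ∀ l, l < r → (∀ x, l ≤ x → x < r → R (b x) (t x)) →
    (∀ x, l ≤ x → x < r → b x ∈ A) → (∀ x, l ≤ x → x < r → t x ∈ B) →
    (B.filter (· < t l)).card ≤ m →
    Rearr R b t l r False True fbr ftr ((m + 1 + (K + 1)) * (4 * K + 6)) := by
  induction m using Nat.strong_induction_on with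
  | _ m ih =>
  intro l hlr h hA hB hm
  by_cases hu : ∀ x, l ≤ x → x < r → R (b x) (t l)
  · exact (rearr_right hR hlr h hA hB hAK hBK (fbl := False) (ftl := True) (fun h => h.1) hrf
      (fun h => h.elim) (fun _ => hu)).mono id id id id
      (Nat.mul_le_mul_right _ (by omega))
  · push Not at hu
    classical
    obtain ⟨x0, hx0, hx0r, hx0R⟩ := hu
    obtain ⟨z, hz, hzmin⟩ := Finset.exists_min_image
      {x ∈ Finset.Ico l r | ¬ R (b x) (t l)} id ⟨x0, by simp [hx0, hx0r, hx0R]⟩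
    simp only [Finset.mem_filter, Finset.mem_Ico, id] at hz hzmin
    obtain ⟨⟨hz1, hz2⟩, hz3⟩ := hz
    have hu : ∀ x, l ≤ x → x < z → R (b x) (t l) := by
      intro x hx hxr
      by_contra hc
      have := hzmin x ⟨⟨hx, by omega⟩, hc⟩
      omega
    have hlz : l < z := by
      by_contra hc
      rw [show z = l by omega] at hz3
      exact hz3 (h l le_rfl hlr)
    have hlt : t z < t l := by
      by_contra hc
      exact hz3 (hR _ _ _ _ le_rfl (not_lt.1 hc) (h z hz1 hz2))
    have hcard : (B.filter (· < t z)).card < (B.filter (· < t l)).card := by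
      refine Finset.card_lt_card ?_
      rw [Finset.ssubset_iff_of_subset]
      · exact ⟨t z, by simp [hB z hz1 hz2, hlt], by simp⟩
      · intro a ha
        rw [Finset.mem_filter] at ha ⊢
        exact ⟨ha.1, ha.2.trans hlt⟩
    have h2 := ih (m - 1) (by omega) z hz2 (fun x hx hxr => h x (by omega) hxr)
      (fun x hx hxr => hA x (by omega) hxr) (fun x hx hxr => hB x (by omega) hxr) (by omega)
    have h1 := rearr_top_top (l := l) (r := z) (ftl := True) (ftr := t (z - 1) = t z) hR hlz
      (fun x hx hxr => h x hx (by omega)) (fun x hx hxr => hA x hx (by omega))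
      (fun x hx hxr => hB x hx (by omega)) hAK hBK (fun _ x hx hxr => hu x hx hxr)
      (fun he x hx hxr => hR _ _ _ _ le_rfl (he.trans_le hlt.le) (hu x hx hxr))
    refine (h1.append hlz hz2 h2 ?_ ?_).mono id id id id ?_
    · intro he
      exact absurd (he ▸ hu (z - 1) (by omega) (by omega)) hz3
    · exact fun he => ⟨he, trivial⟩
    · have : (m - 1 + 1 + (K + 1)) * (4 * K + 6) + (4 * K + 6) ≤
          (m + 1 + (K + 1)) * (4 * K + 6) := by
        rw [show m - 1 + 1 = m by omega]
        exact le_of_eq (by ring)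
      omega

theorem rearr_left (hR : ∀ a a' c c', a' ≤ a → c' ≤ c → R a c → R a' c') (hlr : l < r)
    (h : ∀ x, l ≤ x → x < r → R (b x) (t x))
    (hA : ∀ x, l ≤ x → x < r → b x ∈ A) (hB : ∀ x, l ≤ x → x < r → t x ∈ B)
    (hAK : A.card ≤ K) (hBK : B.card ≤ K) {fbl ftl fbr ftr : Prop} (hlf : ¬ (fbl ∧ ftl))
    (hrf : ¬ (fbr ∧ ftr)) :
    Rearr R b t l r fbl ftl fbr ftr ((K + 1 + (K + 1)) * (4 * K + 6)) := by
  by_cases hf : fbl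
  · exact (rearr_left_top (R := flip R) (fun _ _ _ _ h1 h2 h3 => hR _ _ _ _ h2 h1 h3) hBK hAK
      (fun h => hrf h.symm) K l hlr h hB hA
      ((Finset.card_filter_le _ _).trans hAK)).swap.mono (fun _ => trivial)
      (fun h => hlf ⟨hf, h⟩) id id le_rfl
  · exact (rearr_left_top hR hAK hBK hrf K l hlr h hA hB
      ((Finset.card_filter_le _ _).trans hBK)).mono hf (fun _ => trivial) id id le_rfl

/-- Keeping both right corners is possible because the final columns in which both keys are constant
can be left untouched. At the end of the remaining part, at least one of the two keys changes, so at
most one corner there has to be kept. -/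
theorem rearr_corner_right (hR : ∀ a a' c c', a' ≤ a → c' ≤ c → R a c → R a' c') (hlr : l < r)
    (h : ∀ x, l ≤ x → x < r → R (b x) (t x))
    (hA : ∀ x, l ≤ x → x < r → b x ∈ A) (hB : ∀ x, l ≤ x → x < r → t x ∈ B)
    (hAK : A.card ≤ K) (hBK : B.card ≤ K) {fbl ftl : Prop} (hlf : ¬ (fbl ∧ ftl)) :
    Rearr R b t l r fbl ftl True True ((K + 1 + (K + 1)) * (4 * K + 6) + 1) := by
  classical
  by_cases hc : ∀ x, l ≤ x → x < r → b x = b l ∧ t x = t l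
  · exact (rearr_const h hc).mono (fun _ => trivial) (fun _ => trivial) id id (Nat.zero_le _)
  have hex : ∃ x, l ≤ x ∧ x < r ∧ ¬ (b x = b (r - 1) ∧ t x = t (r - 1)) := by
    by_contra! hn
    refine hc fun x hx hxr => ?_
    have h1 := hn x hx hxr
    have h2 := hn l le_rfl hlr
    exact ⟨h1.1.trans h2.1.symm, h1.2.trans h2.2.symm⟩
  obtain ⟨x0, h1, h2, h3⟩ := hex
  obtain ⟨z, hz, hzmax⟩ := Finset.exists_max_image
    {x ∈ Finset.Ico l r | ¬ (b x = b (r - 1) ∧ t x = t (r - 1))} id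
    ⟨x0, Finset.mem_filter.2 ⟨Finset.mem_Ico.2 ⟨h1, h2⟩, h3⟩⟩
  simp only [Finset.mem_filter, Finset.mem_Ico, id] at hz hzmax
  obtain ⟨⟨hz1, hz2⟩, hz3⟩ := hz
  have hu : ∀ x, z < x → x < r → b x = b (r - 1) ∧ t x = t (r - 1) := by
    intro x hx hxr
    by_contra hc
    have := hzmax x ⟨⟨by omega, hxr⟩, hc⟩
    omega
  have hzr : z + 1 < r := by
    by_contra hc
    rw [show r - 1 = z by omega] at hz3
    exact hz3 ⟨rfl, rfl⟩
  have hz4 := hu (z + 1) (by omega) hzr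
  have a1 := rearr_left (l := l) (r := z + 1) (fbl := fbl) (ftl := ftl) (fbr := b z = b (z + 1))
    (ftr := t z = t (z + 1)) hR (by omega) (fun x hx hxr => h x hx (by omega))
    (fun x hx hxr => hA x hx (by omega)) (fun x hx hxr => hB x hx (by omega)) hAK hBK hlf
    (by rw [hz4.1, hz4.2]; exact hz3)
  have a2 := rearr_const (R := R) (b := b) (t := t) (l := z + 1) (r := r)
    (fun x hx hxr => h x (by omega) hxr)
    (fun x hx hxr => by
      rw [hz4.1, hz4.2]
      exact hu x (by omega) hxr)
  refine (a1.append (by omega) hzr a2 ?_ ?_).mono id id id id (by omega)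
  · exact fun he => ⟨he, trivial⟩
  · exact fun he => ⟨he, trivial⟩

/-- Two compatible rows of columns can be rearranged without moving the corner columns such that the
number of changes of keys is bounded in terms of the number of keys. -/
theorem rearr_all (hR : ∀ a a' c c', a' ≤ a → c' ≤ c → R a c → R a' c')
    (h : ∀ x, l ≤ x → x < r → R (b x) (t x))
    (hA : ∀ x, l ≤ x → x < r → b x ∈ A) (hB : ∀ x, l ≤ x → x < r → t x ∈ B)
    (hAK : A.card ≤ K) (hBK : B.card ≤ K) :
    Rearr R b t l r True True True True ((K + 1 + (K + 1)) * (4 * K + 6) + 2) := by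
  classical
  by_cases hc : ∀ x, l ≤ x → x < r → b x = b l ∧ t x = t l
  · exact (rearr_const h hc).mono id id id id (Nat.zero_le _)
  have hex : ∃ x, l ≤ x ∧ x < r ∧ ¬ (b x = b l ∧ t x = t l) := by
    by_contra! hn
    exact hc hn
  obtain ⟨x0, h1, h2, h3⟩ := hex
  obtain ⟨z, hz, hzmin⟩ := Finset.exists_min_image
    {x ∈ Finset.Ico l r | ¬ (b x = b l ∧ t x = t l)} id
    ⟨x0, Finset.mem_filter.2 ⟨Finset.mem_Ico.2 ⟨h1, h2⟩, h3⟩⟩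
  simp only [Finset.mem_filter, Finset.mem_Ico, id] at hz hzmin
  obtain ⟨⟨hz1, hz2⟩, hz3⟩ := hz
  have hu : ∀ x, l ≤ x → x < z → b x = b l ∧ t x = t l := by
    intro x hx hxr
    by_contra hc
    have := hzmin x ⟨⟨hx, by omega⟩, hc⟩
    omega
  have hlz : l < z := by
    by_contra hc
    rw [show z = l by omega] at hz3
    exact hz3 ⟨rfl, rfl⟩
  have hz4 := hu (z - 1) (by omega) (by omega)
  have a1 := rearr_const (R := R) (b := b) (t := t) (l := l) (r := z)
    (fun x hx hxr => h x hx (by omega)) hu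
  have a2 := rearr_corner_right (l := z) (r := r) (fbl := b (z - 1) = b z)
    (ftl := t (z - 1) = t z) hR hz2 (fun x hx hxr => h x (by omega) hxr)
    (fun x hx hxr => hA x (by omega) hxr) (fun x hx hxr => hB x (by omega) hxr) hAK hBK
    (by rw [hz4.1, hz4.2]; exact fun hh => hz3 ⟨hh.1.symm, hh.2.symm⟩)
  refine (a1.append hlz hz2 a2 ?_ ?_).mono id id id id (by omega)
  · exact fun he => ⟨trivial, he⟩
  · exact fun he => ⟨trivial, he⟩

end Main

end Reorder

/-! ### Keys of columns and the rearrangement of one box -/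

/-- The key of a column of a row: the height that is used up by the row, the height of the tall item
in it, and the kind of this item. -/
abbrev Key : Type := ℝ ×ₗ (ℝ ×ₗ ℕ)

namespace Key

/-- The key with given components. -/
def mk (v i : ℝ) (k : ℕ) : Key := toLex (v, toLex (i, k))

/-- The height of a column. -/
def val (a : Key) : ℝ := (ofLex a).1

/-- The height of the tall item in a column. -/
def inner (a : Key) : ℝ := (ofLex (ofLex a).2).1

/-- The kind of a column. -/
def kind (a : Key) : ℕ := (ofLex (ofLex a).2).2

@[simp] theorem val_mk (v i : ℝ) (k : ℕ) : (mk v i k).val = v := rfl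
@[simp] theorem inner_mk (v i : ℝ) (k : ℕ) : (mk v i k).inner = i := rfl
@[simp] theorem kind_mk (v i : ℝ) (k : ℕ) : (mk v i k).kind = k := rfl

theorem val_mono {a b : Key} (h : a ≤ b) : a.val ≤ b.val := by
  rcases Prod.Lex.le_iff.1 h with h | h
  · exact h.le
  · exact h.1.le

end Key

/-- The heights at which a column with bottom key `a` and top key `b` is divided. -/
def cut (hh : ℝ) (a b : Key) : ℕ → ℝ
  | 0 => 0
  | 1 => a.val - a.inner
  | 2 => a.val
  | 3 => hh - b.val
  | 4 => hh - b.val + b.inner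
  | _ => hh

/-- The `D.card - f` lowest stacks are matched, f being the number that may be dropped. If too few
slots had room for the highest of them, its height θ would bound almost all slots from above, and
the surplus `E` of each column of `D` would exceed the possible gain of the few higher slots. -/
theorem exists_matching {D Q : Finset ℕ} {H G : ℕ → ℝ} {n : ℕ} {E ε M : ℝ}
    (hε2 : 2 * ε ≤ 1) (hE : 0 < E) (hDn : D.card ≤ n) (hQn : Q.card ≤ n)
    (hsum : ∑ x ∈ D, (E + H x) ≤ ∑ y ∈ Q, G y) (hH0 : ∀ x ∈ D, 0 ≤ H x)
    (hHM : ∀ x ∈ D, H x ≤ M) (hGM : ∀ y ∈ Q, G y ≤ M) (hM : 2 * ε * M ≤ (1 - 2 * ε) * E) :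
    ∃ (D' : Finset ℕ) (g : ℕ → ℕ), D' ⊆ D ∧ Set.InjOn g D' ∧
      (∀ x ∈ D', g x ∈ Q ∧ H x ≤ G (g x)) ∧ ((D \ D').card : ℝ) ≤ (1 - 2 * ε) * n := by
  classical
  by_cases hD : (D.card : ℝ) ≤ (1 - 2 * ε) * n
  · exact ⟨∅, id, by simp, by simp, by simp, by simpa using hD⟩
  push Not at hD
  have hn0 : (0 : ℝ) ≤ (1 - 2 * ε) * n := mul_nonneg (by linarith) (Nat.cast_nonneg _)
  set f := ⌊(1 - 2 * ε) * n⌋₊ with hf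
  have hf1 : (f : ℝ) ≤ (1 - 2 * ε) * n := Nat.floor_le hn0
  have hf2 : (1 - 2 * ε) * n < f + 1 := Nat.lt_floor_add_one _
  have hfD : f < D.card := by exact_mod_cast hf1.trans_lt hD
  set k := D.card - f with hk
  have hDne : D.Nonempty := Finset.card_pos.1 (by omega)
  set T := {x ∈ D | k ≤ ({z ∈ D | H z ≤ H x}).card} with hT
  have hTne : T.Nonempty := by
    obtain ⟨x, hx, hmax⟩ := Finset.exists_max_image D H hDne
    refine ⟨x, Finset.mem_filter.2 ⟨hx, ?_⟩⟩
    rw [Finset.filter_true_of_mem hmax]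
    omega
  obtain ⟨x0, hx0, hmin⟩ := Finset.exists_min_image T H hTne
  rw [hT, Finset.mem_filter] at hx0
  -- θ is the k-th smallest height: fewer than `k` stacks are lower, and at least `k` are no higher.
  -- It suffices to find `k` slots of height at least θ.
  set θ := H x0 with hθ
  have hlow : ({z ∈ D | H z < θ}).card < k := by
    by_contra! hc
    have hne : ({z ∈ D | H z < θ}).Nonempty := Finset.card_pos.1 (by omega)
    obtain ⟨x1, hx1, hmax⟩ := Finset.exists_max_image _ H hne
    have hx1' := Finset.mem_filter.1 hx1
    have : x1 ∈ T := Finset.mem_filter.2 ⟨hx1'.1, hc.trans (Finset.card_le_card fun z hz =>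
      Finset.mem_filter.2 ⟨(Finset.mem_filter.1 hz).1, hmax z hz⟩)⟩
    exact absurd (hmin x1 this) (not_le.2 hx1'.2)
  set Y := {y ∈ Q | θ ≤ G y} with hY
  have hYk : k ≤ Y.card := by
    by_contra! hc
    have h1 : ∑ y ∈ Q, G y ≤ Y.card * M + (Q.card - Y.card) * θ := by
      have e1 : ∑ y ∈ Y, G y ≤ Y.card * M := by
        rw [← nsmul_eq_mul]
        exact Finset.sum_le_card_nsmul _ _ _ fun y hy => hGM y (Finset.mem_filter.1 hy).1
      have e2 : ∑ y ∈ Q with ¬ θ ≤ G y, G y ≤ ({y ∈ Q | ¬ θ ≤ G y}).card * θ := by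
        rw [← nsmul_eq_mul]
        exact Finset.sum_le_card_nsmul _ _ _ fun y hy => (not_le.1 (Finset.mem_filter.1 hy).2).le
      have e3 := Finset.card_filter_add_card_filter_not (s := Q) (fun y => θ ≤ G y)
      have e4 : (({y ∈ Q | ¬ θ ≤ G y}).card : ℝ) = Q.card - Y.card := by
        rw [← e3, Nat.cast_add]
        ring
      rw [← Finset.sum_filter_add_sum_filter_not Q (fun y => θ ≤ G y), ← e4]
      exact add_le_add e1 e2
    have h2 : D.card * E + (D.card - (k - 1)) * θ ≤ ∑ x ∈ D, (E + H x) := by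
      have e1 : ({x ∈ D | ¬ H x < θ}).card * θ ≤ ∑ x ∈ D with ¬ H x < θ, H x := by
        rw [← nsmul_eq_mul]
        exact Finset.card_nsmul_le_sum _ _ _ fun y hy => not_lt.1 (Finset.mem_filter.1 hy).2
      have e2 : 0 ≤ ∑ x ∈ D with H x < θ, H x :=
        Finset.sum_nonneg fun y hy => hH0 y (Finset.mem_filter.1 hy).1
      have e3 := Finset.card_filter_add_card_filter_not (s := D) (fun y => H y < θ)
      have e4 : (D.card - (k - 1) : ℝ) ≤ ({x ∈ D | ¬ H x < θ}).card := by
        have : ((({x ∈ D | H x < θ}).card : ℕ) : ℝ) + 1 ≤ k := by exact_mod_cast hlow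
        rw [← e3, Nat.cast_add]
        linarith
      rw [Finset.sum_add_distrib, Finset.sum_const, nsmul_eq_mul,
        ← Finset.sum_filter_add_sum_filter_not D (fun y => H y < θ)]
      have := mul_le_mul_of_nonneg_right e4 (hH0 x0 hx0.1)
      linarith
    have hkR : (k : ℝ) = D.card - f := by rw [hk, Nat.cast_sub hfD.le]
    have hc' : (Y.card : ℝ) + 1 ≤ k := by exact_mod_cast hc
    have hDn' : (D.card : ℝ) ≤ n := by exact_mod_cast hDn
    have hQn' : (Q.card : ℝ) ≤ n := by exact_mod_cast hQn
    have hθ0 : 0 ≤ θ := hH0 x0 hx0.1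
    have hθM : θ ≤ M := hHM x0 hx0.1
    -- Comparing the two estimates, the θ-terms leave the coefficient n - |Y| - f - 1, which is
    -- nonnegative; there θ may be replaced by `M`. By the choice of `f`, n - f - 1 < 2εn, and `hM`
    -- yields the contradiction.
    have h3 : D.card * E ≤ (n - f - 1) * M := by
      have e1 : ((Q.card : ℝ) - Y.card - D.card + (k - 1)) * θ ≤ (n - Y.card - f - 1) * θ :=
        mul_le_mul_of_nonneg_right (by linarith) hθ0
      have e2 : (n - Y.card - f - 1) * θ ≤ (n - Y.card - f - 1) * M :=
        mul_le_mul_of_nonneg_left hθM (by linarith)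
      linarith
    have h4 : (n - f - 1) * M ≤ 2 * ε * n * M :=
      mul_le_mul_of_nonneg_right (by linarith) (hθ0.trans hθM)
    have h5 : 2 * ε * n * M ≤ (1 - 2 * ε) * n * E := by
      have := mul_le_mul_of_nonneg_left hM (Nat.cast_nonneg (α := ℝ) n)
      linarith
    have h6 : (1 - 2 * ε) * n * E < D.card * E := mul_lt_mul_of_pos_right hD hE
    linarith
  obtain ⟨D', hD', hD'k⟩ := Finset.exists_subset_card_eq hx0.2
  obtain ⟨Y', hY', hY'k⟩ := Finset.exists_subset_card_eq hYk
  have e := Finset.equivOfCardEq (hD'k.trans hY'k.symm)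
  refine ⟨D', fun x => if h : x ∈ D' then (e ⟨x, h⟩ : ℕ) else 0, ?_, ?_, ?_, ?_⟩
  · exact hD'.trans (Finset.filter_subset _ _)
  · intro x hx y hy hxy
    have hx := Finset.mem_coe.1 hx
    have hy := Finset.mem_coe.1 hy
    simp only [dif_pos hx, dif_pos hy] at hxy
    exact congrArg Subtype.val (e.injective (Subtype.ext hxy))
  · intro x hx
    simp only [dif_pos hx]
    have h1 := Finset.mem_filter.1 (hY' (e ⟨x, hx⟩).2)
    exact ⟨h1.1, (Finset.mem_filter.1 (hD' hx)).2.trans h1.2⟩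
  · rw [Finset.card_sdiff_of_subset (hD'.trans (Finset.filter_subset _ _)), hD'k,
      show D.card - k = f by omega]
    exact hf1

/-- A rearrangement of the columns of a box. Row `ρ` of column `x` is occupied by a tall item with
key `occ ρ x` and moves to column `p ρ x`; `key ρ y` is the new key of row `ρ` in column `y`; the
stack of height `H x` of vertical items in column `x` moves to the layer and the column given by
`dest x`, if any. -/
structure IsArrangement (n : ℕ) (hh ε : ℝ) (occ : Bool → ℕ → Option Key) (H : ℕ → ℝ)
    (p : Bool → ℕ → ℕ) (key : Bool → ℕ → Key) (S : Finset ℕ) (dest : ℕ → Option (ℕ × ℕ)) :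
    Prop where
  mapsTo : ∀ ρ x, x < n → p ρ x < n
  inj : ∀ ρ x y, x < n → y < n → p ρ x = p ρ y → x = y
  key_eq : ∀ ρ x k, x < n → occ ρ x = some k → key ρ (p ρ x) = k
  rigid : ∀ ρ x k, x + 1 < n → occ ρ x = some k → occ ρ (x + 1) = some k →
    p ρ (x + 1) = p ρ x + 1
  first : ∀ ρ, p ρ 0 = 0
  last : ∀ ρ, p ρ (n - 1) = n - 1
  sum_le : ∀ y, y < n → (key false y).val + (key true y).val ≤ hh
  key_cases : ∀ ρ y, y < n → (∃ x < n, p ρ x = y ∧ occ ρ x = some (key ρ y)) ∨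
    (0 ≤ (key ρ y).val ∧ (key ρ y).inner = 0 ∧ (key ρ y).kind = 0)
  breaks : ∀ ρ y, y + 1 < n → y + 1 ∉ S → key ρ y = key ρ (y + 1)
  dest_lt : ∀ x l y, x < n → dest x = some (l, y) → y < n ∧ (l = 0 ∨ l = 2 ∨ l = 4) ∧
    (l = 0 → (key false y).kind = 0) ∧ (l = 4 → (key true y).kind = 0) ∧
    H x ≤ cut hh (key false y) (key true y) (l + 1) - cut hh (key false y) (key true y) l
  dest_inj : ∀ x x', x < n → x' < n → dest x ≠ none → dest x = dest x' → x = x'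
  dest_none : ∀ x, x < n → dest x = none → occ false x ≠ none ∧ occ true x ≠ none
  card_none : (({x ∈ Finset.range n | dest x = none}).card : ℝ) ≤ (1 - 2 * ε) * n

/-- The key of row `ρ` in column `x`, where columns without a tall item are filled up. -/
noncomputable def fillKey (hh c : ℝ) (occ : Bool → ℕ → Option Key) (ρ : Bool) (x : ℕ) : Key :=
  match occ ρ x with
  | some k => k
  | none => match occ (!ρ) x with
    | some k => if k.val ≤ hh - c then Key.mk (hh - k.val) 0 0 else Key.mk 0 0 0
    | none => if ρ then Key.mk 0 0 0 else Key.mk hh 0 0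

section FillKey

variable {hh c : ℝ} {occ : Bool → ℕ → Option Key} {ρ : Bool} {x : ℕ} {k : Key}

theorem fillKey_some (h : occ ρ x = some k) : fillKey hh c occ ρ x = k := by
  simp [fillKey, h]

theorem fillKey_none_small (h : occ ρ x = none) (h' : occ (!ρ) x = some k) (hk : k.val ≤ hh - c) :
    fillKey hh c occ ρ x = Key.mk (hh - k.val) 0 0 := by
  simp [fillKey, h, h', hk]

theorem fillKey_none_big (h : occ ρ x = none) (h' : occ (!ρ) x = some k) (hk : hh - c < k.val) :
    fillKey hh c occ ρ x = Key.mk 0 0 0 := by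
  simp [fillKey, h, h', hk]

theorem fillKey_none_false (h : occ false x = none) (h' : occ true x = none) :
    fillKey hh c occ false x = Key.mk hh 0 0 := by
  simp [fillKey, h, h']

theorem fillKey_none_true (h : occ false x = none) (h' : occ true x = none) :
    fillKey hh c occ true x = Key.mk 0 0 0 := by
  simp [fillKey, h, h']

end FillKey

theorem exists_inverse_of_injOn {n : ℕ} {p : ℕ → ℕ} (hm : ∀ x, x < n → p x < n)
    (hi : ∀ x y, x < n → y < n → p x = p y → x = y) :
    ∃ q : ℕ → ℕ, (∀ y, y < n → q y < n ∧ p (q y) = y) ∧ ∀ x, x < n → q (p x) = x := by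
  have hs : ∀ y, ∃ x, y < n → x < n ∧ p x = y := by
    intro y
    by_cases hy : y < n
    · have := Finset.surj_on_of_inj_on_of_card_le (s := Finset.range n) (t := Finset.range n)
        (fun x _ => p x) (fun x hx => Finset.mem_range.2 (hm x (Finset.mem_range.1 hx)))
        (fun x y hx hy h => hi x y (Finset.mem_range.1 hx) (Finset.mem_range.1 hy) h) le_rfl y
        (Finset.mem_range.2 hy)
      obtain ⟨x, hx, he⟩ := this
      exact ⟨x, fun _ => ⟨Finset.mem_range.1 hx, he.symm⟩⟩
    · exact ⟨0, fun h => absurd h hy⟩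
  choose q hq using hs
  exact ⟨q, hq, fun x hx => hi _ _ (hq _ (hm x hx)).1 hx (hq _ (hm x hx)).2⟩

/-- The number of changes of keys after the rearrangement of a box in whose rows at most `K`
different keys of tall items occur. -/
def breakBound (K : ℕ) : ℕ := 2 * (2 * K + 3) * (4 * (2 * K + 2) + 6) + 2

/-- Filler keys turn both rows into complete rows to which `rearr_all` applies. A filler is as high
as the space beside a single tall item, so the stack of that column travels with it. All keys have
value 0 or at least `c`, hence a key above `hh - c` can only face an empty one and its stack fits
there. Only columns with two tall items need the matching. -/
theorem exists_arrangement {n K : ℕ} {hh c E ε : ℝ} {occ : Bool → ℕ → Option Key} {H : ℕ → ℝ}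
    (hc : 0 < c) (hch : c ≤ hh) (hε2 : 2 * ε ≤ 1) (hE : 0 < E)
    (hM : 2 * ε * (hh - 2 * c) ≤ (1 - 2 * ε) * E)
    (hval : ∀ ρ x k, x < n → occ ρ x = some k → c ≤ k.val)
    (hH : ∀ x, x < n → 0 ≤ H x)
    (hDD : ∀ x k k', x < n → occ false x = some k → occ true x = some k' →
      k.val + k'.val + E + H x ≤ hh)
    (hSS : ∀ ρ x k, x < n → occ ρ x = some k → occ (!ρ) x = none → k.val + H x ≤ hh)
    (hNN : ∀ x, x < n → occ false x = none → occ true x = none → H x ≤ hh)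
    (A : Finset Key) (hA : ∀ ρ x k, x < n → occ ρ x = some k → k ∈ A) (hAK : A.card ≤ K) :
    ∃ p key S dest, IsArrangement n hh ε occ H p key S dest ∧ S.card ≤ breakBound K := by
  classical
  set F := fillKey hh c occ with hF
  -- the four cases of a column
  have hcase : ∀ x, x < n →
      (∃ k k', occ false x = some k ∧ occ true x = some k') ∨
      (∃ ρ k, occ ρ x = some k ∧ occ (!ρ) x = none) ∨
      (occ false x = none ∧ occ true x = none) := by
    intro x _
    rcases h0 : occ false x with _ | k <;> rcases h1 : occ true x with _ | k'
    · exact Or.inr (Or.inr ⟨rfl, rfl⟩)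
    · exact Or.inr (Or.inl ⟨true, k', h1, h0⟩)
    · exact Or.inr (Or.inl ⟨false, k, h0, h1⟩)
    · exact Or.inl ⟨k, k', rfl, rfl⟩
  have hFsingle : ∀ ρ x k, x < n → occ ρ x = some k → occ (!ρ) x = none →
      F ρ x = k ∧ (k.val ≤ hh - c → F (!ρ) x = Key.mk (hh - k.val) 0 0) ∧
        (hh - c < k.val → F (!ρ) x = Key.mk 0 0 0) := by
    intro ρ x k hx h1 h2
    have h1' : occ (!(!ρ)) x = some k := by rw [Bool.not_not]; exact h1
    exact ⟨fillKey_some h1, fun h3 => fillKey_none_small h2 h1' h3,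
      fun h3 => fillKey_none_big h2 h1' h3⟩
  have hsum' : ∀ ρ x, x < n → (F ρ x).val + (F (!ρ) x).val ≤ hh := by
    intro ρ x hx
    rcases hcase x hx with ⟨k, k', h0, h1⟩ | ⟨ρ', k, h0, h1⟩ | ⟨h0, h1⟩
    · have e0 : F false x = k := fillKey_some h0
      have e1 : F true x = k' := fillKey_some h1
      have := hDD x k k' hx h0 h1
      have := hH x hx
      cases ρ
      · rw [Bool.not_false, e0, e1]; linarith
      · rw [Bool.not_true, e0, e1]; linarith
    · obtain ⟨e0, e1, e2⟩ := hFsingle ρ' x k hx h0 h1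
      have := hSS ρ' x k hx h0 h1
      have := hH x hx
      have h3 : (F ρ' x).val + (F (!ρ') x).val ≤ hh := by
        rcases le_or_gt k.val (hh - c) with h3 | h3
        · rw [e0, e1 h3, Key.val_mk]; linarith
        · rw [e0, e2 h3, Key.val_mk]; linarith
      rcases Bool.eq_or_eq_not ρ ρ' with rfl | rfl
      · exact h3
      · rw [Bool.not_not]; linarith
    · have e0 : F false x = Key.mk hh 0 0 := fillKey_none_false h0 h1
      have e1 : F true x = Key.mk 0 0 0 := fillKey_none_true h0 h1
      cases ρ
      · rw [Bool.not_false, e0, e1]; simp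
      · rw [Bool.not_true, e0, e1]; simp
  have hsum : ∀ x, x < n → (F false x).val + (F true x).val ≤ hh := fun x hx => hsum' false x hx
  have hzero : ∀ ρ x, x < n → (F ρ x).val = 0 ∨ c ≤ (F ρ x).val := by
    intro ρ x hx
    rcases hcase x hx with ⟨k, k', h0, h1⟩ | ⟨ρ', k, h0, h1⟩ | ⟨h0, h1⟩
    · cases ρ
      · exact Or.inr (by rw [hF, fillKey_some h0]; exact hval _ _ _ hx h0)
      · exact Or.inr (by rw [hF, fillKey_some h1]; exact hval _ _ _ hx h1)
    · obtain ⟨e0, e1, e2⟩ := hFsingle ρ' x k hx h0 h1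
      rcases Bool.eq_or_eq_not ρ ρ' with rfl | rfl
      · exact Or.inr (by rw [e0]; exact hval _ _ _ hx h0)
      · rcases le_or_gt k.val (hh - c) with h3 | h3
        · exact Or.inr (by rw [e1 h3, Key.val_mk]; linarith)
        · exact Or.inl (by rw [e2 h3, Key.val_mk])
    · cases ρ
      · exact Or.inr (by rw [hF, fillKey_none_false h0 h1]; exact hch)
      · exact Or.inl (by rw [hF, fillKey_none_true h0 h1]; rfl)
  have hbig : ∀ ρ x, x < n → (F (!ρ) x).val = 0 → hh - c < (F ρ x).val := by
    intro ρ x hx hz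
    rcases hcase x hx with ⟨k, k', h0, h1⟩ | ⟨ρ', k, h0, h1⟩ | ⟨h0, h1⟩
    · exfalso
      cases ρ
      · rw [Bool.not_false, hF, fillKey_some h1] at hz
        have := hval _ _ _ hx h1
        linarith
      · rw [Bool.not_true, hF, fillKey_some h0] at hz
        have := hval _ _ _ hx h0
        linarith
    · obtain ⟨e0, e1, e2⟩ := hFsingle ρ' x k hx h0 h1
      have hk := hval _ _ _ hx h0
      rcases Bool.eq_or_eq_not ρ ρ' with rfl | rfl
      · rcases le_or_gt k.val (hh - c) with h3 | h3
        · rw [e1 h3, Key.val_mk] at hz; linarith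
        · rw [e0]; exact h3
      · rw [Bool.not_not, e0] at hz; linarith
    · cases ρ
      · rw [hF, fillKey_none_false h0 h1, Key.val_mk]; linarith
      · rw [Bool.not_true, hF, fillKey_none_false h0 h1, Key.val_mk] at hz; linarith
  have hfree : ∀ ρ x, x < n → occ ρ x = none →
      0 ≤ (F ρ x).val ∧ (F ρ x).inner = 0 ∧ (F ρ x).kind = 0 := by
    intro ρ x hx h0
    have hv : 0 ≤ (F ρ x).val := (hzero ρ x hx).elim (fun h => h.ge) fun h => hc.le.trans h
    refine ⟨hv, ?_⟩
    rcases h1 : occ (!ρ) x with _ | k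
    · cases ρ
      · rw [hF, fillKey_none_false h0 h1]; exact ⟨rfl, rfl⟩
      · rw [hF, fillKey_none_true h1 h0]; exact ⟨rfl, rfl⟩
    · rcases le_or_gt k.val (hh - c) with h3 | h3
      · rw [hF, fillKey_none_small h0 h1 h3]; exact ⟨rfl, rfl⟩
      · rw [hF, fillKey_none_big h0 h1 h3]; exact ⟨rfl, rfl⟩
  -- Besides the keys of items these are their fillers and the two keys for columns without tall
  -- items, whence 2K + 2.
  set A' : Finset Key := A ∪ (A.image fun k => Key.mk (hh - k.val) 0 0) ∪
    {Key.mk 0 0 0, Key.mk hh 0 0} with hA'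
  have hA'K : A'.card ≤ 2 * K + 2 := by
    have h1 := Finset.card_union_le (A ∪ (A.image fun k => Key.mk (hh - k.val) 0 0))
      {Key.mk 0 0 0, Key.mk hh 0 0}
    have h2 := Finset.card_union_le A (A.image fun k => Key.mk (hh - k.val) 0 0)
    have h3 : (A.image fun k => Key.mk (hh - k.val) 0 0).card ≤ A.card := Finset.card_image_le
    have h4 : ({Key.mk 0 0 0, Key.mk hh 0 0} : Finset Key).card ≤ 2 := Finset.card_le_two
    rw [← hA'] at h1
    omega
  have hFA : ∀ ρ x, x < n → F ρ x ∈ A' := by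
    intro ρ x hx
    rcases h0 : occ ρ x with _ | k
    · rcases h1 : occ (!ρ) x with _ | k
      · cases ρ
        · rw [hF, fillKey_none_false h0 h1]; simp [hA']
        · rw [hF, fillKey_none_true h1 h0]; simp [hA']
      · rcases le_or_gt k.val (hh - c) with h3 | h3
        · rw [hF, fillKey_none_small h0 h1 h3]
          exact Finset.mem_union_left _ (Finset.mem_union_right _
            (Finset.mem_image_of_mem (fun k : Key => Key.mk (hh - k.val) 0 0)
              (hA _ _ _ hx h1)))
        · rw [hF, fillKey_none_big h0 h1 h3]; simp [hA']
    · rw [hF, fillKey_some h0]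
      exact Finset.mem_union_left _ (Finset.mem_union_left _ (hA _ _ _ hx h0))
  obtain ⟨pb, pt, S, hS, hrb, hrt, hR, f1, f2, f3, f4⟩ := rearr_all
    (R := fun a b : Key => a.val + b.val ≤ hh) (b := F false) (t := F true) (l := 0) (r := n)
    (A := A') (B := A') (K := 2 * K + 2)
    (fun a a' b b' h1 h2 h3 => (add_le_add (Key.val_mono h1) (Key.val_mono h2)).trans h3)
    (fun x _ hx => hsum x hx) (fun x _ hx => hFA false x hx) (fun x _ hx => hFA true x hx)
    hA'K hA'K
  set p : Bool → ℕ → ℕ := fun ρ => if ρ then pt else pb with hp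
  have hrow : ∀ ρ, IsRow (F ρ) 0 n (p ρ) S := by
    intro ρ; cases ρ
    · exact hrb
    · exact hrt
  have hpm : ∀ ρ x, x < n → p ρ x < n := fun ρ x hx => ((hrow ρ).mapsTo x (Nat.zero_le _) hx).2
  have hpi : ∀ ρ x y, x < n → y < n → p ρ x = p ρ y → x = y := fun ρ x y hx hy =>
    (hrow ρ).inj x y (Nat.zero_le _) hx (Nat.zero_le _) hy
  choose q hq hq' using fun ρ => exists_inverse_of_injOn (hpm ρ) (hpi ρ)
  set key : Bool → ℕ → Key := fun ρ y => F ρ (q ρ y) with hkey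
  have hkeyp : ∀ ρ x, x < n → key ρ (p ρ x) = F ρ x := fun ρ x hx => by
    simp only [hkey]; rw [hq' ρ x hx]
  have hkey_sum : ∀ y, y < n → (key false y).val + (key true y).val ≤ hh := by
    intro y hy
    have h0 := hq false y hy
    have h1 := hq true y hy
    exact hR (q false y) (q true y) (Nat.zero_le _) h0.1 (Nat.zero_le _) h1.1
      (h0.2.trans h1.2.symm)
  have hkey0 : ∀ ρ y, y < n → (key ρ y).val = 0 ∨ c ≤ (key ρ y).val := fun ρ y hy =>
    hzero ρ _ (hq ρ y hy).1
  have hkey_big : ∀ ρ y, y < n → hh - c < (key ρ y).val → (key (!ρ) y).val = 0 := by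
    intro ρ y hy h
    have h1 := hkey_sum y hy
    refine (hkey0 (!ρ) y hy).resolve_right fun h2 => ?_
    cases ρ
    · rw [Bool.not_false] at h2; linarith
    · rw [Bool.not_true] at h2; linarith
  -- the rearrangement of the top row relative to the bottom row
  set π : ℕ → ℕ := fun x => q true (p false x) with hπ
  have hπm : ∀ x, x < n → π x < n := fun x hx => (hq true _ (hpm false x hx)).1
  have hπp : ∀ x, x < n → p true (π x) = p false x := fun x hx => (hq true _ (hpm false x hx)).2
  have hπi : ∀ x y, x < n → y < n → π x = π y → x = y := fun x y hx hy h =>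
    hpi false x y hx hy (by rw [← hπp x hx, ← hπp y hy, h])
  have hπk : ∀ x, x < n → key true (p false x) = F true (π x) := fun x hx => rfl
  -- Columns are of three kinds: bottom key above `hh - c`, top key above `hh - c`, or neither. In
  -- the first two cases the facing key is 0, before and after the rearrangement. By finiteness π
  -- therefore permutes `B0` and `Q`, and the total free height over `Q` does not change.
  set B0 := {x ∈ Finset.range n | hh - c < (F false x).val} with hB0
  set Q := {x ∈ Finset.range n | (F false x).val ≤ hh - c ∧ (F true x).val ≤ hh - c} with hQ
  have hB0π : B0.image π = B0 := by
    refine Finset.eq_of_subset_of_card_le ?_ ?_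
    · intro y hy
      obtain ⟨x, hx, rfl⟩ := Finset.mem_image.1 hy
      rw [hB0, Finset.mem_filter, Finset.mem_range] at hx ⊢
      refine ⟨hπm x hx.1, hbig false _ (hπm x hx.1) ?_⟩
      have := hkey_big false (p false x) (hpm false x hx.1) (by rw [hkeyp false x hx.1]; exact hx.2)
      rwa [Bool.not_false, hπk x hx.1] at this
    · rw [Finset.card_image_of_injOn]
      intro x hx y hy
      have hx := Finset.mem_filter.1 (Finset.mem_coe.1 hx)
      have hy := Finset.mem_filter.1 (Finset.mem_coe.1 hy)
      exact hπi x y (Finset.mem_range.1 hx.1) (Finset.mem_range.1 hy.1)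
  have hQv : ∀ x ∈ Q, x < n ∧ c ≤ (F false x).val ∧ c ≤ (F true (π x)).val ∧
      (F true (π x)).val ≤ hh - c ∧ (F false (π x)).val ≤ hh - c := by
    intro x hx
    rw [hQ, Finset.mem_filter, Finset.mem_range] at hx
    obtain ⟨hx, h1, h2⟩ := hx
    have a1 : c ≤ (F false x).val := (hzero false x hx).resolve_left fun h =>
      absurd (hbig true x hx h) (not_lt.2 h2)
    have a2 : (F false (π x)).val ≤ hh - c := by
      by_contra! h
      have : π x ∈ B0 := Finset.mem_filter.2 ⟨Finset.mem_range.2 (hπm x hx), h⟩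
      rw [← hB0π] at this
      obtain ⟨z, hz, hze⟩ := Finset.mem_image.1 this
      rw [hB0, Finset.mem_filter, Finset.mem_range] at hz
      rw [hπi z x hz.1 hx hze] at hz
      linarith [hz.2]
    have a3 : (F true (π x)).val ≤ hh - c := by
      by_contra! h
      have := hkey_big true (p false x) (hpm false x hx) (by rw [hπk x hx]; exact h)
      rw [Bool.not_true, hkeyp false x hx] at this
      linarith
    have a4 : c ≤ (F true (π x)).val := (hzero true _ (hπm x hx)).resolve_left fun h =>
      absurd (hbig false _ (hπm x hx) h) (not_lt.2 a2)
    exact ⟨hx, a1, a4, a3, a2⟩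
  have hQπ : Q.image π = Q := by
    refine Finset.eq_of_subset_of_card_le ?_ ?_
    · intro y hy
      obtain ⟨x, hx, rfl⟩ := Finset.mem_image.1 hy
      obtain ⟨h1, h2, h3, h4, h5⟩ := hQv x hx
      exact Finset.mem_filter.2 ⟨Finset.mem_range.2 (hπm x h1), h5, h4⟩
    · rw [Finset.card_image_of_injOn]
      intro x hx y hy
      exact hπi x y (hQv x (Finset.mem_coe.1 hx)).1 (hQv y (Finset.mem_coe.1 hy)).1
  set D := {x ∈ Finset.range n | occ false x ≠ none ∧ occ true x ≠ none} with hD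
  have hDv : ∀ x ∈ D, ∃ k k', x < n ∧ occ false x = some k ∧ occ true x = some k' ∧
      F false x = k ∧ F true x = k' ∧ c ≤ k.val ∧ c ≤ k'.val := by
    intro x hx
    rw [hD, Finset.mem_filter, Finset.mem_range] at hx
    obtain ⟨k, h0⟩ := Option.ne_none_iff_exists'.1 hx.2.1
    obtain ⟨k', h1⟩ := Option.ne_none_iff_exists'.1 hx.2.2
    exact ⟨k, k', hx.1, h0, h1, fillKey_some h0, fillKey_some h1, hval _ _ _ hx.1 h0,
      hval _ _ _ hx.1 h1⟩
  have hDQ : D ⊆ Q := by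
    intro x hx
    obtain ⟨k, k', hxn, h0, h1, e0, e1, c0, c1⟩ := hDv x hx
    have := hsum x hxn
    refine Finset.mem_filter.2 ⟨Finset.mem_range.2 hxn, ?_, ?_⟩
    · rw [e0] at *; rw [e1] at *; linarith
    · rw [e0] at *; rw [e1] at *; linarith
  -- The slots are the middle parts of the new columns of kind `Q`, indexed by the bottom column.
  -- Both keys are at least `c`, so no slot exceeds `hh - 2 * c`. Every column with two tall items
  -- belongs to `Q` and contributes the spare height `E`.
  obtain ⟨D', g, hD'D, hgi, hgQ, hcard⟩ := exists_matching (D := D) (Q := Q) (H := H)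
    (G := fun x => hh - (F false x).val - (F true (π x)).val) (n := n) (E := E) (ε := ε)
    (M := hh - 2 * c) hε2 hE
    ((Finset.card_filter_le _ _).trans (Finset.card_range n).le)
    ((Finset.card_filter_le _ _).trans (Finset.card_range n).le)
    (by
      have e1 : ∑ x ∈ Q, (F true (π x)).val = ∑ x ∈ Q, (F true x).val := by
        conv_rhs => rw [← hQπ]
        rw [Finset.sum_image]
        intro x hx y hy
        exact hπi x y (hQv x (Finset.mem_coe.1 hx)).1 (hQv y (Finset.mem_coe.1 hy)).1
      have e2 : ∑ x ∈ Q, (hh - (F false x).val - (F true (π x)).val) =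
          ∑ x ∈ Q, (hh - (F false x).val - (F true x).val) := by
        simp only [Finset.sum_sub_distrib, e1]
      rw [e2]
      refine (Finset.sum_le_sum (g := fun x => hh - (F false x).val - (F true x).val) ?_).trans
        (Finset.sum_le_sum_of_subset_of_nonneg hDQ ?_)
      · intro x hx
        obtain ⟨k, k', hxn, h0, h1, e0, e1, c0, c1⟩ := hDv x hx
        have := hDD x k k' hxn h0 h1
        rw [e0, e1]; linarith
      · intro x hx _
        have := hsum x (hQv x hx).1
        linarith)
    (fun x hx => hH x (Finset.mem_range.1 (Finset.mem_filter.1 hx).1))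
    (fun x hx => by
      obtain ⟨k, k', hxn, h0, h1, e0, e1, c0, c1⟩ := hDv x hx
      have := hDD x k k' hxn h0 h1
      linarith)
    (fun x hx => by
      obtain ⟨h1, h2, h3, h4, h5⟩ := hQv x hx
      linarith) hM
  -- Stacks follow a filler in the bottom (layer 0) or top row (layer 4), or use the middle layer 2
  -- beside a very high item or in a matched column.
  set dest : ℕ → Option (ℕ × ℕ) := fun x =>
    match occ false x, occ true x with
    | none, none => some (0, p false x)
    | some k, none => if k.val ≤ hh - c then some (4, p true x) else some (2, p false x)
    | none, some k => if k.val ≤ hh - c then some (0, p false x) else some (2, p true x)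
    | some _, some _ => if x ∈ D' then some (2, p false (g x)) else none with hdest
  -- the possible destinations
  have hd : ∀ x l y, x < n → dest x = some (l, y) →
      (l = 0 ∧ y = p false x ∧ occ false x = none ∧ H x ≤ (F false x).val) ∨
      (l = 4 ∧ y = p true x ∧ occ true x = none ∧ H x ≤ (F true x).val) ∨
      (∃ ρ k, l = 2 ∧ y = p ρ x ∧ occ ρ x = some k ∧ hh - c < k.val ∧ H x ≤ hh - k.val) ∨
      (l = 2 ∧ y = p false (g x) ∧ x ∈ D') := by
    intro x l y hx h
    simp only [hdest] at h
    rcases h0 : occ false x with _ | k <;> rcases h1 : occ true x with _ | k' <;>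
      simp only [h0, h1] at h
    · have h := Option.some_injective _ h
      rw [Prod.mk.injEq] at h
      refine Or.inl ⟨h.1.symm, h.2.symm, rfl, ?_⟩
      rw [hF, fillKey_none_false h0 h1]; exact hNN x hx h0 h1
    · have hs := hSS true x k' hx h1 h0
      split_ifs at h with h2 <;> have h := Option.some_injective _ h <;>
        rw [Prod.mk.injEq] at h
      · refine Or.inl ⟨h.1.symm, h.2.symm, rfl, ?_⟩
        rw [hF, fillKey_none_small (ρ := false) h0 h1 h2, Key.val_mk]; linarith
      · exact Or.inr (Or.inr (Or.inl ⟨true, k', h.1.symm, h.2.symm, h1, not_le.1 h2,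
          by linarith⟩))
    · have hs := hSS false x k hx h0 h1
      split_ifs at h with h2 <;> have h := Option.some_injective _ h <;>
        rw [Prod.mk.injEq] at h
      · refine Or.inr (Or.inl ⟨h.1.symm, h.2.symm, rfl, ?_⟩)
        rw [hF, fillKey_none_small (ρ := true) h1 h0 h2, Key.val_mk]; linarith
      · exact Or.inr (Or.inr (Or.inl ⟨false, k, h.1.symm, h.2.symm, h0, not_le.1 h2,
          by linarith⟩))
    · split_ifs at h with h2
      have h := Option.some_injective _ h
      rw [Prod.mk.injEq] at h
      exact Or.inr (Or.inr (Or.inr ⟨h.1.symm, h.2.symm, h2⟩))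
  have hgn : ∀ x ∈ D', g x < n := fun x hx => (hQv _ (hgQ x hx).1).1
  have hnone : ∀ x, x < n → dest x = none → x ∈ D ∧ x ∉ D' := by
    intro x hx h
    simp only [hdest] at h
    rcases h0 : occ false x with _ | k <;> rcases h1 : occ true x with _ | k' <;>
      simp only [h0, h1] at h
    · cases h
    · split_ifs at h
    · split_ifs at h
    · split_ifs at h with h2
      exact ⟨Finset.mem_filter.2 ⟨Finset.mem_range.2 hx, by simp [h0], by simp [h1]⟩, h2⟩
  refine ⟨p, key, S, dest, ⟨hpm, hpi, ?_, ?_, ?_, ?_, hkey_sum, ?_, ?_, ?_, ?_, ?_, ?_⟩, ?_⟩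
  · intro ρ x k hx h
    rw [hkeyp ρ x hx]; exact fillKey_some h
  · intro ρ x k hx h h'
    refine (hrow ρ).rigid x (Nat.zero_le _) hx ?_
    rw [hF, fillKey_some h, fillKey_some h']
  · intro ρ; cases ρ
    · exact f1 trivial
    · exact f2 trivial
  · intro ρ; cases ρ
    · exact f3 trivial
    · exact f4 trivial
  · intro ρ y hy
    have h1 := hq ρ y hy
    rcases h0 : occ ρ (q ρ y) with _ | k
    · exact Or.inr (hfree ρ _ h1.1 h0)
    · refine Or.inl ⟨q ρ y, h1.1, h1.2, ?_⟩
      simp only [hkey]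
      rw [h0, hF, fillKey_some h0]
  · intro ρ y hy hyS
    have h1 := hq ρ y (by omega)
    have h2 := hq ρ (y + 1) hy
    exact (hrow ρ).breaks _ _ (Nat.zero_le _) h1.1 (Nat.zero_le _) h2.1 (by rw [h1.2, h2.2])
      (by rw [h2.2]; exact hyS)
  · intro x l y hx h
    rcases hd x l y hx h with ⟨rfl, rfl, h1, h2⟩ | ⟨rfl, rfl, h1, h2⟩ |
      ⟨ρ, k, rfl, rfl, h1, h2, h3⟩ | ⟨rfl, rfl, h1⟩
    · obtain ⟨h3, h4, h5⟩ := hfree false x hx h1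
      refine ⟨hpm _ _ hx, by simp, fun _ => ?_, by simp, ?_⟩
      · rw [hkeyp _ _ hx]; exact h5
      · simp only [cut]
        rw [hkeyp _ _ hx, h4]; linarith
    · obtain ⟨h3, h4, h5⟩ := hfree true x hx h1
      refine ⟨hpm _ _ hx, by simp, by simp, fun _ => ?_, ?_⟩
      · rw [hkeyp _ _ hx]; exact h5
      · simp only [cut]
        rw [hkeyp _ _ hx, h4]; linarith
    · refine ⟨hpm _ _ hx, by simp, by simp, by simp, ?_⟩
      have e1 : key ρ (p ρ x) = k := by rw [hkeyp _ _ hx]; exact fillKey_some h1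
      have e2 := hkey_big ρ (p ρ x) (hpm _ _ hx) (by rw [e1]; exact h2)
      simp only [cut]
      cases ρ
      · rw [Bool.not_false] at e2; rw [e1, e2]; linarith
      · rw [Bool.not_true] at e2; rw [e1, e2]; linarith
    · have h2 := hgQ x h1
      have h3 := hgn x h1
      refine ⟨hpm _ _ h3, by simp, by simp, by simp, ?_⟩
      simp only [cut]
      rw [hkeyp _ _ h3, hπk _ h3]
      have := h2.2
      linarith
  -- Layer 2 is used in two ways. They never collide, because a column facing a key above `hh - c`
  -- is not of kind `Q`.
  · have hbig2 : ∀ ρ x k, x < n → occ ρ x = some k → hh - c < k.val → ∀ z ∈ Q,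
        p ρ x ≠ p false z := by
      intro ρ x k hx h1 h2 z hz he
      obtain ⟨a1, a2, a3, a4, a5⟩ := hQv z hz
      have e1 : key ρ (p ρ x) = k := by rw [hkeyp _ _ hx]; exact fillKey_some h1
      have e3 := (Finset.mem_filter.1 hz).2.1
      rw [he] at e1
      cases ρ
      · rw [hkeyp _ _ a1] at e1; rw [e1] at e3; linarith
      · rw [hπk _ a1] at e1; rw [e1] at a4; linarith
    have hbig3 : ∀ ρ x k ρ' x' k', x < n → occ ρ x = some k → hh - c < k.val → x' < n →
        occ ρ' x' = some k' → hh - c < k'.val → p ρ x = p ρ' x' → x = x' := by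
      intro ρ x k ρ' x' k' hx h1 h2 hx' h1' h2' he
      rcases Bool.eq_or_eq_not ρ ρ' with rfl | rfl
      · exact hpi _ _ _ hx hx' he
      · exfalso
        have e1 : key ρ' (p ρ' x') = k' := by rw [hkeyp _ _ hx']; exact fillKey_some h1'
        have e2 : key (!ρ') (p ρ' x') = k := by rw [← he, hkeyp _ _ hx]; exact fillKey_some h1
        have e3 := hkey_big ρ' _ (hpm _ _ hx') (by rw [e1]; exact h2')
        rw [e2] at e3
        have := hval _ _ _ hx h1
        linarith
    intro x x' hx hx' h1 h2
    obtain ⟨⟨l, y⟩, h3⟩ := Option.ne_none_iff_exists'.1 h1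
    have h4 := h2.symm.trans h3
    rcases hd x l y hx h3 with ⟨rfl, rfl, -, -⟩ | ⟨rfl, rfl, -, -⟩ |
      ⟨ρ, k, rfl, rfl, a1, a2, -⟩ | ⟨rfl, rfl, a1⟩
    · rcases hd x' _ _ hx' h4 with ⟨-, e, -, -⟩ | ⟨e, -⟩ | ⟨_, _, e, -⟩ | ⟨e, -⟩
      · exact hpi _ _ _ hx hx' e
      · omega
      · omega
      · omega
    · rcases hd x' _ _ hx' h4 with ⟨e, -⟩ | ⟨-, e, -, -⟩ | ⟨_, _, e, -⟩ | ⟨e, -⟩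
      · omega
      · exact hpi _ _ _ hx hx' e
      · omega
      · omega
    · rcases hd x' _ _ hx' h4 with ⟨e, -⟩ | ⟨e, -⟩ | ⟨ρ', k', -, e, a1', a2', -⟩ | ⟨-, e, a1'⟩
      · omega
      · omega
      · exact hbig3 _ _ _ _ _ _ hx a1 a2 hx' a1' a2' e
      · exact absurd e (hbig2 _ _ _ hx a1 a2 _ (hgQ _ a1').1)
    · rcases hd x' _ _ hx' h4 with ⟨e, -⟩ | ⟨e, -⟩ | ⟨ρ', k', -, e, a1', a2', -⟩ | ⟨-, e, a1'⟩
      · omega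
      · omega
      · exact absurd e.symm (hbig2 _ _ _ hx' a1' a2' _ (hgQ _ a1).1)
      · exact hgi (Finset.mem_coe.2 a1) (Finset.mem_coe.2 a1')
          (hpi _ _ _ (hgn _ a1) (hgn _ a1') e)
  · intro x hx h
    exact (Finset.mem_filter.1 (hnone x hx h).1).2
  · refine le_trans (Nat.cast_le.2 (Finset.card_le_card ?_)) hcard
    intro x hx
    rw [Finset.mem_filter, Finset.mem_range] at hx
    exact Finset.mem_sdiff.2 (hnone x hx.1 hx.2)
  · refine hS.trans (le_of_eq ?_)
    unfold breakBound
    ring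

/-! ### Parameters and existence of a rounded packing -/

/-- The conditions on the parameters of a nonempty instance that are used below. -/
structure Setting.Admissible {ι : Type*} (σ : Setting ι) (N k : ℕ) : Prop where
  N_ge : 24 ≤ N
  ε_eq : σ.ε = 1 / N
  k_pos : 1 ≤ k
  δ_eq : σ.δ = σ.ε ^ k
  μ_pos : 0 < σ.μ
  μ_lt : σ.μ < σ.δ
  h_le : ∀ i, σ.h i ≤ σ.OPT
  OPT_pos : 0 < σ.OPT
  W_pos : 0 < σ.W

theorem Setting.h_cast_pos {ι : Type*} (σ : Setting ι) (i : ι) : (0 : ℝ) < σ.h i :=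
  Nat.cast_pos.2 (σ.h_pos i)

namespace Setting.Admissible

variable {ι : Type*} {σ : Setting ι} {N k : ℕ} (ha : σ.Admissible N k)
include ha

theorem N_pos : (0 : ℝ) < N := by
  have := ha.N_ge
  exact Nat.cast_pos.2 (by omega)

theorem ε_pos : 0 < σ.ε := by
  rw [ha.ε_eq]
  exact one_div_pos.2 ha.N_pos

theorem ε_le : σ.ε ≤ 1 / 24 := by
  rw [ha.ε_eq]
  exact one_div_le_one_div_of_le (by norm_num) (by exact_mod_cast ha.N_ge)

theorem δ_pos : 0 < σ.δ := by
  rw [ha.δ_eq]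
  exact pow_pos ha.ε_pos _

theorem δ_le : σ.δ ≤ σ.ε := by
  rw [ha.δ_eq]
  exact pow_le_of_le_one ha.ε_pos.le (by linarith [ha.ε_le]) (by have := ha.k_pos; omega)

theorem o_pos : (0 : ℝ) < σ.OPT := Nat.cast_pos.2 ha.OPT_pos

theorem ε_mul_N : σ.ε * N = 1 := by
  rw [ha.ε_eq]
  exact one_div_mul_cancel ha.N_pos.ne'

theorem δ_mul_pow : σ.δ * (N : ℝ) ^ k = 1 := by
  rw [ha.δ_eq, ← mul_pow, ha.ε_mul_N, one_pow]

theorem le_h_of_isT {i : ι} (h : σ.IsT i) : σ.δ * σ.OPT ≤ σ.h i := by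
  refine le_trans ?_ h.2
  have := ha.o_pos
  exact mul_le_mul_of_nonneg_right (by linarith [ha.δ_le, ha.ε_le]) this.le

theorem le_h {i : ι} (h : σ.IsL i ∨ σ.IsT i ∨ σ.IsV i) : σ.δ * σ.OPT ≤ σ.h i := by
  rcases h with h | h | h
  · exact h.1
  · exact ha.le_h_of_isT h
  · exact h.2.1

theorem not_flat {i : ι} (h : σ.IsL i ∨ σ.IsT i ∨ σ.IsV i) : ¬ (σ.IsH i ∨ σ.IsS i) := by
  intro h'
  have h1 := ha.le_h h
  have h2 : (σ.h i : ℝ) ≤ σ.μ * σ.OPT := h'.elim (fun h => h.1) fun h => h.1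
  have := mul_lt_mul_of_pos_right ha.μ_lt ha.o_pos
  linarith

theorem not_isL_of_isV {i : ι} (h : σ.IsV i) : ¬ σ.IsL i := by
  intro h'
  have h1 := h'.2
  have h2 := h.2.2
  have := mul_lt_mul_of_pos_right ha.μ_lt (Nat.cast_pos.2 ha.W_pos : (0 : ℝ) < σ.W)
  linarith

theorem not_isL {i : ι} (h : σ.IsT i ∨ σ.IsV i) : ¬ σ.IsL i :=
  h.elim (fun h => h.1) fun h => ha.not_isL_of_isV h

theorem exists_level {h : ℝ} (h0 : 0 < h) (h1 : h ≤ σ.OPT) :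
    ∃ l : ℕ, σ.ε ^ l * σ.OPT ≤ h ∧ σ.ε * h < σ.ε ^ l * σ.OPT := by
  classical
  have hε1 : σ.ε < 1 := by linarith [ha.ε_le]
  have hex : ∃ l : ℕ, σ.ε ^ l * σ.OPT ≤ h := by
    obtain ⟨l, hl⟩ := exists_pow_lt_of_lt_one (div_pos h0 ha.o_pos) hε1
    exact ⟨l, ((lt_div_iff₀ ha.o_pos).1 hl).le⟩
  refine ⟨Nat.find hex, Nat.find_spec hex, ?_⟩
  rcases Nat.eq_zero_or_pos (Nat.find hex) with h2 | h2
  · rw [h2, pow_zero, one_mul]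
    have := mul_lt_mul_of_pos_right hε1 h0
    linarith
  · have h3 := not_le.1 (Nat.find_min hex (Nat.sub_lt h2 one_pos))
    have h4 := mul_lt_mul_of_pos_left h3 ha.ε_pos
    rwa [← mul_assoc, ← pow_succ', show Nat.find hex - 1 + 1 = Nat.find hex by omega] at h4

theorem level_unique {h : ℝ} {l l' : ℕ} (h1 : σ.ε ^ l * σ.OPT ≤ h)
    (h2 : σ.ε * h < σ.ε ^ l * σ.OPT) (h1' : σ.ε ^ l' * σ.OPT ≤ h)
    (h2' : σ.ε * h < σ.ε ^ l' * σ.OPT) : l = l' := by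
  have key : ∀ {l l' : ℕ}, σ.ε ^ l * σ.OPT ≤ h → σ.ε * h < σ.ε ^ l' * σ.OPT → l' ≤ l := by
    intro l l' h1 h2
    have h3 : σ.ε ^ (l + 1) * σ.OPT < σ.ε ^ l' * σ.OPT := by
      rw [pow_succ', mul_assoc]
      exact (mul_le_mul_of_nonneg_left h1 ha.ε_pos.le).trans_lt h2
    have h4 := lt_of_mul_lt_mul_right h3 ha.o_pos.le
    have := (pow_lt_pow_iff_right_of_lt_one₀ ha.ε_pos (by linarith [ha.ε_le])).1 h4
    omega
  exact le_antisymm (key h1' h2) (key h1 h2')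

/-- Since δ = ε^k, no item of height at least δOPT needs a grid finer than ε^(k+1)OPT = εδOPT, the
later row height. -/
theorem level_le {h : ℝ} {l : ℕ} (h1 : σ.δ * σ.OPT ≤ h) (h2 : σ.ε * h < σ.ε ^ l * σ.OPT) :
    l ≤ k := by
  rw [ha.δ_eq] at h1
  have h3 : σ.ε ^ (k + 1) * σ.OPT < σ.ε ^ l * σ.OPT := by
    rw [pow_succ', mul_assoc]
    exact (mul_le_mul_of_nonneg_left h1 ha.ε_pos.le).trans_lt h2
  have h4 := lt_of_mul_lt_mul_right h3 ha.o_pos.le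
  have := (pow_lt_pow_iff_right_of_lt_one₀ ha.ε_pos (by linarith [ha.ε_le])).1 h4
  omega

end Setting.Admissible

/-- Scaling vertically by 1 + 2ε gives an item of height h the additional room 2εh. Rounding its
bottom and its height up costs less than one grid unit each, and this unit is at most εh; so the
rounded item stays inside the scaled one. -/
theorem Setting.Admissible.exists_isRounded {ι : Type*} {σ : Setting ι} {N k : ℕ}
    (ha : σ.Admissible N k) {x y : ι → ℕ} (hf : σ.toInstance.Feasible x y)
    (hy : ∀ i, y i + σ.h i ≤ σ.OPT) : ∃ q : Rounding ι, σ.IsRounded q := by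
  classical
  choose lev hlev1 hlev2 using fun i => ha.exists_level (σ.h_cast_pos i)
    (Nat.cast_le.2 (ha.h_le i) : (σ.h i : ℝ) ≤ σ.OPT)
  set u : ι → ℝ := fun i => σ.ε ^ (lev i + 1) * σ.OPT with hu
  have hu0 : ∀ i, 0 < u i := fun i => mul_pos (pow_pos ha.ε_pos _) ha.o_pos
  have hule : ∀ i, u i ≤ σ.ε * σ.h i := fun i => by
    simp only [hu]
    rw [pow_succ', mul_assoc]
    exact mul_le_mul_of_nonneg_left (hlev1 i) ha.ε_pos.le
  have hceil : ∀ i (a : ℝ), 0 ≤ a → a ≤ ⌈a / u i⌉₊ * u i ∧ ⌈a / u i⌉₊ * u i < a + u i := by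
    intro i a h0
    constructor
    · exact (div_le_iff₀ (hu0 i)).1 (Nat.le_ceil _)
    · have := mul_lt_mul_of_pos_right (Nat.ceil_lt_add_one (div_nonneg h0 (hu0 i).le)) (hu0 i)
      rwa [add_mul, one_mul, div_mul_cancel₀ _ (hu0 i).ne'] at this
  set LTV : ι → Prop := fun i => σ.IsL i ∨ σ.IsT i ∨ σ.IsV i with hLTV
  set q : Rounding ι := ⟨fun i => if LTV i then ⌈σ.h i / u i⌉₊ * u i else σ.h i, x,
    fun i => if LTV i then ⌈(1 + 2 * σ.ε) * y i / u i⌉₊ * u i else (1 + 2 * σ.ε) * y i⟩ with hq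
  have hε := ha.ε_pos
  have hy0 : ∀ i, (0 : ℝ) ≤ (1 + 2 * σ.ε) * y i := fun i => by positivity
  have hin : ∀ i, (1 + 2 * σ.ε) * y i ≤ q.y i ∧
      q.y i + q.height i ≤ (1 + 2 * σ.ε) * (y i + σ.h i) := by
    intro i
    by_cases h : LTV i
    · have e1 : q.y i = ⌈(1 + 2 * σ.ε) * y i / u i⌉₊ * u i := if_pos h
      have e2 : q.height i = ⌈σ.h i / u i⌉₊ * u i := if_pos h
      have h1 := hceil i _ (hy0 i)
      have h2 := hceil i _ (σ.h_cast_pos i).le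
      have h3 := hule i
      rw [e1, e2]
      exact ⟨h1.1, by linarith⟩
    · have e1 : q.y i = (1 + 2 * σ.ε) * y i := if_neg h
      have e2 : q.height i = σ.h i := if_neg h
      have := mul_pos hε (σ.h_cast_pos i)
      rw [e1, e2]
      exact ⟨le_rfl, by linarith⟩
  refine ⟨q, ?_, ?_, ?_, ?_, ?_, ?_⟩
  · exact fun i _ => hf.1 i
  · exact fun i _ => (hy0 i).trans (hin i).1
  · intro i _
    refine (hin i).2.trans (mul_le_mul_of_nonneg_left ?_ (by linarith))
    exact_mod_cast hy i
  · intro i j _ _ hij hov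
    obtain ⟨a, v, h1, h2⟩ := (Box.overlap_iff _ _).1 hov
    -- Scaling a common point back and rounding it down gives a common integral cell of the original
    -- items.
    refine hf.2 i j hij ⟨a, ⌊v / (1 + 2 * σ.ε)⌋₊, ?_, ?_⟩
    all_goals
      simp only [Setting.itemBox] at h1 h2
      have hs : 0 < 1 + 2 * σ.ε := by linarith
      have hi := hin i
      have hj := hin j
      have hv : 0 ≤ v := ((hy0 i).trans hi.1).trans h1.2.2.1
      have hv' : 0 ≤ v / (1 + 2 * σ.ε) := div_nonneg hv hs.le
    · refine ⟨h1.1, h1.2.1, (Nat.le_floor_iff hv').2 ?_, (Nat.floor_lt hv').2 ?_⟩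
      · rw [le_div_iff₀ hs]; linarith
      · rw [div_lt_iff₀ hs]; push_cast; linarith
    · refine ⟨h2.1, h2.2.1, (Nat.le_floor_iff hv').2 ?_, (Nat.floor_lt hv').2 ?_⟩
      · rw [le_div_iff₀ hs]; linarith
      · rw [div_lt_iff₀ hs]; push_cast; linarith
  · intro i hi l h1 h2
    have hl : l = lev i := ha.level_unique h1 h2 (hlev1 i) (hlev2 i)
    have hi' : LTV i := hi
    subst hl
    exact ⟨if_pos hi', _, if_pos hi'⟩
  · intro i hi
    exact if_neg fun h : LTV i => ha.not_flat h hi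

/-! ### Rows, runs of blocked cells and the box partition -/

/-- The height of the rows into which the packing area is divided. -/
noncomputable def Setting.rowHeight {ι : Type*} (σ : Setting ι) : ℝ := σ.ε * σ.δ * σ.OPT

/-- Item `i` meets the cell in row `r` and column `x`. -/
def Setting.Meets {ι : Type*} (σ : Setting ι) (q : Rounding ι) (i : ι) (r x : ℕ) : Prop :=
  q.x i ≤ x ∧ x < q.x i + σ.w i ∧ q.y i < (r + 1) * σ.rowHeight ∧
    r * σ.rowHeight < q.y i + q.height i

/-- The cells that meet a large item. -/
def Setting.LCell {ι : Type*} (σ : Setting ι) (q : Rounding ι) (R r x : ℕ) : Prop :=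
  r < R ∧ ∃ i, σ.IsL i ∧ σ.Meets q i r x

/-- The cells that meet a horizontal item. -/
def Setting.HCell {ι : Type*} (σ : Setting ι) (q : Rounding ι) (R r x : ℕ) : Prop :=
  r < R ∧ ∃ i, σ.IsH i ∧ σ.Meets q i r x

/-- The cells that meet a large or horizontal item. -/
def Setting.Blocked {ι : Type*} (σ : Setting ι) (q : Rounding ι) (R r x : ℕ) : Prop :=
  σ.LCell q R r x ∨ σ.HCell q R r x

/-- The cells that meet no large or horizontal item. -/
def Setting.Free {ι : Type*} (σ : Setting ι) (q : Rounding ι) (R x r : ℕ) : Prop :=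
  x < σ.W ∧ r < R ∧ ¬ σ.Blocked q R r x

/-- The rows from `a` to `b - 1` are a maximal run of free cells of column `x`. -/
def Setting.FreeRun {ι : Type*} (σ : Setting ι) (q : Rounding ι) (R a b x : ℕ) : Prop :=
  a < b ∧ (∀ r, a ≤ r → r < b → σ.Free q R x r) ∧ (a = 0 ∨ ¬ σ.Free q R x (a - 1)) ∧
    ¬ σ.Free q R x b

namespace Setting.Admissible

variable {ι : Type*} {σ : Setting ι} {N k : ℕ} (ha : σ.Admissible N k) {q : Rounding ι}
include ha

theorem rowHeight_pos : 0 < σ.rowHeight := mul_pos (mul_pos ha.ε_pos ha.δ_pos) ha.o_pos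

theorem rows_mul : ((N ^ (k + 1) + 2 * N ^ k : ℕ) : ℝ) * σ.rowHeight = (1 + 2 * σ.ε) * σ.OPT := by
  have h1 := ha.ε_mul_N
  have h2 := ha.δ_mul_pow
  unfold Setting.rowHeight
  push_cast
  calc ((N : ℝ) ^ (k + 1) + 2 * N ^ k) * (σ.ε * σ.δ * σ.OPT)
      = ((σ.ε * N) * (σ.δ * N ^ k) + 2 * σ.ε * (σ.δ * N ^ k)) * σ.OPT := by ring
    _ = (1 + 2 * σ.ε) * σ.OPT := by rw [h1, h2]; ring

variable (hq : σ.IsRounded q)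
include hq

theorem h_le_height {i : ι} (hi : σ.IsL i ∨ σ.IsT i ∨ σ.IsV i) : (σ.h i : ℝ) ≤ q.height i := by
  obtain ⟨l, h1, h2⟩ := ha.exists_level (σ.h_cast_pos i)
    (Nat.cast_le.2 (ha.h_le i) : (σ.h i : ℝ) ≤ σ.OPT)
  rw [(hq.rounded i hi l h1 h2).1]
  exact (div_le_iff₀ (mul_pos (pow_pos ha.ε_pos _) ha.o_pos)).1 (Nat.le_ceil _)

theorem height_pos {i : ι} (hi : σ.Kept i) : 0 < q.height i := by
  have h0 := σ.h_cast_pos i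
  rcases hi with h | h | h | h | h
  · exact h0.trans_le (ha.h_le_height hq (Or.inl h))
  · exact h0.trans_le (ha.h_le_height hq (Or.inr (Or.inl h)))
  · exact h0.trans_le (ha.h_le_height hq (Or.inr (Or.inr h)))
  · rw [hq.unchanged i (Or.inl h)]; exact h0
  · rw [hq.unchanged i (Or.inr h)]; exact h0

/-- The grid of level l has mesh N^(k-l) times the row height, so all levels are aligned with the
rows. -/
theorem exists_grid {i : ι} (hi : σ.IsL i ∨ σ.IsT i ∨ σ.IsV i) :
    ∃ m m' : ℕ, q.y i = m * σ.rowHeight ∧ q.height i = m' * σ.rowHeight := by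
  obtain ⟨l, h1, h2⟩ := ha.exists_level (σ.h_cast_pos i)
    (Nat.cast_le.2 (ha.h_le i) : (σ.h i : ℝ) ≤ σ.OPT)
  obtain ⟨h3, m, h4⟩ := hq.rounded i hi l h1 h2
  have hl : l ≤ k := ha.level_le (ha.le_h hi) h2
  have hu : σ.ε ^ (l + 1) * σ.OPT = ((N ^ (k - l) : ℕ) : ℝ) * σ.rowHeight := by
    unfold Setting.rowHeight
    push_cast
    have e1 : σ.ε ^ k = σ.ε ^ l * σ.ε ^ (k - l) := by rw [← pow_add, Nat.add_sub_cancel' hl]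
    rw [ha.δ_eq, e1]
    calc σ.ε ^ (l + 1) * (σ.OPT : ℝ) = σ.ε ^ (l + 1) * σ.OPT * (σ.ε * N) ^ (k - l) := by
          rw [ha.ε_mul_N, one_pow, mul_one]
      _ = _ := by rw [mul_pow]; ring
  refine ⟨m * N ^ (k - l), ⌈σ.h i / (σ.ε ^ (l + 1) * σ.OPT)⌉₊ * N ^ (k - l), ?_, ?_⟩
  · rw [h4, hu]; push_cast; ring
  · rw [h3, hu]; push_cast; ring

/-- Large, tall and vertical items occupy the rows that they meet from bottom to top. -/
theorem row_within {i : ι} (hi : σ.IsL i ∨ σ.IsT i ∨ σ.IsV i) {r x : ℕ} (h : σ.Meets q i r x) :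
    q.y i ≤ r * σ.rowHeight ∧ (r + 1) * σ.rowHeight ≤ q.y i + q.height i := by
  obtain ⟨m, m', h1, h2⟩ := ha.exists_grid hq hi
  obtain ⟨-, -, h3, h4⟩ := h
  have hU := ha.rowHeight_pos
  rw [h1] at h3 ⊢
  rw [h1, h2] at h4
  rw [h2]
  have h5 : m < r + 1 := by
    have := lt_of_mul_lt_mul_right h3 hU.le
    exact_mod_cast this
  have h6 : r < m + m' := by
    rw [← add_mul] at h4
    have := lt_of_mul_lt_mul_right h4 hU.le
    exact_mod_cast this
  constructor
  · exact mul_le_mul_of_nonneg_right (by exact_mod_cast Nat.lt_succ_iff.1 h5) hU.le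
  · rw [← add_mul]
    exact mul_le_mul_of_nonneg_right (by exact_mod_cast h6) hU.le

/-- Being aligned with the rows, `i` fills the cell from bottom to top, and any other item meeting
the cell would overlap it. -/
theorem not_meets_of_meets {i j : ι} (hi : σ.IsL i ∨ σ.IsT i ∨ σ.IsV i) (hj : σ.Kept j)
    (hij : i ≠ j) {r x : ℕ} (h : σ.Meets q i r x) : ¬ σ.Meets q j r x := by
  intro h'
  have h1 := ha.row_within hq hi h
  have hki : σ.Kept i := by rcases hi with h | h | h <;> simp [Setting.Kept, h]
  refine hq.not_overlap i j hki hj hij ((Box.overlap_iff _ _).2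
    ⟨x, max (q.y j) (r * σ.rowHeight), ?_, ?_⟩)
  · refine ⟨h.1, h.2.1, h1.1.trans (le_max_right _ _), ?_⟩
    exact (max_lt h'.2.2.1 (mul_lt_mul_of_pos_right (lt_add_one _) ha.rowHeight_pos)).trans_le h1.2
  · refine ⟨h'.1, h'.2.1, le_max_left _ _, max_lt ?_ h'.2.2.2⟩
    exact lt_add_of_pos_right _ (ha.height_pos hq hj)

omit hq in
theorem floor_row {v : ℝ} (hv : 0 ≤ v) : ⌊v / σ.rowHeight⌋₊ * σ.rowHeight ≤ v ∧
    v < (⌊v / σ.rowHeight⌋₊ + 1) * σ.rowHeight := by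
  have hU := ha.rowHeight_pos
  exact ⟨(le_div_iff₀ hU).1 (Nat.floor_le (div_nonneg hv hU.le)),
    (div_lt_iff₀ hU).1 (Nat.lt_floor_add_one _)⟩

omit hq in
theorem floor_row_eq {v : ℝ} {r : ℕ} (h1 : r * σ.rowHeight ≤ v) (h2 : v < (r + 1) * σ.rowHeight) :
    ⌊v / σ.rowHeight⌋₊ = r := by
  have hU := ha.rowHeight_pos
  have hv : 0 ≤ v := (mul_nonneg (Nat.cast_nonneg _) hU.le).trans h1
  rw [Nat.floor_eq_iff (div_nonneg hv hU.le)]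
  exact ⟨(le_div_iff₀ hU).2 h1, (div_lt_iff₀ hU).2 h2⟩

omit hq in
theorem floor_row_mem {v : ℝ} {a b : ℕ} (hv : 0 ≤ v) :
    (a * σ.rowHeight ≤ v ∧ v < b * σ.rowHeight) ↔
      a ≤ ⌊v / σ.rowHeight⌋₊ ∧ ⌊v / σ.rowHeight⌋₊ < b := by
  have hU := ha.rowHeight_pos
  rw [Nat.le_floor_iff (div_nonneg hv hU.le), Nat.floor_lt (div_nonneg hv hU.le),
    le_div_iff₀ hU, div_lt_iff₀ hU]

omit hq in
theorem meets_of_point {i : ι} {x : ℕ} {v : ℝ} (hv : 0 ≤ v)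
    (h : q.x i ≤ x ∧ x < q.x i + σ.w i ∧ q.y i ≤ v ∧ v < q.y i + q.height i) :
    σ.Meets q i ⌊v / σ.rowHeight⌋₊ x := by
  have := ha.floor_row hv
  exact ⟨h.1, h.2.1, h.2.2.1.trans_lt this.2, this.1.trans_lt h.2.2.2⟩

theorem row_lt {i : ι} (hi : σ.Kept i) {r x : ℕ} (h : σ.Meets q i r x) :
    r < N ^ (k + 1) + 2 * N ^ k := by
  have h1 := h.2.2.2.trans_le (hq.y_le i hi)
  rw [← ha.rows_mul] at h1
  have := lt_of_mul_lt_mul_right h1 ha.rowHeight_pos.le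
  exact_mod_cast this

omit ha in
theorem col_lt {i : ι} (hi : σ.Kept i) {r x : ℕ} (h : σ.Meets q i r x) : x < σ.W :=
  h.2.1.trans_le (hq.x_le i hi)

omit ha hq in
theorem kept_of_isL {i : ι} (h : σ.IsL i) : σ.Kept i := Or.inl h

omit ha hq in
theorem kept_of_isH {i : ι} (h : σ.IsH i) : σ.Kept i := Or.inr (Or.inr (Or.inr (Or.inl h)))

omit ha in
theorem blocked_lt {R r x : ℕ} (h : σ.Blocked q R r x) : x < σ.W := by
  rcases h with ⟨-, i, hi, hm⟩ | ⟨-, i, hi, hm⟩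
  · exact col_lt hq (kept_of_isL hi) hm
  · exact col_lt hq (kept_of_isH hi) hm

omit ha hq in
theorem wide_of_HCell {R r x : ℕ} (h : σ.HCell q R r x) : ∃ a b : ℕ, a ≤ x ∧ x < b ∧
    (∀ y, a ≤ y → y < b → σ.HCell q R r y) ∧ σ.δ * σ.W ≤ (b : ℝ) - a := by
  obtain ⟨h1, i, hi, h2, h3, h4⟩ := h
  refine ⟨q.x i, q.x i + σ.w i, h2, h3, fun y hy hy' => ⟨h1, i, hi, hy, hy', h4⟩, ?_⟩
  push_cast
  linarith [hi.2]

omit ha hq in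
theorem wide_of_blocked {R r x : ℕ} (h : σ.Blocked q R r x) : ∃ a b : ℕ, a ≤ x ∧ x < b ∧
    (∀ y, a ≤ y → y < b → σ.Blocked q R r y) ∧ σ.δ * σ.W ≤ (b : ℝ) - a := by
  rcases h with ⟨h1, i, hi, h2, h3, h4⟩ | h
  · refine ⟨q.x i, q.x i + σ.w i, h2, h3, fun y hy hy' => Or.inl ⟨h1, i, hi, hy, hy', h4⟩, ?_⟩
    push_cast
    linarith [hi.2]
  · obtain ⟨a, b, h1, h2, h3, h4⟩ := wide_of_HCell h
    exact ⟨a, b, h1, h2, fun y hy hy' => Or.inr (h3 y hy hy'), h4⟩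

omit hq in
theorem card_le_of_mul_le {m : ℕ} (h : (m : ℝ) * (σ.δ * σ.W) ≤ σ.W) : m ≤ N ^ k := by
  have hW : (0 : ℝ) < σ.W := Nat.cast_pos.2 ha.W_pos
  have h1 : (m : ℝ) * σ.δ ≤ 1 := by
    by_contra! hc
    have := mul_lt_mul_of_pos_right hc hW
    linarith
  have h2 := mul_le_mul_of_nonneg_right h1 (pow_nonneg ha.N_pos.le k)
  rw [mul_assoc, ha.δ_mul_pow] at h2
  rw [one_mul, mul_one] at h2
  exact_mod_cast h2

omit hq in
theorem card_lt_of_mul_lt {m : ℕ} (h : (m : ℝ) * (σ.δ * σ.W) < σ.W) : m < N ^ k := by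
  have hW : (0 : ℝ) < σ.W := Nat.cast_pos.2 ha.W_pos
  have h1 : (m : ℝ) * σ.δ < 1 := by
    by_contra! hc
    have := mul_le_mul_of_nonneg_right hc hW.le
    linarith
  have h2 := mul_lt_mul_of_pos_right h1 (pow_pos ha.N_pos k)
  rw [mul_assoc, ha.δ_mul_pow] at h2
  rw [one_mul, mul_one] at h2
  exact_mod_cast h2

theorem card_runStarts_HCell_le (R r : ℕ) : (runStarts (σ.HCell q R r) σ.W).card ≤ N ^ k := by
  classical
  refine ha.card_le_of_mul_le ((card_runStarts_mul_le
    (fun x hx => blocked_lt hq (Or.inr hx)) (fun x hx => wide_of_HCell hx)).trans ?_)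
  exact_mod_cast (Finset.card_filter_le _ _).trans (Finset.card_range _).le

theorem card_runStarts_blocked_le (R r : ℕ) :
    (runStarts (σ.Blocked q R r) σ.W).card ≤ N ^ k := by
  classical
  refine ha.card_le_of_mul_le ((card_runStarts_mul_le
    (fun x hx => blocked_lt hq hx) (fun x hx => wide_of_blocked hx)).trans ?_)
  exact_mod_cast (Finset.card_filter_le _ _).trans (Finset.card_range _).le

/-- A row with a free cell is not completely blocked. The strict inequality saves the one unit that
pays for the corner block in `card_freeBlocks_le`. -/
theorem card_runStarts_blocked_lt {R r x : ℕ} (h : σ.Free q R x r) :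
    (runStarts (σ.Blocked q R r) σ.W).card < N ^ k := by
  classical
  refine ha.card_lt_of_mul_lt ((card_runStarts_mul_le
    (fun x hx => blocked_lt hq hx) (fun x hx => wide_of_blocked hx)).trans_lt ?_)
  have : ({y ∈ Finset.range σ.W | σ.Blocked q R r y}).card < (Finset.range σ.W).card :=
    Finset.card_lt_card ((Finset.ssubset_iff_of_subset (Finset.filter_subset _ _)).2
      ⟨x, Finset.mem_range.2 h.1, fun hx => h.2.2 (Finset.mem_filter.1 hx).2⟩)
  rw [Finset.card_range] at this
  exact_mod_cast this

omit ha hq in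
theorem freeRun_of_free {R x r : ℕ} (h : σ.Free q R x r) :
    σ.FreeRun q R (runLo (σ.Free q R x) r) (runHi (σ.Free q R x) r) x ∧
      runLo (σ.Free q R x) r ≤ r ∧ r < runHi (σ.Free q R x) r := by
  have hb : ∃ b, r < b ∧ ¬ σ.Free q R x b := ⟨R, h.2.1, fun h' => h'.2.1.false⟩
  have h1 := runLo_le h
  have h2 := runHi_mem hb
  exact ⟨⟨by omega, fun y hy hy' => run_all h hy hy', runLo_start h, h2.2⟩, h1, h2.1⟩

omit ha hq in
theorem freeRun_eq {R a b x r : ℕ} (h : σ.FreeRun q R a b x) (h1 : a ≤ r) (h2 : r < b) :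
    runLo (σ.Free q R x) r = a ∧ runHi (σ.Free q R x) r = b :=
  ⟨runLo_eq_of_start (h.2.1 r h1 h2) h1 (fun y hy hy' => h.2.1 y hy (by omega)) h.2.2.1,
    runHi_eq_of_all h2 (fun y hy hy' => h.2.1 y (by omega) hy') h.2.2.2⟩

end Setting.Admissible

open Classical in
/-- The left ends of the maximal sequences of columns with the same maximal run of free cells. -/
noncomputable def Setting.freeBlocks {ι : Type*} (σ : Setting ι) (q : Rounding ι) (R : ℕ) :
    Finset (ℕ × ℕ × ℕ) :=
  {z ∈ Finset.range σ.W ×ˢ Finset.range R ×ˢ Finset.range (R + 1) |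
    σ.FreeRun q R z.2.1 z.2.2 z.1 ∧ (z.1 = 0 ∨ ¬ σ.FreeRun q R z.2.1 z.2.2 (z.1 - 1))}

open Classical in
/-- The left ends of the boxes for horizontal items. -/
noncomputable def Setting.flatBlocks {ι : Type*} (σ : Setting ι) (q : Rounding ι) (R : ℕ) :
    Finset (Σ _ : ℕ, ℕ) :=
  (Finset.range R).sigma fun r => runStarts (σ.HCell q R r) σ.W

namespace Setting.Admissible

variable {ι : Type*} {σ : Setting ι} {N k : ℕ} (ha : σ.Admissible N k) {q : Rounding ι}
  (hq : σ.IsRounded q)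
include ha hq

theorem card_flatBlocks_le (R : ℕ) : (σ.flatBlocks q R).card ≤ R * N ^ k := by
  unfold Setting.flatBlocks
  rw [Finset.card_sigma]
  refine (Finset.sum_le_card_nsmul _ _ _ fun r _ => ha.card_runStarts_HCell_le hq R r).trans ?_
  rw [Finset.card_range, smul_eq_mul]

/-- A block of free cells begins in a column where the free run changes. This is caused by a blocked
run that ends there in one of its rows, or by one that starts there in the row just below or just
above. The only exception is the block in the bottom left corner. Each cause determines the block,
and in total there are at most 3(RN^k - 1) causes. -/
theorem card_freeBlocks_le (R : ℕ) : (σ.freeBlocks q R).card ≤ 3 * (R * N ^ k) := by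
  classical
  by_cases hne : ∃ x r, σ.Free q R x r
  swap
  · have : σ.freeBlocks q R = ∅ := by
      refine Finset.filter_eq_empty_iff.2 fun z _ h => hne ⟨z.1, z.2.1, ?_⟩
      exact h.1.2.1 _ le_rfl h.1.1
    rw [this, Finset.card_empty]
    exact Nat.zero_le _
  obtain ⟨x0, r0, h0⟩ := hne
  set BS : Finset (Σ _ : ℕ, ℕ) :=
    (Finset.range R).sigma fun r => runStarts (σ.Blocked q R r) σ.W with hBS
  set BE : Finset (Σ _ : ℕ, ℕ) := (Finset.range R).sigma fun r =>
    {x ∈ Finset.range σ.W | 0 < x ∧ σ.Blocked q R r (x - 1) ∧ ¬ σ.Blocked q R r x} with hBE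
  have hBS1 : BS.card + 1 ≤ R * N ^ k := by
    rw [hBS, Finset.card_sigma]
    have : ∑ r ∈ Finset.range R, (runStarts (σ.Blocked q R r) σ.W).card <
        ∑ r ∈ Finset.range R, N ^ k :=
      Finset.sum_lt_sum (fun r _ => ha.card_runStarts_blocked_le hq R r)
        ⟨r0, Finset.mem_range.2 h0.2.1, ha.card_runStarts_blocked_lt hq h0⟩
    rw [Finset.sum_const, Finset.card_range, smul_eq_mul] at this
    exact this
  have hBE1 : BE.card ≤ BS.card := by
    rw [hBS, hBE, Finset.card_sigma, Finset.card_sigma]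
    exact Finset.sum_le_sum fun r _ => card_runEnds_le _ _
  set f1 : (Σ _ : ℕ, ℕ) → ℕ × ℕ × ℕ := fun z =>
    (z.2, runLo (σ.Free q R z.2) z.1, runHi (σ.Free q R z.2) z.1) with hf1
  set f2 : (Σ _ : ℕ, ℕ) → ℕ × ℕ × ℕ := fun z =>
    (z.2, z.1 + 1, runHi (σ.Free q R z.2) (z.1 + 1)) with hf2
  set f3 : (Σ _ : ℕ, ℕ) → ℕ × ℕ × ℕ := fun z =>
    (z.2, runLo (σ.Free q R z.2) (z.1 - 1), z.1) with hf3
  have hsub : σ.freeBlocks q R ⊆ insert (0, 0, runHi (σ.Free q R 0) 0)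
      (BE.image f1 ∪ (BS.image f2 ∪ BS.image f3)) := by
    rintro ⟨x, a, b⟩ hz
    rw [Setting.freeBlocks, Finset.mem_filter] at hz
    simp only [Finset.mem_product, Finset.mem_range] at hz
    obtain ⟨⟨hx, haR, hbR⟩, hrun, hstart⟩ := hz
    have hab := hrun.1
    by_cases h1 : 0 < x ∧ ∃ r, a ≤ r ∧ r < b ∧ σ.Blocked q R r (x - 1)
    · obtain ⟨hx0, r, h1, h2, h3⟩ := h1
      refine Finset.mem_insert_of_mem (Finset.mem_union_left _
        (Finset.mem_image.2 ⟨⟨r, x⟩, ?_, ?_⟩))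
      · exact Finset.mem_sigma.2 ⟨Finset.mem_range.2 (show r < R by omega), Finset.mem_filter.2
          ⟨Finset.mem_range.2 hx, hx0, h3, (hrun.2.1 r h1 h2).2.2⟩⟩
      · have := freeRun_eq hrun h1 h2
        simp only [hf1, this]
    have hfree' : ∀ r, 0 < x → a ≤ r → r < b → σ.Free q R (x - 1) r := by
      intro r hx0 hr hr'
      refine ⟨by omega, by omega, fun hB => h1 ⟨hx0, r, hr, hr', hB⟩⟩
    by_cases h2 : 0 < a ∧ (x = 0 ∨ σ.Free q R (x - 1) (a - 1))
    · refine Finset.mem_insert_of_mem (Finset.mem_union_right _ (Finset.mem_union_left _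
        (Finset.mem_image.2 ⟨⟨a - 1, x⟩, ?_, ?_⟩)))
      · refine Finset.mem_sigma.2 ⟨Finset.mem_range.2 (show a - 1 < R by omega), Finset.mem_filter.2
          ⟨Finset.mem_range.2 hx, ?_, h2.2.imp id fun h => h.2.2⟩⟩
        by_contra hc
        exact (hrun.2.2.1.resolve_left (by omega)) ⟨hx, by omega, hc⟩
      · have := freeRun_eq hrun le_rfl hab
        simp only [hf2, show a - 1 + 1 = a by omega, this]
    by_cases h3 : 0 < x ∧ σ.Free q R (x - 1) b
    · refine Finset.mem_insert_of_mem (Finset.mem_union_right _ (Finset.mem_union_right _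
        (Finset.mem_image.2 ⟨⟨b, x⟩, ?_, ?_⟩)))
      · refine Finset.mem_sigma.2 ⟨Finset.mem_range.2 h3.2.2.1, Finset.mem_filter.2
          ⟨Finset.mem_range.2 hx, ?_, Or.inr h3.2.2.2⟩⟩
        by_contra hc
        exact hrun.2.2.2 ⟨hx, h3.2.2.1, hc⟩
      · have := freeRun_eq hrun (r := b - 1) (by omega) (by omega)
        simp only [hf3, this]
    -- No cause was found. Either the block is the corner block, or the preceding column has the
    -- same maximal free run, contradicting the choice of the left end.
    rcases Nat.eq_zero_or_pos x with rfl | hx0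
    · have ha0 : a = 0 := by
        by_contra hc
        exact h2 ⟨by omega, Or.inl rfl⟩
      subst ha0
      have := freeRun_eq hrun le_rfl hab
      rw [this.2]
      exact Finset.mem_insert_self _ _
    · refine absurd ?_ (hstart.resolve_left (by omega))
      refine ⟨hab, fun r => hfree' r hx0, ?_, fun h => h3 ⟨hx0, h⟩⟩
      by_contra! hc
      exact h2 ⟨by omega, Or.inr hc.2⟩
  have h1 := Finset.card_le_card hsub
  have h2 := Finset.card_insert_le (0, 0, runHi (σ.Free q R 0) 0)
    (BE.image f1 ∪ (BS.image f2 ∪ BS.image f3))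
  have h3 := Finset.card_union_le (BE.image f1) (BS.image f2 ∪ BS.image f3)
  have h4 := Finset.card_union_le (BS.image f2) (BS.image f3)
  have h5 : (BE.image f1).card ≤ BE.card := Finset.card_image_le
  have h6 : (BS.image f2).card ≤ BS.card := Finset.card_image_le
  have h7 : (BS.image f3).card ≤ BS.card := Finset.card_image_le
  omega

end Setting.Admissible

/-- The box for horizontal items that starts in row `z.1` and column `z.2`. -/
noncomputable def Setting.flatBox {ι : Type*} (σ : Setting ι) (q : Rounding ι) (R : ℕ)
    (z : Σ _ : ℕ, ℕ) : Box :=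
  ⟨z.2, runHi (σ.HCell q R z.1) z.2 - z.2, z.1 * σ.rowHeight, σ.rowHeight⟩

/-- The box consisting of the rows from `z.2.1` to `z.2.2 - 1` that starts in column `z.1`. -/
noncomputable def Setting.freeBox {ι : Type*} (σ : Setting ι) (q : Rounding ι) (R : ℕ)
    (z : ℕ × ℕ × ℕ) : Box :=
  ⟨z.1, runHi (σ.FreeRun q R z.2.1 z.2.2) z.1 - z.1, z.2.1 * σ.rowHeight,
    z.2.2 * σ.rowHeight - z.2.1 * σ.rowHeight⟩

namespace Setting.Admissible

variable {ι : Type*} {σ : Setting ι} {N k : ℕ} (ha : σ.Admissible N k) {q : Rounding ι}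
  (hq : σ.IsRounded q)
include ha hq

theorem flatBox_point {R : ℕ} {z : Σ _ : ℕ, ℕ} (hz : z ∈ σ.flatBlocks q R) (x : ℕ) (v : ℝ) :
    ((σ.flatBox q R z).x ≤ x ∧ x < (σ.flatBox q R z).x + (σ.flatBox q R z).w ∧
      (σ.flatBox q R z).y ≤ v ∧ v < (σ.flatBox q R z).y + (σ.flatBox q R z).h) ↔
    0 ≤ v ∧ ⌊v / σ.rowHeight⌋₊ = z.1 ∧ σ.HCell q R z.1 x ∧ runLo (σ.HCell q R z.1) x = z.2 := by
  classical
  obtain ⟨r, x0⟩ := z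
  obtain ⟨hx0, hstart⟩ := (Finset.mem_filter.1 (Finset.mem_sigma.1 hz).2).2
  dsimp only at hx0 hstart
  have hU := ha.rowHeight_pos
  have hb : ∀ x, σ.HCell q R r x → ∃ b, x < b ∧ ¬ σ.HCell q R r b := fun x hx =>
    ⟨σ.W, blocked_lt hq (Or.inr hx), fun h => (blocked_lt hq (Or.inr h)).false⟩
  have h1 := runHi_mem (hb x0 hx0)
  simp only [Setting.flatBox]
  rw [Nat.add_sub_cancel' h1.1.le]
  have hlo0 : runLo (σ.HCell q R r) x0 = x0 := runLo_eq_of_start hx0 le_rfl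
    (fun y h h' => le_antisymm h' h ▸ hx0) hstart
  constructor
  · rintro ⟨a1, a2, a3, a4⟩
    refine ⟨(mul_nonneg (Nat.cast_nonneg _) hU.le).trans a3, ha.floor_row_eq a3 (by linarith),
      runHi_all hx0 a1 a2, ?_⟩
    rw [(run_congr (hb x0 hx0) hx0 (hlo0.le.trans a1) a2).1, hlo0]
  · rintro ⟨a1, a2, a3, a4⟩
    have h2 := ha.floor_row a1
    rw [a2] at h2
    have h3 := runLo_mem a3
    rw [a4] at h3
    refine ⟨h3.1, ?_, h2.1, by linarith⟩
    by_contra! hc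
    exact h1.2 (h3.2 _ h1.1.le hc)

omit hq in
theorem freeBox_point {R : ℕ} {z : ℕ × ℕ × ℕ} (hz : z ∈ σ.freeBlocks q R) (x : ℕ) (v : ℝ) :
    ((σ.freeBox q R z).x ≤ x ∧ x < (σ.freeBox q R z).x + (σ.freeBox q R z).w ∧
      (σ.freeBox q R z).y ≤ v ∧ v < (σ.freeBox q R z).y + (σ.freeBox q R z).h) ↔
    0 ≤ v ∧ σ.Free q R x ⌊v / σ.rowHeight⌋₊ ∧
      runLo (σ.Free q R x) ⌊v / σ.rowHeight⌋₊ = z.2.1 ∧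
      runHi (σ.Free q R x) ⌊v / σ.rowHeight⌋₊ = z.2.2 ∧
      runLo (σ.FreeRun q R z.2.1 z.2.2) x = z.1 := by
  classical
  obtain ⟨x0, a, b⟩ := z
  obtain ⟨-, hx0, hstart⟩ := Finset.mem_filter.1 hz
  dsimp only at hx0 hstart
  have hU := ha.rowHeight_pos
  have hab := hx0.1
  have hb : ∀ x, σ.FreeRun q R a b x → ∃ b', x < b' ∧ ¬ σ.FreeRun q R a b b' := fun x hx =>
    ⟨σ.W, (hx.2.1 a le_rfl hab).1, fun h => (h.2.1 a le_rfl hab).1.false⟩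
  have h1 := runHi_mem (hb x0 hx0)
  simp only [Setting.freeBox]
  rw [Nat.add_sub_cancel' h1.1.le, add_sub_cancel]
  have hlo0 : runLo (σ.FreeRun q R a b) x0 = x0 := runLo_eq_of_start hx0 le_rfl
    (fun y h h' => le_antisymm h' h ▸ hx0) hstart
  constructor
  · rintro ⟨a1, a2, a3, a4⟩
    have hv : 0 ≤ v := (mul_nonneg (Nat.cast_nonneg _) hU.le).trans a3
    have h2 := (ha.floor_row_mem hv).1 ⟨a3, a4⟩
    have h3 := runHi_all hx0 a1 a2
    have h4 := freeRun_eq h3 h2.1 h2.2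
    refine ⟨hv, h3.2.1 _ h2.1 h2.2, h4.1, h4.2, ?_⟩
    rw [(run_congr (hb x0 hx0) hx0 (hlo0.le.trans a1) a2).1, hlo0]
  · rintro ⟨a1, a2, a3, a4, a5⟩
    have h2 := freeRun_of_free a2
    rw [a3, a4] at h2
    have h3 := runLo_mem h2.1
    rw [a5] at h3
    have h4 := (ha.floor_row_mem a1).2 h2.2
    refine ⟨h3.1, ?_, h4.1, h4.2⟩
    by_contra! hc
    exact h1.2 (h3.2 _ h1.1.le hc)

/-- Horizontal boxes are the runs of cells of a row that meet horizontal items, so they cut no such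
item vertically. The boxes for tall and vertical items are maximal sequences of columns with the
same run of free cells. A tall or vertical item occupies free cells only, so in each column it lies
within one free run and is not cut horizontally. -/
theorem exists_isBoxPartition :
    ∃ (nH nTV : ℕ) (P : σ.BoxFamily nH nTV), σ.IsBoxPartition q P := by
  classical
  set R := N ^ (k + 1) + 2 * N ^ k with hR
  set U := σ.rowHeight with hUdef
  have hU : 0 < U := ha.rowHeight_pos
  have hRU : (R : ℝ) * U = (1 + 2 * σ.ε) * σ.OPT := ha.rows_mul
  set eH := (σ.flatBlocks q R).equivFin with heH
  set eT := (σ.freeBlocks q R).equivFin with heT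
  set P : σ.BoxFamily (σ.flatBlocks q R).card (σ.freeBlocks q R).card :=
    Sum.elim (fun i => σ.itemBox q i) (Sum.elim (fun a => σ.flatBox q R (eH.symm a))
      (fun a => σ.freeBox q R (eT.symm a))) with hP
  have hPH : ∀ a, P.boxH a = σ.flatBox q R (eH.symm a) := fun a => rfl
  have hPT : ∀ a, P.boxTV a = σ.freeBox q R (eT.symm a) := fun a => rfl
  have hPL : ∀ i, P.boxL i = σ.itemBox q i := fun a => rfl
  -- points of items
  have hpt : ∀ i, σ.Kept i → ∀ x v, ((σ.itemBox q i).x ≤ x ∧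
      x < (σ.itemBox q i).x + (σ.itemBox q i).w ∧ (σ.itemBox q i).y ≤ v ∧
      v < (σ.itemBox q i).y + (σ.itemBox q i).h) →
      0 ≤ v ∧ σ.Meets q i ⌊v / U⌋₊ x ∧ ⌊v / U⌋₊ < R ∧ x < σ.W := by
    intro i hi x v h
    have hv : 0 ≤ v := (hq.y_nonneg i hi).trans h.2.2.1
    have h1 := ha.meets_of_point hv h
    exact ⟨hv, h1, ha.row_lt hq hi h1, col_lt hq hi h1⟩
  have hL : ∀ i, σ.IsL i → ∀ x v, ((σ.itemBox q i).x ≤ x ∧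
      x < (σ.itemBox q i).x + (σ.itemBox q i).w ∧ (σ.itemBox q i).y ≤ v ∧
      v < (σ.itemBox q i).y + (σ.itemBox q i).h) → σ.LCell q R ⌊v / U⌋₊ x := by
    intro i hi x v h
    have h1 := hpt i (kept_of_isL hi) x v h
    exact ⟨h1.2.2.1, i, hi, h1.2.1⟩
  have hcol : ∀ i, σ.Kept i → σ.IsH i ∨ σ.IsS i ∨ σ.IsL i ∨ σ.IsT i ∨ σ.IsV i := by
    rintro i (h | h | h | h | h) <;> simp [h]
  -- meeting items in a cell
  have hHmeet : ∀ a i x v, σ.Kept i → ((σ.itemBox q i).x ≤ x ∧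
      x < (σ.itemBox q i).x + (σ.itemBox q i).w ∧ (σ.itemBox q i).y ≤ v ∧
      v < (σ.itemBox q i).y + (σ.itemBox q i).h) → ((P.boxH a).x ≤ x ∧
      x < (P.boxH a).x + (P.boxH a).w ∧ (P.boxH a).y ≤ v ∧ v < (P.boxH a).y + (P.boxH a).h) →
      σ.IsH i ∨ σ.IsS i := by
    intro a i x v hi h1 h2
    obtain ⟨-, hm, hr, -⟩ := hpt i hi x v h1
    obtain ⟨-, e, hc, -⟩ := (ha.flatBox_point hq (eH.symm a).2 x v).1 h2
    by_contra hc'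
    have hi' : σ.IsL i ∨ σ.IsT i ∨ σ.IsV i := by
      have := hcol i hi
      tauto
    obtain ⟨-, j, hj, hmj⟩ := hc
    rw [← e] at hmj
    refine ha.not_meets_of_meets hq hi' (kept_of_isH hj) ?_ hm hmj
    rintro rfl
    exact hc' (Or.inl hj)
  have hTmeet : ∀ a i x v, σ.Kept i → ((σ.itemBox q i).x ≤ x ∧
      x < (σ.itemBox q i).x + (σ.itemBox q i).w ∧ (σ.itemBox q i).y ≤ v ∧
      v < (σ.itemBox q i).y + (σ.itemBox q i).h) → ((P.boxTV a).x ≤ x ∧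
      x < (P.boxTV a).x + (P.boxTV a).w ∧ (P.boxTV a).y ≤ v ∧
      v < (P.boxTV a).y + (P.boxTV a).h) → ¬ σ.IsL i ∧ ¬ σ.IsH i := by
    intro a i x v hi h1 h2
    obtain ⟨-, hm, hr, -⟩ := hpt i hi x v h1
    obtain ⟨-, hc, -⟩ := (ha.freeBox_point (eT.symm a).2 x v).1 h2
    exact ⟨fun h => hc.2.2 (Or.inl ⟨hr, i, h, hm⟩), fun h => hc.2.2 (Or.inr ⟨hr, i, h, hm⟩)⟩
  have hdisj : ∀ a b, a ≠ b → Disjoint (P a).region (P b).region := by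
    have key : ∀ a b, ∀ (x : ℕ) (v : ℝ),
        ((P a).x ≤ x ∧ x < (P a).x + (P a).w ∧ (P a).y ≤ v ∧ v < (P a).y + (P a).h) →
        ((P b).x ≤ x ∧ x < (P b).x + (P b).w ∧ (P b).y ≤ v ∧ v < (P b).y + (P b).h) → a = b := by
      have hLH : ∀ (i : {i // σ.IsL i}) (a : Fin (σ.flatBlocks q R).card) (x : ℕ) (v : ℝ),
          ((P.boxL i).x ≤ x ∧ x < (P.boxL i).x + (P.boxL i).w ∧ (P.boxL i).y ≤ v ∧
            v < (P.boxL i).y + (P.boxL i).h) → ((P.boxH a).x ≤ x ∧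
            x < (P.boxH a).x + (P.boxH a).w ∧ (P.boxH a).y ≤ v ∧
            v < (P.boxH a).y + (P.boxH a).h) → False := fun i a x v h1 h2 =>
        ha.not_flat (Or.inl i.2) (hHmeet a i x v (kept_of_isL i.2) h1 h2)
      have hLT : ∀ (i : {i // σ.IsL i}) (a : Fin (σ.freeBlocks q R).card) (x : ℕ) (v : ℝ),
          ((P.boxL i).x ≤ x ∧ x < (P.boxL i).x + (P.boxL i).w ∧ (P.boxL i).y ≤ v ∧
            v < (P.boxL i).y + (P.boxL i).h) → ((P.boxTV a).x ≤ x ∧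
            x < (P.boxTV a).x + (P.boxTV a).w ∧ (P.boxTV a).y ≤ v ∧
            v < (P.boxTV a).y + (P.boxTV a).h) → False := fun i a x v h1 h2 =>
        (hTmeet a i x v (kept_of_isL i.2) h1 h2).1 i.2
      have hHT : ∀ (a : Fin (σ.flatBlocks q R).card) (b : Fin (σ.freeBlocks q R).card) (x : ℕ)
          (v : ℝ), ((P.boxH a).x ≤ x ∧ x < (P.boxH a).x + (P.boxH a).w ∧ (P.boxH a).y ≤ v ∧
            v < (P.boxH a).y + (P.boxH a).h) → ((P.boxTV b).x ≤ x ∧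
            x < (P.boxTV b).x + (P.boxTV b).w ∧ (P.boxTV b).y ≤ v ∧
            v < (P.boxTV b).y + (P.boxTV b).h) → False := by
        intro a b x v h1 h2
        obtain ⟨-, e, hc, -⟩ := (ha.flatBox_point hq (eH.symm a).2 x v).1 h1
        obtain ⟨-, hc', -⟩ := (ha.freeBox_point (eT.symm b).2 x v).1 h2
        rw [e] at hc'
        exact hc'.2.2 (Or.inr hc)
      rintro (i | a | a) (j | b | b) x v h1 h2
      · by_contra hne
        exact hq.not_overlap i j (kept_of_isL i.2) (kept_of_isL j.2)
          (fun h => hne (congrArg Sum.inl (Subtype.ext h)))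
          ((Box.overlap_iff _ _).2 ⟨x, v, h1, h2⟩)
      · exact (hLH i b x v h1 h2).elim
      · exact (hLT i b x v h1 h2).elim
      · exact (hLH j a x v h2 h1).elim
      · obtain ⟨-, e1, -, e2⟩ := (ha.flatBox_point hq (eH.symm a).2 x v).1 h1
        obtain ⟨-, e1', -, e2'⟩ := (ha.flatBox_point hq (eH.symm b).2 x v).1 h2
        have e3 := e1.symm.trans e1'
        rw [e3] at e2
        have : eH.symm a = eH.symm b :=
          Subtype.ext (Sigma.ext e3 (heq_of_eq (e2.symm.trans e2')))
        rw [eH.symm.injective this]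
      · exact (hHT a b x v h1 h2).elim
      · exact (hLT j a x v h2 h1).elim
      · exact (hHT b a x v h2 h1).elim
      · obtain ⟨-, -, e1, e2, e3⟩ := (ha.freeBox_point (eT.symm a).2 x v).1 h1
        obtain ⟨-, -, e1', e2', e3'⟩ := (ha.freeBox_point (eT.symm b).2 x v).1 h2
        have e4 := e1.symm.trans e1'
        have e5 := e2.symm.trans e2'
        rw [e4, e5] at e3
        have : eT.symm a = eT.symm b :=
          Subtype.ext (Prod.ext (e3.symm.trans e3') (Prod.ext e4 e5))
        rw [eT.symm.injective this]
    intro a b hab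
    rw [Box.disjoint_iff, Box.overlap_iff]
    rintro ⟨x, v, h1, h2⟩
    exact hab (key a b x v h1 h2)
  have hεδ : σ.ε * σ.δ ^ 2 ≠ 0 := (mul_pos ha.ε_pos (pow_pos ha.δ_pos 2)).ne'
  -- There are R = (1 + 2ε)/(εδ) rows, and N^k = 1/δ.
  have hcard : ((R * N ^ k : ℕ) : ℝ) = (1 + 2 * σ.ε) / (σ.ε * σ.δ ^ 2) := by
    rw [eq_div_iff hεδ]
    have h1 := ha.δ_mul_pow
    have h2 : (R : ℝ) * (σ.ε * σ.δ) = 1 + 2 * σ.ε := by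
      have h3 : (R : ℝ) * (σ.ε * σ.δ) * σ.OPT = (1 + 2 * σ.ε) * σ.OPT := by
        rw [← hRU, hUdef, Setting.rowHeight]; ring
      exact mul_right_cancel₀ ha.o_pos.ne' h3
    push_cast
    calc (R : ℝ) * N ^ k * (σ.ε * σ.δ ^ 2) = R * (σ.ε * σ.δ) * (σ.δ * N ^ k) := by ring
      _ = 1 + 2 * σ.ε := by rw [h1, h2, mul_one]
  have hHstart : ∀ a, σ.HCell q R (eH.symm a).1.1 (eH.symm a).1.2 := by
    intro a
    exact (Finset.mem_filter.1 (Finset.mem_sigma.1 (eH.symm a).2).2).2.1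
  have hHb : ∀ r x, σ.HCell q R r x → ∃ b, x < b ∧ ¬ σ.HCell q R r b := fun r x hx =>
    ⟨σ.W, blocked_lt hq (Or.inr hx), fun h => (blocked_lt hq (Or.inr h)).false⟩
  refine ⟨_, _, P, ⟨?_, hdisj, ?_, ?_, ?_, hPL, fun a => rfl, ?_, ?_, ?_, ?_, ?_⟩⟩
  · rintro (i | a | a)
    · exact ⟨σ.w_pos i, ha.height_pos hq (kept_of_isL i.2)⟩
    · have h2 := runHi_mem (hHb _ _ (hHstart a))
      refine ⟨?_, hU⟩
      change 0 < runHi (σ.HCell q R (eH.symm a).1.1) (eH.symm a).1.2 - (eH.symm a).1.2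
      omega
    · have h1 := Finset.mem_filter.1 (eT.symm a).2
      have hrun := h1.2.1
      have h2 := runHi_mem (p := σ.FreeRun q R (eT.symm a).1.2.1 (eT.symm a).1.2.2)
        (x := (eT.symm a).1.1) ⟨σ.W, (hrun.2.1 _ le_rfl hrun.1).1,
          fun h => (h.2.1 _ le_rfl hrun.1).1.false⟩
      constructor
      · change 0 < runHi (σ.FreeRun q R (eT.symm a).1.2.1 (eT.symm a).1.2.2) (eT.symm a).1.1 -
          (eT.symm a).1.1
        omega
      · refine sub_pos.2 (mul_lt_mul_of_pos_right ?_ hU)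
        exact_mod_cast hrun.1
  · ext ⟨p, v⟩
    simp only [Set.mem_iUnion, Box.mem_region_iff, Set.mem_prod, Set.mem_Ico]
    constructor
    · rintro ⟨a, hp, h⟩
      suffices h' : ⌊p⌋₊ < σ.W ∧ 0 ≤ v ∧ ⌊v / U⌋₊ < R by
        refine ⟨⟨hp, (Nat.floor_lt hp).1 h'.1⟩, h'.2.1, ?_⟩
        rw [← hRU, ← div_lt_iff₀ hU]
        exact (Nat.floor_lt (div_nonneg h'.2.1 hU.le)).1 h'.2.2
      rcases a with i | a | a
      · have := hpt i (kept_of_isL i.2) _ _ h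
        exact ⟨this.2.2.2, this.1, this.2.2.1⟩
      · obtain ⟨hv, e, hc, -⟩ := (ha.flatBox_point hq (eH.symm a).2 _ v).1 h
        exact ⟨blocked_lt hq (Or.inr hc), hv, e ▸ hc.1⟩
      · obtain ⟨hv, hc, -⟩ := (ha.freeBox_point (eT.symm a).2 _ v).1 h
        exact ⟨hc.1, hv, hc.2.1⟩
    · rintro ⟨⟨hp, hpW⟩, hv, hvR⟩
      have hx : ⌊p⌋₊ < σ.W := (Nat.floor_lt hp).2 hpW
      have hr : ⌊v / U⌋₊ < R := by
        rw [Nat.floor_lt (div_nonneg hv hU.le), div_lt_iff₀ hU, hRU]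
        exact hvR
      by_cases hB : σ.Blocked q R ⌊v / U⌋₊ ⌊p⌋₊
      · rcases hB with ⟨-, i, hi, hm⟩ | hB
        · have h1 := ha.row_within hq (Or.inl hi) hm
          have h2 := ha.floor_row hv
          exact ⟨Sum.inl ⟨i, hi⟩, hp, hm.1, hm.2.1, h1.1.trans h2.1, h2.2.trans_le h1.2⟩
        · have hmem : (⟨⌊v / U⌋₊, runLo (σ.HCell q R ⌊v / U⌋₊) ⌊p⌋₊⟩ : Σ _ : ℕ, ℕ) ∈
              σ.flatBlocks q R := by
            have h1 := runLo_mem hB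
            exact Finset.mem_sigma.2 ⟨Finset.mem_range.2 hr, Finset.mem_filter.2
              ⟨Finset.mem_range.2 (h1.1.trans_lt hx), h1.2 _ le_rfl h1.1, runLo_start hB⟩⟩
          refine ⟨Sum.inr (Sum.inl (eH ⟨_, hmem⟩)), hp, ?_⟩
          have := (ha.flatBox_point hq hmem ⌊p⌋₊ v).2 ⟨hv, rfl, hB, rfl⟩
          have e : P.boxH (eH ⟨_, hmem⟩) = σ.flatBox q R _ :=
            (hPH _).trans (by rw [Equiv.symm_apply_apply])
          rw [← e] at this
          exact this
      · have hfree : σ.Free q R ⌊p⌋₊ ⌊v / U⌋₊ := ⟨hx, hr, hB⟩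
        obtain ⟨h1, h2, h3⟩ := freeRun_of_free hfree
        have h4 := runLo_mem h1
        have hmem : ((runLo (σ.FreeRun q R (runLo (σ.Free q R ⌊p⌋₊) ⌊v / U⌋₊)
            (runHi (σ.Free q R ⌊p⌋₊) ⌊v / U⌋₊)) ⌊p⌋₊, runLo (σ.Free q R ⌊p⌋₊) ⌊v / U⌋₊,
            runHi (σ.Free q R ⌊p⌋₊) ⌊v / U⌋₊) : ℕ × ℕ × ℕ) ∈ σ.freeBlocks q R := by
          refine Finset.mem_filter.2 ⟨Finset.mem_product.2 ⟨Finset.mem_range.2 (h4.1.trans_lt hx),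
            Finset.mem_product.2 ⟨Finset.mem_range.2 (h2.trans_lt hr), Finset.mem_range.2 ?_⟩⟩,
            h4.2 _ le_rfl h4.1, runLo_start h1⟩
          have := (h1.2.1 (runHi (σ.Free q R ⌊p⌋₊) ⌊v / U⌋₊ - 1) (by omega) (by omega)).2.1
          dsimp only
          omega
        refine ⟨Sum.inr (Sum.inr (eT ⟨_, hmem⟩)), hp, ?_⟩
        have := (ha.freeBox_point hmem ⌊p⌋₊ v).2 ⟨hv, hfree, rfl, rfl, rfl⟩
        have e : P.boxTV (eT ⟨_, hmem⟩) = σ.freeBox q R _ :=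
          (hPT _).trans (by rw [Equiv.symm_apply_apply])
        rw [← e] at this
        exact this
  · rw [← hcard]
    exact_mod_cast ha.card_flatBlocks_le hq R
  · rw [mul_div_assoc, ← hcard]
    exact_mod_cast ha.card_freeBlocks_le hq R
  · intro a
    obtain ⟨hr, i, hi, hm⟩ := hHstart a
    refine ⟨i, hi, (Box.overlap_iff _ _).2 ⟨(eH.symm a).1.2,
      max (q.y i) ((eH.symm a).1.1 * U), ⟨hm.1, hm.2.1, le_max_left _ _, max_lt ?_ hm.2.2.2⟩, ?_⟩⟩
    · exact lt_add_of_pos_right _ (ha.height_pos hq (kept_of_isH hi))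
    · have h2 := runHi_mem (hHb _ _ (hHstart a))
      rw [hPH]
      simp only [Setting.flatBox]
      refine ⟨le_rfl, by omega, le_max_right _ _, ?_⟩
      have h3 := hm.2.2.1
      rw [add_mul, one_mul] at h3
      exact max_lt h3 (lt_add_of_pos_right _ hU)
  · intro a i hi hov
    obtain ⟨x, v, h1, h2⟩ := (Box.overlap_iff _ _).1 hov
    exact hHmeet a i x v hi h1 h2
  · intro a i hi hov
    obtain ⟨x, v, h1, h2⟩ := (Box.overlap_iff _ _).1 hov
    have h3 := hTmeet a i x v hi h1 h2
    have := hcol i hi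
    tauto
  · intro a i hi hov
    obtain ⟨x, v, h1, h2⟩ := (Box.overlap_iff _ _).1 hov
    have hki : σ.Kept i := kept_of_isH hi
    rcases a with j | a | a
    · refine absurd hov (hq.not_overlap i j hki (kept_of_isL j.2) ?_)
      rintro rfl
      exact ha.not_flat (Or.inl j.2) (Or.inl hi)
    · obtain ⟨-, hm, hr, -⟩ := hpt i hki x v h1
      obtain ⟨-, e, hc, hlo⟩ := (ha.flatBox_point hq (eH.symm a).2 x v).1 h2
      rw [e] at hm hr
      have hall : ∀ y, q.x i ≤ y → y < q.x i + σ.w i → σ.HCell q R (eH.symm a).1.1 y :=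
        fun y hy hy' => ⟨hr, i, hi, hy, hy', hm.2.2⟩
      have hx0 := hHstart a
      have h3 := runHi_mem (hHb _ _ hx0)
      have h4 := runLo_mem hc
      rw [hlo] at h4
      change (σ.flatBox q R (eH.symm a)).x ≤ q.x i ∧ q.x i + σ.w i ≤
        (σ.flatBox q R (eH.symm a)).x + (σ.flatBox q R (eH.symm a)).w
      simp only [Setting.flatBox]
      rw [Nat.add_sub_cancel' h3.1.le, ← hlo]
      have hm1 := hm.1
      have hm2 := hm.2.1
      refine ⟨runLo_le_of_all hm1 fun y hy hy' => hall y hy (by omega), ?_⟩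
      rw [hlo]
      refine le_runHi_of_all (hHb _ _ hx0) fun y hy hy' => ?_
      rcases le_total y x with h5 | h5
      · exact h4.2 y hy h5
      · exact hall y (by omega) hy'
    · exact absurd hi (hTmeet a i x v hki h1 h2).2
  · intro a i hi hov
    obtain ⟨x, v, h1, h2⟩ := (Box.overlap_iff _ _).1 hov
    have hi' : σ.IsL i ∨ σ.IsT i ∨ σ.IsV i := Or.inr hi
    have hki : σ.Kept i := by rcases hi with h | h <;> simp [Setting.Kept, h]
    rcases a with j | a | a
    · refine absurd hov (hq.not_overlap i j hki (kept_of_isL j.2) ?_)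
      rintro rfl
      exact ha.not_isL hi j.2
    · exact absurd (hHmeet a i x v hki h1 h2) (ha.not_flat hi')
    · obtain ⟨hv, hm, hr, hxW⟩ := hpt i hki x v h1
      obtain ⟨-, hf, e1, e2, -⟩ := (ha.freeBox_point (eT.symm a).2 x v).1 h2
      obtain ⟨m, m', g1, g2⟩ := ha.exists_grid hq hi'
      have hmm : ∀ r, m ≤ r → r < m + m' → σ.Meets q i r x := by
        intro r hr1 hr2
        refine ⟨hm.1, hm.2.1, ?_, ?_⟩
        · rw [g1]
          refine mul_lt_mul_of_pos_right ?_ hU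
          exact_mod_cast Nat.lt_succ_iff.2 hr1
        · rw [g1, g2, ← add_mul]
          refine mul_lt_mul_of_pos_right ?_ hU
          exact_mod_cast hr2
      have hfree : ∀ r, m ≤ r → r < m + m' → σ.Free q R x r := by
        intro r hr1 hr2
        have h3 := hmm r hr1 hr2
        refine ⟨hxW, ha.row_lt hq hki h3, ?_⟩
        rintro (⟨-, j, hj, hmj⟩ | ⟨-, j, hj, hmj⟩)
        · refine ha.not_meets_of_meets hq hi' (kept_of_isL hj) ?_ h3 hmj
          rintro rfl
          exact ha.not_isL hi hj
        · refine ha.not_meets_of_meets hq hi' (kept_of_isH hj) ?_ h3 hmj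
          rintro rfl
          exact ha.not_flat hi' (Or.inl hj)
      have h5 : m ≤ ⌊v / U⌋₊ ∧ ⌊v / U⌋₊ < m + m' := by
        refine (ha.floor_row_mem hv).1 ⟨?_, ?_⟩
        · rw [← hUdef, ← g1]; exact h1.2.2.1
        · rw [← hUdef]; push_cast; rw [add_mul, ← g1, ← g2]; exact h1.2.2.2
      have h6 : runLo (σ.Free q R x) ⌊v / U⌋₊ ≤ m :=
        runLo_le_of_all h5.1 fun y hy hy' => hfree y hy (by omega)
      have h7 : m + m' ≤ runHi (σ.Free q R x) ⌊v / U⌋₊ :=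
        le_runHi_of_all ⟨R, hr, fun h => h.2.1.false⟩ fun y hy hy' => hfree y (by omega) hy'
      rw [e1] at h6
      rw [e2] at h7
      change (eT.symm a).1.2.1 * U ≤ q.y i ∧ q.y i + q.height i ≤ (eT.symm a).1.2.1 * U +
        ((eT.symm a).1.2.2 * U - (eT.symm a).1.2.1 * U)
      rw [add_sub_cancel, g1, g2, ← add_mul]
      constructor
      · exact mul_le_mul_of_nonneg_right (by exact_mod_cast h6) hU.le
      · exact mul_le_mul_of_nonneg_right (by exact_mod_cast h7) hU.le

end Setting.Admissible

/-! ### Stretching the packing and the tall items in one box -/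

namespace Setting

/-- The least height of a tall item. -/
noncomputable def tallMin {ι : Type*} (σ : Setting ι) : ℝ := (1 / 3 + σ.ε) * σ.OPT

/-- The unit to multiples of which the heights of tall items are rounded. -/
noncomputable def unit {ι : Type*} (σ : Setting ι) : ℝ := σ.ε * σ.OPT

/-- The distance by which a point at height `y` moves up. -/
noncomputable def shift {ι : Type*} (σ : Setting ι) (y : ℝ) : ℝ :=
  (if σ.tallMin ≤ y then 2 * σ.unit else 0) + if 2 * σ.tallMin ≤ y then σ.unit else 0

/-- The new height of a point at height `y`. -/
noncomputable def stretch {ι : Type*} (σ : Setting ι) (y : ℝ) : ℝ := y + σ.shift y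

/-- The tall item `i` is the one in row `ρ` of column `x` of the box `B`. -/
def TallAt {ι : Type*} (σ : Setting ι) (q : Rounding ι) (B : Box) (ρ : Bool) (x : ℕ) (i : ι) :
    Prop :=
  σ.IsT i ∧ (q.x i ≤ B.x + x ∧ B.x + x < q.x i + σ.w i) ∧
    (B.y ≤ q.y i ∧ q.y i + q.height i ≤ B.y + B.h) ∧ (ρ = true ↔ B.y + σ.tallMin ≤ q.y i)

open Classical in
/-- The tall item in row `ρ` of column `x` of the box `B`. -/
noncomputable def occItem {ι : Type*} (σ : Setting ι) (q : Rounding ι) (B : Box) (ρ : Bool)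
    (x : ℕ) : Option ι :=
  if h : ∃ i, σ.TallAt q B ρ x i then some h.choose else none

/-- Whether the item `i` sticks out of the box `B` to the left (`2`), to the right only (`3`) or not
at all (`1`). -/
def itemKind {ι : Type*} (σ : Setting ι) (q : Rounding ι) (B : Box) (i : ι) : ℕ :=
  if q.x i < B.x then 2 else if B.x + B.w < q.x i + σ.w i then 3 else 1

/-- The key of the tall item `i` in row `ρ` of the box `B`. -/
noncomputable def itemKey {ι : Type*} (σ : Setting ι) (q : Rounding ι) (B : Box) (ρ : Bool)
    (i : ι) : Key :=
  Key.mk (if σ.itemKind q B i = 1 then σ.tallHeight q i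
    else if ρ then σ.stretch (B.y + B.h) - σ.stretch (q.y i)
    else σ.stretch (q.y i) + σ.tallHeight q i - σ.stretch B.y)
    (σ.tallHeight q i) (σ.itemKind q B i)

/-- The keys of the columns of the box `B`. -/
noncomputable def occ {ι : Type*} (σ : Setting ι) (q : Rounding ι) (B : Box) (ρ : Bool)
    (x : ℕ) : Option Key :=
  (σ.occItem q B ρ x).map (σ.itemKey q B ρ)

/-- The lower end of the part of column `x` of the box `B` that is reserved by its row `ρ`. -/
noncomputable def rowLo {ι : Type*} (σ : Setting ι) (q : Rounding ι) (B : Box) (ρ : Bool)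
    (x : ℕ) : ℝ :=
  match σ.occItem q B ρ x with
  | none => if ρ then B.y + B.h else B.y
  | some i => if σ.itemKind q B i ≠ 1 ∧ ρ = false then B.y else q.y i

/-- The upper end of the part of column `x` of the box `B` that is reserved by its row `ρ`. -/
noncomputable def rowHi {ι : Type*} (σ : Setting ι) (q : Rounding ι) (B : Box) (ρ : Bool)
    (x : ℕ) : ℝ :=
  match σ.occItem q B ρ x with
  | none => if ρ then B.y + B.h else B.y
  | some i => if σ.itemKind q B i ≠ 1 ∧ ρ = true then B.y + B.h else q.y i + q.height i

/-- The height of column `x` of the box `B` that is not reserved. -/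
noncomputable def gap {ι : Type*} (σ : Setting ι) (q : Rounding ι) (B : Box) (x : ℕ) : ℝ :=
  B.h - (σ.rowHi q B false x - σ.rowLo q B false x) - (σ.rowHi q B true x - σ.rowLo q B true x)

/-- The height below `v` in column `x` of the box `B` that is not reserved. -/
noncomputable def stackPos {ι : Type*} (σ : Setting ι) (q : Rounding ι) (B : Box) (x : ℕ)
    (v : ℝ) : ℝ :=
  v - B.y - max 0 (min v (σ.rowHi q B false x) - σ.rowLo q B false x) -
    max 0 (min v (σ.rowHi q B true x) - σ.rowLo q B true x)

/-- The box `B` lies in the area of the rounded packing. -/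
structure BoxValid {ι : Type*} (σ : Setting ι) (B : Box) : Prop where
  y_nonneg : 0 ≤ B.y
  h_pos : 0 < B.h
  top_le : B.y + B.h ≤ (1 + 2 * σ.ε) * σ.OPT

end Setting

namespace Setting.Admissible

variable {ι : Type*} {σ : Setting ι} {N k : ℕ} (ha : σ.Admissible N k)
include ha

theorem tallMin_pos : 0 < σ.tallMin := mul_pos (by linarith [ha.ε_pos]) ha.o_pos

theorem unit_pos : 0 < σ.unit := mul_pos ha.ε_pos ha.o_pos

theorem area_lt : (1 + 2 * σ.ε) * σ.OPT < 3 * σ.tallMin := by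
  have := ha.unit_pos
  rw [Setting.tallMin]
  rw [Setting.unit] at this
  linarith

theorem shift_nonneg (y : ℝ) : 0 ≤ σ.shift y := by
  have := ha.unit_pos
  unfold Setting.shift
  split_ifs <;> linarith

theorem shift_mono {y z : ℝ} (h : y ≤ z) : σ.shift y ≤ σ.shift z := by
  have := ha.unit_pos
  unfold Setting.shift
  split_ifs <;> linarith

theorem shift_le (y : ℝ) : σ.shift y ≤ 3 * σ.unit := by
  have := ha.unit_pos
  unfold Setting.shift
  split_ifs <;> linarith

theorem shift_of_lt {y : ℝ} (h : y < σ.tallMin) : σ.shift y = 0 := by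
  have := ha.tallMin_pos
  unfold Setting.shift
  rw [if_neg (by linarith), if_neg (by linarith), add_zero]

theorem shift_of_le {y : ℝ} (h : 2 * σ.tallMin ≤ y) : σ.shift y = 3 * σ.unit := by
  have := ha.tallMin_pos
  unfold Setting.shift
  rw [if_pos (by linarith), if_pos h]
  ring

theorem le_shift {y : ℝ} (h : σ.tallMin ≤ y) : 2 * σ.unit ≤ σ.shift y := by
  have := ha.unit_pos
  unfold Setting.shift
  rw [if_pos h]
  split_ifs <;> linarith

/-- Climbing by τ crosses one of the thresholds τ and 2τ. If it starts at or above τ it must start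
below 2τ, because the area ends below 3τ. -/
theorem shift_add_le {y z : ℝ} (h : y + σ.tallMin ≤ z) (hy : 0 ≤ y)
    (hz : z ≤ (1 + 2 * σ.ε) * σ.OPT) : σ.shift y + σ.unit ≤ σ.shift z := by
  have h1 := ha.unit_pos
  have h2 := ha.area_lt
  rcases lt_or_ge y σ.tallMin with h3 | h3
  · have := ha.le_shift (y := z) (by linarith)
    rw [ha.shift_of_lt h3]
    linarith
  · rw [ha.shift_of_le (y := z) (by linarith), Setting.shift, if_pos h3, if_neg (by linarith)]
    linarith

theorem stretch_mono {y z : ℝ} (h : y ≤ z) : σ.stretch y ≤ σ.stretch z :=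
  add_le_add h (ha.shift_mono h)

theorem tallHeight_mem (q : Rounding ι) {i : ι} (h0 : 0 ≤ q.height i) :
    q.height i ≤ σ.tallHeight q i ∧ σ.tallHeight q i < q.height i + σ.unit := by
  have hu := ha.unit_pos
  rw [Setting.unit] at hu ⊢
  constructor
  · exact (div_le_iff₀ hu).1 (Nat.le_ceil _)
  · have := mul_lt_mul_of_pos_right (Nat.ceil_lt_add_one (div_nonneg h0 hu.le)) hu
    rwa [add_mul, one_mul, div_mul_cancel₀ _ hu.ne'] at this

variable {q : Rounding ι} (hq : σ.IsRounded q) {B : Box} (hB : σ.BoxValid B)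
include hq

theorem tallMin_le {i : ι} (hi : σ.IsT i) : σ.tallMin ≤ q.height i :=
  hi.2.trans (ha.h_le_height hq (Or.inr (Or.inl hi)))

omit ha in
/-- Two items in the same column are vertically disjoint. -/
theorem column_disjoint {i j : ι} (hi : σ.Kept i) (hj : σ.Kept j) (hij : i ≠ j) {x : ℕ}
    (h1 : q.x i ≤ x ∧ x < q.x i + σ.w i) (h2 : q.x j ≤ x ∧ x < q.x j + σ.w j)
    (hi0 : 0 < q.height i) (hj0 : 0 < q.height j) :
    q.y i + q.height i ≤ q.y j ∨ q.y j + q.height j ≤ q.y i := by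
  by_contra! h
  refine hq.not_overlap i j hi hj hij ((Box.overlap_iff _ _).2 ⟨x, max (q.y i) (q.y j),
    ⟨h1.1, h1.2, le_max_left _ _, max_lt ?_ h.1⟩, h2.1, h2.2, le_max_right _ _, max_lt h.2 ?_⟩)
  · exact lt_add_of_pos_right _ hi0
  · exact lt_add_of_pos_right _ hj0

omit ha hq in
theorem kept_of_isT {i : ι} (h : σ.IsT i) : σ.Kept i := Or.inr (Or.inl h)

omit ha hq in
theorem kept_of_isV {i : ι} (h : σ.IsV i) : σ.Kept i := Or.inr (Or.inr (Or.inl h))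

/-- The item in the bottom row lies below the one in the top row. -/
theorem bottom_le_top {x : ℕ} {i j : ι} (h1 : σ.TallAt q B false x i)
    (h2 : σ.TallAt q B true x j) : q.y i + q.height i ≤ q.y j := by
  have h3 : ¬ B.y + σ.tallMin ≤ q.y i := fun h => Bool.noConfusion (h1.2.2.2.2 h)
  have h4 := h2.2.2.2.1 rfl
  have hij : i ≠ j := by
    rintro rfl
    exact h3 h4
  have h5 := column_disjoint hq (kept_of_isT h1.1) (kept_of_isT h2.1) hij h1.2.1 h2.2.1
    (ha.height_pos hq (kept_of_isT h1.1)) (ha.height_pos hq (kept_of_isT h2.1))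
  have := ha.height_pos hq (kept_of_isT h2.1)
  rcases h5 with h5 | h5
  · exact h5
  · linarith

include hB

/-- Above a tall item of the bottom row one is at least τ above the floor, hence in the top row. Two
items of the top row would require a height of 3τ. -/
theorem tallAt_unique {ρ : Bool} {x : ℕ} {i j : ι} (h1 : σ.TallAt q B ρ x i)
    (h2 : σ.TallAt q B ρ x j) : i = j := by
  have key : ∀ {i j : ι}, σ.TallAt q B ρ x i → σ.TallAt q B ρ x j →
      ¬ q.y i + q.height i ≤ q.y j := by
    intro i j h1 h2 h
    have e1 := ha.tallMin_le hq h1.1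
    have e2 := ha.tallMin_le hq h2.1
    have e3 := h1.2.2.1
    have e4 := h2.2.2.1
    have e5 := hB.y_nonneg
    have e6 := hB.top_le
    have e7 := ha.area_lt
    cases ρ
    · have : ¬ B.y + σ.tallMin ≤ q.y j := fun h => Bool.noConfusion (h2.2.2.2.2 h)
      linarith
    · have := h1.2.2.2.1 rfl
      linarith
  by_contra hij
  rcases column_disjoint hq (kept_of_isT h1.1) (kept_of_isT h2.1) hij h1.2.1 h2.2.1
    (ha.height_pos hq (kept_of_isT h1.1)) (ha.height_pos hq (kept_of_isT h2.1)) with h | h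
  · exact key h1 h2 h
  · exact key h2 h1 h

theorem occItem_eq_some {ρ : Bool} {x : ℕ} {i : ι} :
    σ.occItem q B ρ x = some i ↔ σ.TallAt q B ρ x i := by
  rw [Setting.occItem]
  constructor
  · intro h
    split_ifs at h with h'
    rw [← Option.some.inj h]
    exact h'.choose_spec
  · intro h
    have h' : ∃ i, σ.TallAt q B ρ x i := ⟨i, h⟩
    rw [dif_pos h', ha.tallAt_unique hq hB h'.choose_spec h]

theorem occ_of_tallAt {ρ : Bool} {x : ℕ} {i : ι} (h : σ.TallAt q B ρ x i) :
    σ.occ q B ρ x = some (σ.itemKey q B ρ i) := by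
  rw [Setting.occ, (ha.occItem_eq_some hq hB).2 h, Option.map_some]

theorem exists_tallAt {ρ : Bool} {x : ℕ} {a : Key} (h : σ.occ q B ρ x = some a) :
    ∃ i, σ.TallAt q B ρ x i ∧ σ.itemKey q B ρ i = a := by
  rw [Setting.occ, Option.map_eq_some_iff] at h
  obtain ⟨i, h1, h2⟩ := h
  exact ⟨i, (ha.occItem_eq_some hq hB).1 h1, h2⟩

theorem rowLo_of_tallAt {ρ : Bool} {x : ℕ} {i : ι} (h : σ.TallAt q B ρ x i) :
    σ.rowLo q B ρ x = if σ.itemKind q B i ≠ 1 ∧ ρ = false then B.y else q.y i := by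
  rw [Setting.rowLo, (ha.occItem_eq_some hq hB).2 h]

theorem rowHi_of_tallAt {ρ : Bool} {x : ℕ} {i : ι} (h : σ.TallAt q B ρ x i) :
    σ.rowHi q B ρ x =
      if σ.itemKind q B i ≠ 1 ∧ ρ = true then B.y + B.h else q.y i + q.height i := by
  rw [Setting.rowHi, (ha.occItem_eq_some hq hB).2 h]

omit ha hq hB in
theorem row_of_occ_none {ρ : Bool} {x : ℕ} (h : σ.occ q B ρ x = none) :
    σ.rowLo q B ρ x = (if ρ then B.y + B.h else B.y) ∧
      σ.rowHi q B ρ x = if ρ then B.y + B.h else B.y := by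
  rw [Setting.occ, Option.map_eq_none_iff] at h
  rw [Setting.rowLo, Setting.rowHi, h]
  exact ⟨rfl, rfl⟩

/-- The reserved part contains the item. -/
theorem row_bounds {ρ : Bool} {x : ℕ} {i : ι} (h : σ.TallAt q B ρ x i) :
    B.y ≤ σ.rowLo q B ρ x ∧ σ.rowLo q B ρ x ≤ q.y i ∧
      q.y i + q.height i ≤ σ.rowHi q B ρ x ∧ σ.rowHi q B ρ x ≤ B.y + B.h ∧
      (ρ = true → σ.rowLo q B ρ x = q.y i) ∧
      (ρ = false → σ.rowHi q B ρ x = q.y i + q.height i) := by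
  rw [ha.rowLo_of_tallAt hq hB h, ha.rowHi_of_tallAt hq hB h]
  have h1 := h.2.2.1
  cases ρ <;> by_cases h2 : σ.itemKind q B i = 1 <;> simp [h2, h1.1, h1.2]

theorem row_chain (x : ℕ) : B.y ≤ σ.rowLo q B false x ∧
    σ.rowLo q B false x ≤ σ.rowHi q B false x ∧ σ.rowHi q B false x ≤ σ.rowLo q B true x ∧
    σ.rowLo q B true x ≤ σ.rowHi q B true x ∧ σ.rowHi q B true x ≤ B.y + B.h := by
  have h0 := hB.h_pos
  have hs : ∀ ρ, (∃ i, σ.TallAt q B ρ x i) ∨ σ.occ q B ρ x = none := by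
    intro ρ
    rcases h : σ.occ q B ρ x with _ | a
    · exact Or.inr rfl
    · obtain ⟨i, hi, -⟩ := ha.exists_tallAt hq hB h
      exact Or.inl ⟨i, hi⟩
  rcases hs false with ⟨i, hi⟩ | h1 <;> rcases hs true with ⟨j, hj⟩ | h2
  · have e1 := ha.row_bounds hq hB hi
    have e2 := ha.row_bounds hq hB hj
    have e3 := ha.bottom_le_top hq hi hj
    have e4 := ha.height_pos hq (kept_of_isT hi.1)
    have e5 := ha.height_pos hq (kept_of_isT hj.1)
    rw [e1.2.2.2.2.2 rfl, e2.2.2.2.2.1 rfl]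
    exact ⟨e1.1, by linarith, e3, by linarith, e2.2.2.2.1⟩
  · have e1 := ha.row_bounds hq hB hi
    have e2 := row_of_occ_none h2
    have e4 := ha.height_pos hq (kept_of_isT hi.1)
    rw [e2.1, e2.2, if_pos rfl]
    exact ⟨e1.1, by linarith, e1.2.2.2.1, le_rfl, le_rfl⟩
  · have e1 := row_of_occ_none h1
    have e2 := ha.row_bounds hq hB hj
    have e5 := ha.height_pos hq (kept_of_isT hj.1)
    rw [e1.1, e1.2, if_neg Bool.false_ne_true]
    exact ⟨le_rfl, le_rfl, e2.1, by linarith, e2.2.2.2.1⟩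
  · have e1 := row_of_occ_none h1
    have e2 := row_of_occ_none h2
    rw [e1.1, e1.2, e2.1, e2.2, if_neg Bool.false_ne_true, if_pos rfl]
    exact ⟨le_rfl, le_rfl, by linarith, le_rfl, le_rfl⟩

theorem gap_nonneg (x : ℕ) : 0 ≤ σ.gap q B x := by
  have := ha.row_chain hq hB x
  rw [Setting.gap]
  linarith

theorem gap_le (x : ℕ) : σ.gap q B x ≤ B.h := by
  have := ha.row_chain hq hB x
  rw [Setting.gap]
  linarith

theorem stackPos_top (x : ℕ) : σ.stackPos q B x (B.y + B.h) = σ.gap q B x := by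
  obtain ⟨h1, h2, h3, h4, h5⟩ := ha.row_chain hq hB x
  rw [Setting.stackPos, Setting.gap, min_eq_right (h3.trans (h4.trans h5)), min_eq_right h5,
    max_eq_right (by linarith), max_eq_right (by linarith)]
  ring

theorem stackPos_bottom (x : ℕ) : σ.stackPos q B x B.y = 0 := by
  obtain ⟨h1, h2, h3, h4, h5⟩ := ha.row_chain hq hB x
  rw [Setting.stackPos, max_eq_left, max_eq_left]
  · ring
  · linarith [min_le_left B.y (σ.rowHi q B true x)]
  · linarith [min_le_left B.y (σ.rowHi q B false x)]

/-- Each reserved part alone absorbs at most v' - v. The two parts are disjoint with the lower one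
first, so together they do not absorb more either. -/
theorem stackPos_mono (x : ℕ) {v v' : ℝ} (h : v ≤ v') :
    σ.stackPos q B x v ≤ σ.stackPos q B x v' := by
  obtain ⟨h1, h2, h3, h4, h5⟩ := ha.row_chain hq hB x
  unfold Setting.stackPos
  generalize σ.rowLo q B false x = l0 at *
  generalize σ.rowLo q B true x = l1 at *
  generalize σ.rowHi q B false x = u0 at *
  generalize σ.rowHi q B true x = u1 at *
  have lip : ∀ l u : ℝ, max 0 (min v' u - l) ≤ max 0 (min v u - l) + (v' - v) := by
    intro l u
    have a1 := le_max_left (0 : ℝ) (min v u - l)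
    have a2 := le_max_right (0 : ℝ) (min v u - l)
    have a3 : min v' u ≤ min v u + (v' - v) := by
      rcases min_cases v u with ⟨b1, b2⟩ | ⟨b1, b2⟩
      · linarith [min_le_left v' u]
      · linarith [min_le_right v' u]
    exact max_le (by linarith) (by linarith)
  have f0 := lip l0 u0
  have f1 := lip l1 u1
  rcases le_total v' l1 with c1 | c1
  · have e1 : max 0 (min v' u1 - l1) = 0 := max_eq_left (by linarith [min_le_left v' u1])
    have e2 := le_max_left (0 : ℝ) (min v u1 - l1)
    linarith
  rcases le_total u0 v with c2 | c2
  · rw [min_eq_right c2, min_eq_right (c2.trans h)]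
    linarith
  · have e1 : max 0 (min v' u1 - l1) ≤ v' - l1 :=
      max_le (by linarith) (by linarith [min_le_left v' u1])
    have e2 : max 0 (min v' u0 - l0) = u0 - l0 := by
      rw [min_eq_right (by linarith), max_eq_right (by linarith)]
    have e3 := le_max_right (0 : ℝ) (min v u0 - l0)
    have e4 := le_max_left (0 : ℝ) (min v u1 - l1)
    rw [min_eq_left c2] at e3 ⊢
    linarith

omit ha hq hB in
theorem stackPos_add {x : ℕ} {v h : ℝ} (h0 : 0 ≤ h)
    (hd : ∀ ρ, v + h ≤ σ.rowLo q B ρ x ∨ σ.rowHi q B ρ x ≤ v) :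
    σ.stackPos q B x (v + h) = σ.stackPos q B x v + h := by
  have key : ∀ l u : ℝ, v + h ≤ l ∨ u ≤ v →
      max 0 (min (v + h) u - l) = max 0 (min v u - l) := by
    rintro l u (h1 | h1)
    · rw [max_eq_left, max_eq_left]
      · linarith [min_le_left v u]
      · linarith [min_le_left (v + h) u]
    · rw [min_eq_right h1, min_eq_right (by linarith)]
  rw [Setting.stackPos, Setting.stackPos, key _ _ (hd false), key _ _ (hd true)]
  ring

/-- The part that is used up by a row does not increase too much. -/
theorem itemKey_val {ρ : Bool} {x : ℕ} {i : ι} (h : σ.TallAt q B ρ x i) :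
    σ.tallHeight q i ≤ (σ.itemKey q B ρ i).val ∧
    (ρ = false → (σ.itemKey q B ρ i).val ≤ (σ.rowHi q B ρ x - σ.rowLo q B ρ x) +
      (σ.shift (q.y i) - σ.shift B.y) + (σ.tallHeight q i - q.height i)) ∧
    (ρ = true → (σ.itemKey q B ρ i).val ≤ (σ.rowHi q B ρ x - σ.rowLo q B ρ x) +
      max (σ.tallHeight q i - q.height i) (σ.shift (B.y + B.h) - σ.shift (q.y i))) := by
  have e1 := ha.tallHeight_mem q (i := i) (ha.height_pos hq (kept_of_isT h.1)).le
  have e2 := ha.tallMin_le hq h.1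
  have e3 := h.2.2.1
  have e4 := hB.y_nonneg
  have e5 := hB.top_le
  have e6 := ha.shift_mono e3.1
  have e7 := ha.shift_add_le (y := q.y i) (z := B.y + B.h) (by linarith) (by linarith) e5
  rw [ha.rowLo_of_tallAt hq hB h, ha.rowHi_of_tallAt hq hB h, Setting.itemKey, Key.val_mk]
  unfold Setting.stretch
  have m1 := le_max_left (σ.tallHeight q i - q.height i) (σ.shift (B.y + B.h) - σ.shift (q.y i))
  have m2 := le_max_right (σ.tallHeight q i - q.height i) (σ.shift (B.y + B.h) - σ.shift (q.y i))
  cases ρ <;> by_cases h2 : σ.itemKind q B i = 1 <;> simp [h2] <;>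
    (try constructor) <;> linarith

theorem tallMin_le_row {ρ : Bool} {x : ℕ} {i : ι} (h : σ.TallAt q B ρ x i) :
    σ.tallMin ≤ σ.rowHi q B ρ x - σ.rowLo q B ρ x := by
  have e2 := ha.tallMin_le hq h.1
  have := ha.row_bounds hq hB h
  linarith

/-- A box with two tall items in the same column is high. -/
theorem two_tallMin_le {x : ℕ} {i j : ι} (h1 : σ.TallAt q B false x i)
    (h2 : σ.TallAt q B true x j) : 2 * σ.tallMin ≤ B.h := by
  have e1 := ha.row_chain hq hB x
  have e2 := ha.tallMin_le_row hq hB h1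
  have e3 := ha.tallMin_le_row hq hB h2
  linarith

/-- The hypotheses of `exists_arrangement` are checked for the stretched box, with the spare height
εOPT in the role of `E`. -/
theorem exists_layout : ∃ p key S dest, IsArrangement B.w (σ.stretch (B.y + B.h) - σ.stretch B.y)
    σ.ε (σ.occ q B) (σ.gap q B) p key S dest ∧ S.card ≤ breakBound (N + 7) := by
  classical
  have hu := ha.unit_pos
  have ht := ha.tallMin_pos
  have hε := ha.ε_pos
  have hε' := ha.ε_le
  have hy := hB.y_nonneg
  have htop := hB.top_le
  have hh := hB.h_pos
  have harea := ha.area_lt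
  have hsm : σ.shift B.y ≤ σ.shift (B.y + B.h) := ha.shift_mono (by linarith)
  have hhat : σ.stretch (B.y + B.h) - σ.stretch B.y =
      B.h + (σ.shift (B.y + B.h) - σ.shift B.y) := by
    unfold Setting.stretch; ring
  rw [hhat]
  set hh' := B.h + (σ.shift (B.y + B.h) - σ.shift B.y) with hhh
  -- The minimum covers boxes lower than τ, which contain no tall item. A key is either that of an
  -- item inside the box, a multiple of εOPT up to (N + 2)εOPT, or belongs to one of the two rows in
  -- the first or last column; this gives N + 7 keys.
  refine exists_arrangement (c := min σ.tallMin hh') (E := σ.unit) (lt_min ht (by linarith))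
    (min_le_right _ _) (by linarith) hu ?_ ?_ (fun x _ => ha.gap_nonneg hq hB x) ?_ ?_ ?_
    (Finset.univ.biUnion (fun ρ : Bool => (σ.occ q B ρ 0).toFinset ∪
      (σ.occ q B ρ (B.w - 1)).toFinset) ∪
      (Finset.range (N + 3)).image (fun m : ℕ => Key.mk (m * σ.unit) (m * σ.unit) 1)) ?_ ?_
  · have h1 : hh' ≤ (1 + 2 * σ.ε) * σ.OPT + 3 * σ.unit := by
      have := ha.shift_le (B.y + B.h)
      have := ha.shift_nonneg B.y
      linarith
    rcases le_total σ.tallMin hh' with h2 | h2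
    · rw [min_eq_left h2]
      have h3 : hh' - 2 * σ.tallMin ≤ (1 / 3 + 3 * σ.ε) * σ.OPT := by
        rw [Setting.tallMin]
        rw [Setting.unit] at h1
        linarith
      refine (mul_le_mul_of_nonneg_left h3 (by linarith)).trans ?_
      -- The middle part has height at most (1/3 + 3ε)OPT, so the condition reads 2(1/3 + 3ε) ≤ 1 -
      -- 2ε, that is, ε ≤ 1/24.
      have h4 : 0 ≤ σ.unit * (1 - 2 * σ.ε - 2 * (1 / 3 + 3 * σ.ε)) :=
        mul_nonneg hu.le (by linarith)
      have h5 : 2 * σ.ε * ((1 / 3 + 3 * σ.ε) * σ.OPT) = σ.unit * (2 * (1 / 3 + 3 * σ.ε)) := by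
        rw [Setting.unit]; ring
      rw [h5]
      linarith
    · rw [min_eq_right h2]
      have h3 : 0 ≤ 2 * σ.ε * hh' := mul_nonneg (by linarith) (by linarith)
      have h4 : 0 ≤ (1 - 2 * σ.ε) * σ.unit := mul_nonneg (by linarith) hu.le
      linarith
  · intro ρ x a _ hoc
    obtain ⟨i, hi, rfl⟩ := ha.exists_tallAt hq hB hoc
    exact (min_le_left _ _).trans (((ha.tallMin_le hq hi.1).trans (ha.tallHeight_mem q
      (ha.height_pos hq (kept_of_isT hi.1)).le).1).trans (ha.itemKey_val hq hB hi).1)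
  · intro x a b _ h1 h2
    obtain ⟨i, hi, rfl⟩ := ha.exists_tallAt hq hB h1
    obtain ⟨j, hj, rfl⟩ := ha.exists_tallAt hq hB h2
    have e1 := (ha.itemKey_val hq hB hi).2.1 rfl
    have e2 := (ha.itemKey_val hq hB hj).2.2 rfl
    have e3 := ha.bottom_le_top hq hi hj
    have e4 := hj.2.2.2.1 rfl
    have e5 := ha.tallMin_le hq hi.1
    have e6 := ha.tallMin_le hq hj.1
    have e7 := hi.2.2.1
    have e8 := hj.2.2.1
    have f1 := ha.tallHeight_mem q (i := i) (ha.height_pos hq (kept_of_isT hi.1)).le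
    have f2 := ha.tallHeight_mem q (i := j) (ha.height_pos hq (kept_of_isT hj.1)).le
    -- The box gains 3u. The bottom item loses less than u by rounding, the top one at most u:
    -- either by rounding or, if it sticks out, because it was already lifted by 2u of the 3u. So u
    -- remains.
    have s1 : σ.shift B.y = 0 := ha.shift_of_lt (by linarith)
    have s2 : σ.shift (B.y + B.h) = 3 * σ.unit := ha.shift_of_le (by linarith)
    have s3 : σ.shift (q.y i) = 0 := ha.shift_of_lt (by linarith)
    have s4 : 2 * σ.unit ≤ σ.shift (q.y j) := ha.le_shift (by linarith)
    have e9 : max (σ.tallHeight q j - q.height j) (σ.shift (B.y + B.h) - σ.shift (q.y j)) ≤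
        σ.unit := max_le (by linarith) (by linarith)
    rw [Setting.gap]
    linarith
  · intro ρ x a _ h1 h2
    obtain ⟨i, hi, rfl⟩ := ha.exists_tallAt hq hB h1
    have e5 := ha.tallMin_le hq hi.1
    have e7 := hi.2.2.1
    have f1 := ha.tallHeight_mem q (i := i) (ha.height_pos hq (kept_of_isT hi.1)).le
    have s1 := ha.shift_add_le (y := q.y i) (z := B.y + B.h) (by linarith) (by linarith) htop
    have s2 := ha.shift_mono e7.1
    have e2 := row_of_occ_none h2
    rw [Setting.gap]
    cases ρ
    · rw [Bool.not_false] at e2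
      have e1 := (ha.itemKey_val hq hB hi).2.1 rfl
      linarith
    · rw [Bool.not_true] at e2
      have e1 := (ha.itemKey_val hq hB hi).2.2 rfl
      have e9 : max (σ.tallHeight q i - q.height i) (σ.shift (B.y + B.h) - σ.shift (q.y i)) ≤
        σ.shift (B.y + B.h) - σ.shift B.y := max_le (by linarith) (by linarith)
      linarith
  · intro x _ _ _
    linarith [ha.gap_le hq hB x]
  · intro ρ x a hx hoc
    have hoc' := hoc
    obtain ⟨i, hi, rfl⟩ := ha.exists_tallAt hq hB hoc
    have hx1 := hi.2.1
    by_cases h1 : q.x i < B.x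
    · have : σ.TallAt q B ρ 0 i := ⟨hi.1, ⟨by omega, by omega⟩, hi.2.2⟩
      refine Finset.mem_union_left _ (Finset.mem_biUnion.2 ⟨ρ, Finset.mem_univ _,
        Finset.mem_union_left _ ?_⟩)
      rw [Option.mem_toFinset, ha.occ_of_tallAt hq hB this]
      rfl
    by_cases h2 : B.x + B.w < q.x i + σ.w i
    · have : σ.TallAt q B ρ (B.w - 1) i := ⟨hi.1, ⟨by omega, by omega⟩, hi.2.2⟩
      refine Finset.mem_union_left _ (Finset.mem_biUnion.2 ⟨ρ, Finset.mem_univ _,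
        Finset.mem_union_right _ ?_⟩)
      rw [Option.mem_toFinset, ha.occ_of_tallAt hq hB this]
      rfl
    · have hk : σ.itemKind q B i = 1 := by rw [Setting.itemKind, if_neg h1, if_neg h2]
      refine Finset.mem_union_right _ (Finset.mem_image.2 ⟨⌈q.height i / σ.unit⌉₊, ?_, ?_⟩)
      · rw [Finset.mem_range, Nat.lt_succ_iff, Nat.ceil_le, div_le_iff₀ hu]
        have h3 : ((N + 2 : ℕ) : ℝ) * σ.unit = (1 + 2 * σ.ε) * σ.OPT := by
          rw [Setting.unit]
          push_cast
          calc ((N : ℝ) + 2) * (σ.ε * σ.OPT) = (σ.ε * N + 2 * σ.ε) * σ.OPT := by ring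
            _ = _ := by rw [ha.ε_mul_N]
        rw [h3]
        linarith [hi.2.2.1]
      · rw [Setting.itemKey, if_pos hk, hk]
        rfl
  · have h1 : ∀ o : Option Key, o.toFinset.card ≤ 1 := by
      intro o; cases o <;> simp
    refine (Finset.card_union_le _ _).trans ?_
    have h2 : (Finset.univ.biUnion (fun ρ : Bool => (σ.occ q B ρ 0).toFinset ∪
        (σ.occ q B ρ (B.w - 1)).toFinset)).card ≤ 4 := by
      refine (Finset.card_biUnion_le_card_mul _ _ 2 fun ρ _ => ?_).trans (by simp)
      refine (Finset.card_union_le _ _).trans ?_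
      have := h1 (σ.occ q B ρ 0)
      have := h1 (σ.occ q B ρ (B.w - 1))
      omega
    have h3 := Finset.card_image_le (s := Finset.range (N + 3))
      (f := fun m : ℕ => Key.mk (m * σ.unit) (m * σ.unit) 1)
    rw [Finset.card_range] at h3
    omega

end Setting.Admissible

/-! ### The enlarged boxes -/

namespace Setting

/-- The box `B` after moving the points of the packing upwards. -/
noncomputable def stretchBox {ι : Type*} (σ : Setting ι) (B : Box) : Box :=
  ⟨B.x, B.w, σ.stretch B.y, σ.stretch (B.y + B.h) - σ.stretch B.y⟩

/-- The boxes `P` after moving the points of the packing upwards. -/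
noncomputable def stretchBoxes {ι : Type*} (σ : Setting ι) {nH nTV : ℕ} (P : σ.BoxFamily nH nTV) :
    σ.BoxFamily nH nTV :=
  Sum.elim (fun i => ⟨(P.boxL i).x, (P.boxL i).w, σ.stretch (P.boxL i).y, (P.boxL i).h⟩)
    (Sum.elim (fun a => ⟨(P.boxH a).x, (P.boxH a).w, σ.stretch (P.boxH a).y, (P.boxH a).h⟩)
      fun a => σ.stretchBox (P.boxTV a))

/-- The disjoint boxes `B` contain all tall and vertical items, and the horizontal borders of the
boxes do not cut these items. -/
structure Houses {ι : Type*} (σ : Setting ι) (q : Rounding ι) {m : ℕ} (B : Fin m → Box) :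
    Prop where
  valid : ∀ a, σ.BoxValid (B a)
  x_le : ∀ a, (B a).x + (B a).w ≤ σ.W
  eq_of_mem : ∀ a b (x : ℕ) (v : ℝ),
    ((B a).x ≤ x ∧ x < (B a).x + (B a).w ∧ (B a).y ≤ v ∧ v < (B a).y + (B a).h) →
    ((B b).x ≤ x ∧ x < (B b).x + (B b).w ∧ (B b).y ≤ v ∧ v < (B b).y + (B b).h) → a = b
  cover : ∀ i, σ.IsT i ∨ σ.IsV i → ∀ x, q.x i ≤ x → x < q.x i + σ.w i →
    ∃ a, ((B a).x ≤ x ∧ x < (B a).x + (B a).w) ∧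
      (B a).y ≤ q.y i ∧ q.y i + q.height i ≤ (B a).y + (B a).h

theorem box_valid {ι : Type*} {σ : Setting ι} {q : Rounding ι} {nH nTV : ℕ}
    {P : σ.BoxFamily nH nTV} (hP : σ.IsBoxPartition q P) (a) :
    σ.BoxValid (P a) ∧ (P a).x + (P a).w ≤ σ.W := by
  have h0 := hP.pos a
  have key : ∀ (x : ℕ) (v : ℝ), (P a).x ≤ x ∧ x < (P a).x + (P a).w ∧ (P a).y ≤ v ∧
      v < (P a).y + (P a).h → x < σ.W ∧ 0 ≤ v ∧ v < (1 + 2 * σ.ε) * σ.OPT := by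
    intro x v h
    have h1 : ((x : ℝ), v) ∈ ⋃ a, (P a).region :=
      Set.mem_iUnion.2 ⟨a, (Box.natCast_mem_region_iff _ _ _).2 h⟩
    rw [hP.union] at h1
    simp only [Set.mem_prod, Set.mem_Ico, Nat.cast_nonneg, true_and, Nat.cast_lt] at h1
    exact h1
  refine ⟨⟨?_, h0.2, ?_⟩, ?_⟩
  · exact (key (P a).x (P a).y ⟨le_rfl, by omega, le_rfl, by linarith⟩).2.1
  · refine le_of_forall_lt fun v hv => ?_
    have := (key (P a).x (max v (P a).y) ⟨le_rfl, by omega, le_max_right _ _,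
      max_lt hv (by linarith)⟩).2.2
    exact (le_max_left _ _).trans_lt this
  · have := (key ((P a).x + (P a).w - 1) (P a).y ⟨by omega, by omega, le_rfl, by linarith⟩).1
    omega

namespace Admissible

variable {ι : Type*} {σ : Setting ι} {N k : ℕ} (ha : σ.Admissible N k)
include ha

/-- Disjoint boxes are separated horizontally, which is unaffected, or vertically, which the
monotone map preserves. -/
theorem stretch_disjoint {A B A' B' : Box} (hA : 0 < A.h) (hB : 0 < B.h)
    (h : Disjoint A.region B.region) (hx : A'.x = A.x ∧ A'.w = A.w) (hx' : B'.x = B.x ∧ B'.w = B.w)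
    (hy : A'.y = σ.stretch A.y) (hy' : B'.y = σ.stretch B.y)
    (ht : A'.y + A'.h ≤ σ.stretch (A.y + A.h)) (ht' : B'.y + B'.h ≤ σ.stretch (B.y + B.h)) :
    Disjoint A'.region B'.region := by
  rw [Box.disjoint_iff, Box.overlap_iff] at h ⊢
  rintro ⟨x, v, h1, h2⟩
  rw [hx.1, hx.2] at h1
  rw [hx'.1, hx'.2] at h2
  by_cases h3 : A.y + A.h ≤ B.y
  · have := ha.stretch_mono h3
    linarith
  by_cases h4 : B.y + B.h ≤ A.y
  · have := ha.stretch_mono h4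
    linarith
  push Not at h3 h4
  exact h ⟨x, max A.y B.y, ⟨h1.1, h1.2.1, le_max_left _ _, max_lt (by linarith) h3⟩,
    h2.1, h2.2.1, le_max_right _ _, max_lt h4 (by linarith)⟩

theorem le_stretch (y : ℝ) : y ≤ σ.stretch y :=
  le_add_of_nonneg_right (ha.shift_nonneg y)

theorem stretch_le {y : ℝ} (h : y ≤ (1 + 2 * σ.ε) * σ.OPT) :
    σ.stretch y ≤ (1 + 5 * σ.ε) * σ.OPT := by
  have := ha.shift_le y
  rw [Setting.unit] at this
  rw [Setting.stretch]
  linarith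

theorem add_stretch_le {y h : ℝ} (h0 : 0 ≤ h) : σ.stretch y + h ≤ σ.stretch (y + h) := by
  have := ha.shift_mono (y := y) (z := y + h) (by linarith)
  rw [Setting.stretch, Setting.stretch]
  linarith

variable {q : Rounding ι} {nH nTV : ℕ} {P : σ.BoxFamily nH nTV}

theorem isEnlargement_stretchBoxes (hP : σ.IsBoxPartition q P) :
    σ.IsEnlargement P (σ.stretchBoxes P) := by
  have hx : ∀ a, (σ.stretchBoxes P a).x = (P a).x ∧ (σ.stretchBoxes P a).w = (P a).w := by
    rintro (i | a | a) <;> exact ⟨rfl, rfl⟩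
  have hy : ∀ a, (σ.stretchBoxes P a).y = σ.stretch (P a).y := by
    rintro (i | a | a) <;> rfl
  have ht : ∀ a, (σ.stretchBoxes P a).y + (σ.stretchBoxes P a).h ≤
      σ.stretch ((P a).y + (P a).h) := by
    rintro (i | a | a)
    · exact ha.add_stretch_le (hP.pos _).2.le
    · exact ha.add_stretch_le (hP.pos _).2.le
    · exact (add_sub_cancel _ _).le
  refine ⟨fun a => (hx a).1, fun a => (hx a).2, fun a => ?_, fun _ => rfl, fun _ => rfl,
    fun a => ?_, fun a => ?_, fun a b hab => ?_⟩
  · rw [hy]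
    exact ha.le_stretch _
  · have := ha.add_stretch_le (y := (P.boxTV a).y) (hP.pos (Sum.inr (Sum.inr a))).2.le
    change _ ≤ σ.stretch ((P.boxTV a).y + (P.boxTV a).h) - σ.stretch (P.boxTV a).y
    linarith
  · exact (ht a).trans (ha.stretch_le (box_valid hP a).1.top_le)
  · exact ha.stretch_disjoint (hP.pos a).2 (hP.pos b).2 (hP.disjoint a b hab) (hx a) (hx b)
      (hy a) (hy b) (ht a) (ht b)

theorem houses_boxTV (hq : σ.IsRounded q) (hP : σ.IsBoxPartition q P) : σ.Houses q P.boxTV := by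
  refine ⟨fun a => (box_valid hP _).1, fun a => (box_valid hP _).2, ?_, ?_⟩
  · intro a b x v h1 h2
    by_contra hab
    have := hP.disjoint (Sum.inr (Sum.inr a)) (Sum.inr (Sum.inr b))
      (fun h => hab (Sum.inr.inj (Sum.inr.inj h)))
    rw [Box.disjoint_iff, Box.overlap_iff] at this
    exact this ⟨x, v, h1, h2⟩
  · intro i hi x h1 h2
    have hk : σ.Kept i := hi.elim kept_of_isT kept_of_isV
    have h0 := ha.height_pos hq hk
    have h3 := hq.y_le i hk
    have h4 : ((x : ℝ), q.y i) ∈ ⋃ a, (P a).region := by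
      rw [hP.union]
      refine ⟨⟨Nat.cast_nonneg _, ?_⟩, hq.y_nonneg i hk, ?_⟩
      · have := hq.x_le i hk
        exact Nat.cast_lt.2 (by omega)
      · change q.y i < _
        linarith
    obtain ⟨a, h5⟩ := Set.mem_iUnion.1 h4
    rw [Box.natCast_mem_region_iff] at h5
    have hov : (σ.itemBox q i).Overlap (P a) :=
      (Box.overlap_iff _ _).2 ⟨x, q.y i, ⟨h1, h2, le_rfl, lt_add_of_pos_right _ h0⟩, h5⟩
    rcases a with j | a | a
    · refine absurd hov ?_
      have e := hP.boxL j
      change ¬ (σ.itemBox q i).Overlap (P.boxL j)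
      rw [e]
      refine hq.not_overlap i j hk (kept_of_isL j.2) ?_
      rintro rfl
      exact ha.not_isL hi j.2
    · exact absurd (hP.boxH_only a i hk hov) (ha.not_flat (Or.inr hi))
    · exact ⟨a, ⟨h5.1, h5.2.1⟩, hP.uncut_TV (Sum.inr (Sum.inr a)) i hi hov⟩

end Admissible

end Setting

/-! ### Blocks of columns between break points -/

open Classical in
/-- The first column of the block of `y`, where the blocks are separated by the numbers in `T`. -/
noncomputable def blockLo (T : Finset ℕ) (y : ℕ) : ℕ :=
  Nat.findGreatest (fun s => s ∈ insert 0 T) y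

/-- The end of the block that starts with `s`. -/
noncomputable def blockHi (T : Finset ℕ) (n s : ℕ) : ℕ := sInf {b | s < b ∧ (b ∈ T ∨ b = n)}

/-- The first columns of the blocks. -/
def blockStarts (T : Finset ℕ) (n : ℕ) : Finset ℕ := {s ∈ insert 0 T | s < n}

section Blocks

variable {T : Finset ℕ} {n : ℕ}

theorem blockLo_spec (T : Finset ℕ) (y : ℕ) : blockLo T y ≤ y ∧ blockLo T y ∈ insert 0 T ∧
    ∀ s, blockLo T y < s → s ≤ y → s ∉ insert 0 T := by
  classical
  refine ⟨Nat.findGreatest_le _, ?_, fun s h1 h2 => Nat.findGreatest_is_greatest h1 h2⟩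
  exact Nat.findGreatest_spec (P := fun s => s ∈ insert 0 T) (Nat.zero_le y)
    (Finset.mem_insert_self _ _)

theorem blockHi_spec {s : ℕ} (hs : s < n) : (s < blockHi T n s ∧
    (blockHi T n s ∈ T ∨ blockHi T n s = n)) ∧ ∀ b, s < b → b ∈ T ∨ b = n → blockHi T n s ≤ b :=
  ⟨Nat.sInf_mem (s := {b | s < b ∧ (b ∈ T ∨ b = n)}) ⟨n, hs, Or.inr rfl⟩,
    fun _ h1 h2 => Nat.sInf_le ⟨h1, h2⟩⟩

theorem blockLo_mem {y : ℕ} (hy : y < n) : blockLo T y ∈ blockStarts T n :=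
  Finset.mem_filter.2 ⟨(blockLo_spec T y).2.1, (blockLo_spec T y).1.trans_lt hy⟩

theorem mem_block_iff {s y : ℕ} (hs : s ∈ blockStarts T n) :
    s ≤ y ∧ y < blockHi T n s ↔ y < n ∧ blockLo T y = s := by
  obtain ⟨hs1, hs2⟩ := Finset.mem_filter.1 hs
  have h1 := blockHi_spec (T := T) hs2
  have h2 := blockLo_spec T y
  constructor
  · rintro ⟨h3, h4⟩
    have h5 : y < n := h4.trans_le (h1.2 n hs2 (Or.inr rfl))
    refine ⟨h5, ?_⟩
    rcases lt_trichotomy (blockLo T y) s with h6 | h6 | h6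
    · exact absurd hs1 (h2.2.2 s h6 h3)
    · exact h6
    · have h7 : blockLo T y ∈ T := (Finset.mem_insert.1 h2.2.1).resolve_left (by omega)
      have := h1.2 _ h6 (Or.inl h7)
      omega
  · rintro ⟨h3, rfl⟩
    refine ⟨h2.1, ?_⟩
    by_contra! h4
    rcases h1.1.2 with h5 | h5
    · exact h2.2.2 _ h1.1.1 h4 (Finset.mem_insert_of_mem h5)
    · omega

theorem block_congr {α : Type*} {f : ℕ → α} (hf : ∀ y, y + 1 < n → y + 1 ∉ T → f y = f (y + 1))
    {y : ℕ} (hy : y < n) : f (blockLo T y) = f y := by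
  have h2 := blockLo_spec T y
  have key : ∀ d, blockLo T y + d ≤ y → f (blockLo T y) = f (blockLo T y + d) := by
    intro d
    induction d with
    | zero => exact fun _ => rfl
    | succ d ih =>
      intro hd
      rw [ih (by omega)]
      refine hf _ (by omega) fun h => ?_
      exact h2.2.2 _ (by omega) hd (Finset.mem_insert_of_mem h)
  have := key (y - blockLo T y) (by omega)
  rwa [Nat.add_sub_cancel' h2.1] at this

theorem blockLo_eq {y z : ℕ} (hyz : y ≤ z) (h : ∀ s, y < s → s ≤ z → s ∉ T) :
    blockLo T z = blockLo T y := by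
  have h1 := blockLo_spec T y
  have h2 := blockLo_spec T z
  refine le_antisymm ?_ ?_
  · by_contra! h3
    rcases Nat.lt_or_ge y (blockLo T z) with h4 | h4
    · exact h _ h4 h2.1 ((Finset.mem_insert.1 h2.2.1).resolve_left (by omega))
    · exact h1.2.2 _ h3 h4 h2.2.1
  · by_contra! h3
    exact h2.2.2 _ h3 (h1.1.trans hyz) h1.2.1

theorem card_blockStarts_le (T : Finset ℕ) (n : ℕ) : (blockStarts T n).card ≤ T.card + 1 :=
  (Finset.card_filter_le _ _).trans (Finset.card_insert_le _ _)

end Blocks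

/-! ### New places of the tall items -/

namespace Setting

/-- Rearrangements of the columns of the boxes `B` with at most `M` break points in each box. -/
structure Layout {ι : Type*} (σ : Setting ι) (q : Rounding ι) {m : ℕ} (B : Fin m → Box)
    (M : ℕ) where
  p : Fin m → Bool → ℕ → ℕ
  key : Fin m → Bool → ℕ → Key
  S : Fin m → Finset ℕ
  dest : Fin m → ℕ → Option (ℕ × ℕ)
  arr : ∀ a, IsArrangement (B a).w (σ.stretch ((B a).y + (B a).h) - σ.stretch (B a).y) σ.ε
    (σ.occ q (B a)) (σ.gap q (B a)) (p a) (key a) (S a) (dest a)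
  card_le : ∀ a, (S a).card ≤ M

/-- The layer of the tall items of row `ρ`. -/
def layerOf (ρ : Bool) : ℕ := if ρ then 3 else 1

/-- A tall item is fixed if it sticks out of a box. -/
def Fixed {ι : Type*} (σ : Setting ι) (q : Rounding ι) {m : ℕ} (B : Fin m → Box) (i : ι) : Prop :=
  ∃ a ρ x, x < (B a).w ∧ σ.TallAt q (B a) ρ x i ∧ σ.itemKind q (B a) i ≠ 1

/-- The new place of a fixed tall item. -/
noncomputable def fixedBox {ι : Type*} (σ : Setting ι) (q : Rounding ι) (i : ι) : Box :=
  ⟨q.x i, σ.w i, σ.stretch (q.y i), σ.tallHeight q i⟩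

section LayoutDefs

variable {ι : Type*} {σ : Setting ι} {q : Rounding ι} {m : ℕ} {B : Fin m → Box} {M : ℕ}
  (Λ : σ.Layout q B M)

/-- The lower end of layer `l` in column `x` of box `a`. -/
noncomputable def Layout.base (a : Fin m) (x l : ℕ) : ℝ :=
  σ.stretch (B a).y + cut (σ.stretch ((B a).y + (B a).h) - σ.stretch (B a).y) (Λ.key a false x)
    (Λ.key a true x) l

/-- The point at height `v` of column `x` lies in layer `l` of column `x'` of box `a`. -/
structure Layout.At (a : Fin m) (l x' x : ℕ) (v : ℝ) : Prop where
  lt_w : x' < (B a).w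
  x_eq : x = (B a).x + x'
  le : Λ.base a x' l ≤ v
  lt : v < Λ.base a x' (l + 1)

open Classical in
/-- The columns in which the key of row `ρ` changes. -/
noncomputable def Layout.rowBreaks (a : Fin m) (ρ : Bool) : Finset ℕ :=
  {y ∈ Λ.S a | Λ.key a ρ (y - 1) ≠ Λ.key a ρ y}

/-- A block of row `ρ` for tall items. -/
noncomputable def Layout.tallBlock (a : Fin m) (ρ : Bool) (s : ℕ) : Box :=
  ⟨(B a).x + s, blockHi (Λ.rowBreaks a ρ) (B a).w s - s, Λ.base a s (layerOf ρ),
    if (Λ.key a ρ s).kind ≤ 1 then (Λ.key a ρ s).inner else 0⟩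

/-- A block of layer `l` for vertical items. -/
noncomputable def Layout.vertBlock (a : Fin m) (l s : ℕ) : Box :=
  ⟨(B a).x + s, blockHi (Λ.S a) (B a).w s - s, Λ.base a s l,
    Λ.base a s (l + 1) - Λ.base a s l⟩

end LayoutDefs

namespace Admissible

variable {ι : Type*} {σ : Setting ι} {N k : ℕ} (ha : σ.Admissible N k) {q : Rounding ι}
  (hq : σ.IsRounded q) {m : ℕ} {B : Fin m → Box} (hB : σ.Houses q B)
include ha hq hB

theorem exists_layout_boxes : Nonempty (σ.Layout q B (breakBound (N + 7))) := by
  choose p key S dest h using fun a => ha.exists_layout hq (hB.valid a)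
  exact ⟨⟨p, key, S, dest, fun a => (h a).1, fun a => (h a).2⟩⟩

variable {M : ℕ} (Λ : σ.Layout q B M)

/-- The column in which an item is moved has the key of the item. -/
theorem key_of_tallAt {a : Fin m} {ρ : Bool} {x : ℕ} {i : ι} (hx : x < (B a).w)
    (h : σ.TallAt q (B a) ρ x i) : Λ.key a ρ (Λ.p a ρ x) = σ.itemKey q (B a) ρ i :=
  (Λ.arr a).key_eq ρ x _ hx (ha.occ_of_tallAt hq (hB.valid a) h)

theorem exists_tallAt_of_kind {a : Fin m} {ρ : Bool} {y : ℕ} (hy : y < (B a).w)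
    (h : (Λ.key a ρ y).kind ≠ 0) : ∃ x i, x < (B a).w ∧ Λ.p a ρ x = y ∧
      σ.TallAt q (B a) ρ x i ∧ Λ.key a ρ y = σ.itemKey q (B a) ρ i := by
  rcases (Λ.arr a).key_cases ρ y hy with ⟨x, hx, h1, h2⟩ | h1
  · obtain ⟨i, hi, h3⟩ := ha.exists_tallAt hq (hB.valid a) h2
    exact ⟨x, i, hx, h1, hi, h3.symm⟩
  · exact absurd h1.2.2 h

theorem key_bounds (a : Fin m) (ρ : Bool) {y : ℕ} (hy : y < (B a).w) :
    0 ≤ (Λ.key a ρ y).inner ∧ (Λ.key a ρ y).inner ≤ (Λ.key a ρ y).val := by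
  rcases (Λ.arr a).key_cases ρ y hy with ⟨x, hx, h1, h2⟩ | h1
  · obtain ⟨i, hi, h3⟩ := ha.exists_tallAt hq (hB.valid a) h2
    rw [← h3]
    have h4 := ha.itemKey_val hq (hB.valid a) hi
    have h5 := ha.height_pos hq (kept_of_isT hi.1)
    have h6 := ha.tallHeight_mem q (i := i) h5.le
    exact ⟨h5.le.trans h6.1, h4.1⟩
  · rw [h1.2.1]
    exact ⟨le_rfl, h1.1⟩

theorem base_step (a : Fin m) {x : ℕ} (hx : x < (B a).w) :
    Λ.base a x 0 = σ.stretch (B a).y ∧ Λ.base a x 0 ≤ Λ.base a x 1 ∧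
    Λ.base a x 1 ≤ Λ.base a x 2 ∧ Λ.base a x 2 ≤ Λ.base a x 3 ∧
    Λ.base a x 3 ≤ Λ.base a x 4 ∧ Λ.base a x 4 ≤ Λ.base a x 5 ∧
    Λ.base a x 5 = σ.stretch ((B a).y + (B a).h) := by
  have h0 := ha.key_bounds hq hB Λ a false hx
  have h1 := ha.key_bounds hq hB Λ a true hx
  have h2 := (Λ.arr a).sum_le x hx
  simp only [Layout.base, cut]
  refine ⟨by ring, ?_, ?_, ?_, ?_, ?_, by ring⟩ <;> linarith

theorem base_mono (a : Fin m) {x : ℕ} (hx : x < (B a).w) {l l' : ℕ} (h : l ≤ l') (hl' : l' ≤ 5) :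
    Λ.base a x l ≤ Λ.base a x l' := by
  obtain ⟨-, h1, h2, h3, h4, h5, -⟩ := ha.base_step hq hB Λ a hx
  interval_cases l' <;> interval_cases l <;> linarith

/-- Points of the new boxes. -/
theorem at_mem {a : Fin m} {l x' x : ℕ} {v : ℝ} (hl : l ≤ 4) (h : Λ.At a l x' x v) :
    (σ.stretchBox (B a)).x ≤ x ∧ x < (σ.stretchBox (B a)).x + (σ.stretchBox (B a)).w ∧
    (σ.stretchBox (B a)).y ≤ v ∧ v < (σ.stretchBox (B a)).y + (σ.stretchBox (B a)).h := by
  obtain ⟨h1, h2, h3, h4⟩ := h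
  have h5 := ha.base_step hq hB Λ a h1
  have h6 := ha.base_mono hq hB Λ a h1 (Nat.zero_le l) (by omega)
  have h7 := ha.base_mono hq hB Λ a h1 (show l + 1 ≤ 5 by omega) le_rfl
  simp only [Setting.stretchBox]
  exact ⟨by omega, by omega, by linarith, by linarith⟩

theorem exists_at {a : Fin m} {x : ℕ} {v : ℝ}
    (h : (σ.stretchBox (B a)).x ≤ x ∧ x < (σ.stretchBox (B a)).x + (σ.stretchBox (B a)).w ∧
    (σ.stretchBox (B a)).y ≤ v ∧ v < (σ.stretchBox (B a)).y + (σ.stretchBox (B a)).h) :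
    ∃ l x', l ≤ 4 ∧ Λ.At a l x' x v := by
  simp only [Setting.stretchBox] at h
  obtain ⟨h1, h2, h3, h4⟩ := h
  have hx : x - (B a).x < (B a).w := by omega
  have e : x = (B a).x + (x - (B a).x) := by omega
  have h5 := ha.base_step hq hB Λ a hx
  rcases lt_or_ge v (Λ.base a (x - (B a).x) 1) with c | c1
  · exact ⟨0, _, by omega, hx, e, by linarith, c⟩
  rcases lt_or_ge v (Λ.base a (x - (B a).x) 2) with c | c2
  · exact ⟨1, _, by omega, hx, e, by linarith, c⟩
  rcases lt_or_ge v (Λ.base a (x - (B a).x) 3) with c | c3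
  · exact ⟨2, _, by omega, hx, e, by linarith, c⟩
  rcases lt_or_ge v (Λ.base a (x - (B a).x) 4) with c | c4
  · exact ⟨3, _, by omega, hx, e, by linarith, c⟩
  · exact ⟨4, _, le_rfl, hx, e, by linarith, by linarith⟩

omit hq in
theorem stretchBox_disjoint {a b : Fin m} (hab : a ≠ b) :
    Disjoint (σ.stretchBox (B a)).region (σ.stretchBox (B b)).region := by
  refine ha.stretch_disjoint (hB.valid a).h_pos (hB.valid b).h_pos ?_ ⟨rfl, rfl⟩ ⟨rfl, rfl⟩
    rfl rfl (add_sub_cancel _ _).le (add_sub_cancel _ _).le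
  rw [Box.disjoint_iff, Box.overlap_iff]
  rintro ⟨x, v, h1, h2⟩
  exact hab (hB.eq_of_mem a b x v h1 h2)

theorem at_unique {a b : Fin m} {l l' x' x'' x : ℕ} {v : ℝ} (hl : l ≤ 4) (hl' : l' ≤ 4)
    (h : Λ.At a l x' x v) (h' : Λ.At b l' x'' x v) : a = b ∧ l = l' ∧ x' = x'' := by
  have hab : a = b := by
    by_contra hab
    have := ha.stretchBox_disjoint hB hab
    rw [Box.disjoint_iff, Box.overlap_iff] at this
    exact this ⟨x, v, ha.at_mem hq hB Λ hl h, ha.at_mem hq hB Λ hl' h'⟩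
  subst hab
  have hx : x' = x'' := by
    have := h.x_eq
    have := h'.x_eq
    omega
  subst hx
  refine ⟨rfl, ?_, rfl⟩
  rcases lt_trichotomy l l' with c | c | c
  · have := ha.base_mono hq hB Λ a h.lt_w (show l + 1 ≤ l' by omega) (by omega)
    linarith [h.lt, h'.le]
  · exact c
  · have := ha.base_mono hq hB Λ a h.lt_w (show l' + 1 ≤ l by omega) (by omega)
    linarith [h'.lt, h.le]

/-- The new vertical position of a tall item. -/
theorem base_layer (a : Fin m) {ρ : Bool} {x : ℕ} {i : ι} (hx : x < (B a).w)
    (h : σ.TallAt q (B a) ρ x i) :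
    Λ.base a (Λ.p a ρ x) (layerOf ρ) = (if σ.itemKind q (B a) i = 1 then
      (if ρ then σ.stretch ((B a).y + (B a).h) - σ.tallHeight q i else σ.stretch (B a).y)
      else σ.stretch (q.y i)) ∧
    Λ.base a (Λ.p a ρ x) (layerOf ρ + 1) =
      Λ.base a (Λ.p a ρ x) (layerOf ρ) + σ.tallHeight q i := by
  have h1 := ha.key_of_tallAt hq hB Λ hx h
  cases ρ
  · simp only [Layout.base, layerOf, cut, h1, itemKey, Key.val_mk, Key.inner_mk,
      Bool.false_eq_true, if_false, Nat.reduceAdd]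
    constructor
    · split_ifs <;> ring
    · ring
  · simp only [Layout.base, layerOf, cut, h1, itemKey, Key.val_mk, Key.inner_mk, if_true,
      Nat.reduceAdd]
    constructor
    · split_ifs <;> ring
    · ring

omit ha hq hB in
theorem itemKind_cases (q : Rounding ι) (B : Box) (i : ι) :
    (σ.itemKind q B i = 2 ∧ q.x i < B.x) ∨
    (σ.itemKind q B i = 3 ∧ B.x ≤ q.x i ∧ B.x + B.w < q.x i + σ.w i) ∨
    (σ.itemKind q B i = 1 ∧ B.x ≤ q.x i ∧ q.x i + σ.w i ≤ B.x + B.w) := by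
  unfold Setting.itemKind
  split_ifs with h1 h2
  · exact Or.inl ⟨rfl, h1⟩
  · exact Or.inr (Or.inl ⟨rfl, by omega, h2⟩)
  · exact Or.inr (Or.inr ⟨rfl, by omega, by omega⟩)

/-- The columns of an item keep their order. -/
theorem p_add (a : Fin m) {ρ : Bool} {x : ℕ} {i : ι} (h : σ.TallAt q (B a) ρ x i) (d : ℕ)
    (hd : x + d < (B a).w) (hd' : (B a).x + (x + d) < q.x i + σ.w i) :
    Λ.p a ρ (x + d) = Λ.p a ρ x + d := by
  induction d with
  | zero => rfl
  | succ d ih =>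
    have h1 := h.2.1
    have e : ∀ e ≤ d + 1, σ.TallAt q (B a) ρ (x + e) i := fun e he =>
      ⟨h.1, ⟨by omega, by omega⟩, h.2.2⟩
    rw [← add_assoc, (Λ.arr a).rigid ρ (x + d) _ (by omega)
      (ha.occ_of_tallAt hq (hB.valid a) (e d (by omega)))
      (ha.occ_of_tallAt hq (hB.valid a) (e (d + 1) le_rfl)), ih (by omega) (by omega)]
    rfl

/-- Items that stick out of a box do not move horizontally. -/
theorem p_of_kind_ne (a : Fin m) {ρ : Bool} {x : ℕ} {i : ι} (hx : x < (B a).w)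
    (h : σ.TallAt q (B a) ρ x i) (hk : σ.itemKind q (B a) i ≠ 1) : Λ.p a ρ x = x := by
  have h1 := h.2.1
  rcases itemKind_cases (σ := σ) q (B a) i with h2 | h2 | h2
  · have h3 : σ.TallAt q (B a) ρ 0 i := ⟨h.1, ⟨by omega, by omega⟩, h.2.2⟩
    have h4 := ha.p_add hq hB Λ a h3 x (by omega) (by omega)
    rw [(Λ.arr a).first, zero_add] at h4
    exact h4
  · have h4 := ha.p_add hq hB Λ a h ((B a).w - 1 - x) (by omega) (by omega)
    rw [show x + ((B a).w - 1 - x) = (B a).w - 1 by omega, (Λ.arr a).last] at h4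
    omega
  · exact absurd h2.1 hk

omit ha hq in
/-- A fixed item sticks out of every box that it meets. -/
theorem kind_ne_of_fixed {i : ι} (hf : σ.Fixed q B i) {b : Fin m} {ρ : Bool} {x : ℕ}
    (h : σ.TallAt q (B b) ρ x i) (hh : 0 < q.height i) : σ.itemKind q (B b) i ≠ 1 := by
  obtain ⟨a, ρ', x', hx', h', hk⟩ := hf
  intro hk'
  have h1 := h'.2.1
  rcases itemKind_cases (σ := σ) q (B b) i with h2 | h2 | h2
  · omega
  · omega
  · have h3 := h'.2.2.1
    have h4 := h.2.2.1
    have : a = b := hB.eq_of_mem a b ((B a).x + x') (q.y i)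
      ⟨by omega, by omega, h3.1, by linarith⟩ ⟨by omega, by omega, h4.1, by linarith⟩
    exact hk (this ▸ hk')

omit ha hq in
/-- Each column of a tall item lies in a box. -/
theorem exists_box_tallAt {i : ι} (hi : σ.IsT i) {x : ℕ} (h1 : q.x i ≤ x)
    (h2 : x < q.x i + σ.w i) :
    ∃ a ρ x', x' < (B a).w ∧ x = (B a).x + x' ∧ σ.TallAt q (B a) ρ x' i := by
  obtain ⟨a, h3, h4⟩ := hB.cover i (Or.inl hi) x h1 h2
  refine ⟨a, decide ((B a).y + σ.tallMin ≤ q.y i), x - (B a).x, by omega, by omega, hi,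
    ⟨by omega, by omega⟩, h4, ?_⟩
  exact decide_eq_true_iff

/-- A fixed item may cross several boxes. In each of them its columns stay and it is lifted to the
same height, so the parts fit together to one rectangle. The condition on the kind separates these
parts from the blocks for the other tall items. -/
theorem fixedBox_point {i : ι} (hi : σ.IsT i) (hf : σ.Fixed q B i) (x : ℕ) (v : ℝ) :
    ((σ.fixedBox q i).x ≤ x ∧ x < (σ.fixedBox q i).x + (σ.fixedBox q i).w ∧
      (σ.fixedBox q i).y ≤ v ∧ v < (σ.fixedBox q i).y + (σ.fixedBox q i).h) ↔
    ∃ a ρ x', Λ.At a (layerOf ρ) x' x v ∧ σ.TallAt q (B a) ρ x' i ∧ Λ.p a ρ x' = x' ∧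
      2 ≤ (Λ.key a ρ x').kind := by
  have hh := ha.height_pos hq (kept_of_isT hi)
  simp only [Setting.fixedBox]
  constructor
  · rintro ⟨h1, h2, h3, h4⟩
    obtain ⟨a, ρ, x', hx', e, h5⟩ := exists_box_tallAt hB hi h1 h2
    have h6 := kind_ne_of_fixed hB hf h5 hh
    have h7 := ha.p_of_kind_ne hq hB Λ a hx' h5 h6
    have h8 := ha.base_layer hq hB Λ a hx' h5
    rw [if_neg h6, h7] at h8
    refine ⟨a, ρ, x', ⟨hx', e, by rw [h8.1]; exact h3, by rw [h8.2, h8.1]; exact h4⟩, h5, h7, ?_⟩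
    have h9 := ha.key_of_tallAt hq hB Λ hx' h5
    rw [h7] at h9
    rw [h9, Setting.itemKey, Key.kind_mk]
    rcases itemKind_cases (σ := σ) q (B a) i with h | h | h <;> omega
  · rintro ⟨a, ρ, x', ⟨hx', e, h1, h2⟩, h5, h7, -⟩
    have h6 := kind_ne_of_fixed hB hf h5 hh
    have h8 := ha.base_layer hq hB Λ a hx' h5
    rw [if_neg h6, h7] at h8
    have h9 := h5.2.1
    rw [h8.2] at h2
    rw [h8.1] at h1 h2
    exact ⟨by omega, by omega, h1, h2⟩

omit ha hq hB in
-- The set `S` contains the breaks of both rows. Dropping those where this row does not change keeps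
-- the key constant on blocks and avoids cutting a tall item at a break of the opposite row.
theorem key_rowBreaks (a : Fin m) (ρ : Bool) {y : ℕ} (hy : y < (B a).w) :
    Λ.key a ρ (blockLo (Λ.rowBreaks a ρ) y) = Λ.key a ρ y := by
  refine block_congr (n := (B a).w) (fun y hy h => ?_) hy
  by_contra hne
  have h1 : y + 1 ∈ Λ.S a := by
    by_contra h1
    exact hne ((Λ.arr a).breaks ρ y hy h1)
  exact h (Finset.mem_filter.2 ⟨h1, by rwa [Nat.add_sub_cancel]⟩)

omit ha hq hB in
theorem base_rowBreaks (a : Fin m) (ρ : Bool) {y : ℕ} (hy : y < (B a).w) :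
    Λ.base a (blockLo (Λ.rowBreaks a ρ) y) (layerOf ρ) = Λ.base a y (layerOf ρ) := by
  have := key_rowBreaks Λ a ρ hy
  cases ρ <;> simp only [Layout.base, layerOf, cut, this, if_true, if_false,
    Bool.false_eq_true]

omit ha hq hB in
theorem base_add_inner (a : Fin m) (ρ : Bool) (y : ℕ) :
    Λ.base a y (layerOf ρ + 1) = Λ.base a y (layerOf ρ) + (Λ.key a ρ y).inner := by
  cases ρ <;> simp only [Layout.base, layerOf, cut, if_true, if_false, Bool.false_eq_true,
    Nat.reduceAdd] <;> ring

omit ha hq hB in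
-- Blocks belonging to fixed items have height 0 and therefore no points; the box of the fixed item
-- covers that area instead.
theorem tallBlock_point (a : Fin m) (ρ : Bool) {s : ℕ}
    (hs : s ∈ blockStarts (Λ.rowBreaks a ρ) (B a).w) (x : ℕ) (v : ℝ) :
    ((Λ.tallBlock a ρ s).x ≤ x ∧ x < (Λ.tallBlock a ρ s).x + (Λ.tallBlock a ρ s).w ∧
      (Λ.tallBlock a ρ s).y ≤ v ∧ v < (Λ.tallBlock a ρ s).y + (Λ.tallBlock a ρ s).h) ↔
    ∃ x', Λ.At a (layerOf ρ) x' x v ∧ blockLo (Λ.rowBreaks a ρ) x' = s ∧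
      (Λ.key a ρ x').kind ≤ 1 := by
  simp only [Layout.tallBlock]
  constructor
  · rintro ⟨h1, h2, h3, h4⟩
    obtain ⟨h5, h6⟩ := (mem_block_iff hs (y := x - (B a).x)).1 ⟨by omega, by omega⟩
    have h7 := key_rowBreaks Λ a ρ h5
    have h8 := base_rowBreaks Λ a ρ h5
    rw [h6] at h7 h8
    rw [h7, h8] at h4
    rw [h8] at h3
    split_ifs at h4 with h9
    · exact ⟨_, ⟨h5, by omega, h3, by rw [base_add_inner]; exact h4⟩, h6, h9⟩
    · linarith
  · rintro ⟨x', ⟨h1, h2, h3, h4⟩, h5, h6⟩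
    have h9 := (mem_block_iff hs).2 ⟨h1, h5⟩
    have h7 := key_rowBreaks Λ a ρ h1
    have h8 := base_rowBreaks Λ a ρ h1
    rw [h5] at h7 h8
    rw [base_add_inner] at h4
    rw [h7, h8, if_pos h6]
    exact ⟨by omega, by omega, h3, h4⟩

omit ha hq hB in
theorem base_S (a : Fin m) (l : ℕ) {y : ℕ} (hy : y < (B a).w) :
    Λ.base a (blockLo (Λ.S a) y) l = Λ.base a y l := by
  have h : ∀ ρ, Λ.key a ρ (blockLo (Λ.S a) y) = Λ.key a ρ y := fun ρ =>
    block_congr (n := (B a).w) (fun y hy h => (Λ.arr a).breaks ρ y hy h) hy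
  rw [Layout.base, Layout.base, h, h]

omit ha hq hB in
theorem vertBlock_point (a : Fin m) (l : ℕ) {s : ℕ}
    (hs : s ∈ blockStarts (Λ.S a) (B a).w) (x : ℕ) (v : ℝ) :
    ((Λ.vertBlock a l s).x ≤ x ∧ x < (Λ.vertBlock a l s).x + (Λ.vertBlock a l s).w ∧
      (Λ.vertBlock a l s).y ≤ v ∧ v < (Λ.vertBlock a l s).y + (Λ.vertBlock a l s).h) ↔
    ∃ x', Λ.At a l x' x v ∧ blockLo (Λ.S a) x' = s := by
  simp only [Layout.vertBlock]
  rw [add_sub_cancel]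
  constructor
  · rintro ⟨h1, h2, h3, h4⟩
    obtain ⟨h5, h6⟩ := (mem_block_iff hs (y := x - (B a).x)).1 ⟨by omega, by omega⟩
    rw [← h6, base_S Λ a _ h5] at h3 h4
    exact ⟨_, ⟨h5, by omega, h3, h4⟩, h6⟩
  · rintro ⟨x', ⟨h1, h2, h3, h4⟩, h5⟩
    have h9 := (mem_block_iff hs).2 ⟨h1, h5⟩
    rw [← h5, base_S Λ a _ h1, base_S Λ a _ h1, h5]
    exact ⟨by omega, by omega, h3, h4⟩

/-- The new place of a tall item. -/
theorem exists_slot {i : ι} (hi : σ.IsT i) : ∃ s : Box,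
    (s.w = σ.w i ∧ s.h = σ.tallHeight q i) ∧
    ((σ.Fixed q B i ∧ s = σ.fixedBox q i) ∨
      ∃ a ρ, ∃ t ∈ blockStarts (Λ.rowBreaks a ρ) (B a).w, s.Within (Λ.tallBlock a ρ t) ∧
        s.h = (Λ.tallBlock a ρ t).h) ∧
    ∀ (x : ℕ) (v : ℝ), s.x ≤ x ∧ x < s.x + s.w ∧ s.y ≤ v ∧ v < s.y + s.h →
      ∃ a ρ x', x' < (B a).w ∧ σ.TallAt q (B a) ρ x' i ∧
        Λ.At a (layerOf ρ) (Λ.p a ρ x') x v := by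
  by_cases hf : σ.Fixed q B i
  · refine ⟨σ.fixedBox q i, ⟨rfl, rfl⟩, Or.inl ⟨hf, rfl⟩, fun x v h => ?_⟩
    obtain ⟨a, ρ, x', h1, h2, h3, -⟩ := (ha.fixedBox_point hq hB Λ hi hf x v).1 h
    exact ⟨a, ρ, x', h1.lt_w, h2, by rwa [h3]⟩
  have hw := σ.w_pos i
  obtain ⟨a, ρ, x0, hx0, e0, h0⟩ := exists_box_tallAt hB hi (x := q.x i) le_rfl (by omega)
  have hk : σ.itemKind q (B a) i = 1 := by
    by_contra hk
    exact hf ⟨a, ρ, x0, hx0, h0, hk⟩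
  have hcol : x0 + σ.w i ≤ (B a).w := by
    rcases itemKind_cases (σ := σ) q (B a) i with h | h | h <;> omega
  have hp : ∀ d, d < σ.w i → Λ.p a ρ (x0 + d) = Λ.p a ρ x0 + d ∧
      σ.TallAt q (B a) ρ (x0 + d) i := fun d hd =>
    ⟨ha.p_add hq hB Λ a h0 d (by omega) (by omega), h0.1, ⟨by omega, by omega⟩, h0.2.2⟩
  have hkey : ∀ d, d < σ.w i → Λ.key a ρ (Λ.p a ρ x0 + d) = σ.itemKey q (B a) ρ i := by
    intro d hd
    have := ha.key_of_tallAt hq hB Λ (x := x0 + d) (by omega) (hp d hd).2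
    rwa [(hp d hd).1] at this
  have hlt : ∀ d, d < σ.w i → Λ.p a ρ x0 + d < (B a).w := fun d hd => by
    have := (Λ.arr a).mapsTo ρ (x0 + d) (by omega)
    rwa [(hp d hd).1] at this
  have hbase : ∀ d, d < σ.w i → Λ.base a (Λ.p a ρ x0 + d) (layerOf ρ) =
      Λ.base a (Λ.p a ρ x0) (layerOf ρ) := by
    intro d hd
    have h1 := (ha.base_layer hq hB Λ a (by omega) (hp d hd).2).1
    have h2 := (ha.base_layer hq hB Λ a hx0 h0).1
    rw [(hp d hd).1] at h1
    rw [h1, h2]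
  have hhi := (ha.base_layer hq hB Λ a hx0 h0).2
  have hinner : (σ.itemKey q (B a) ρ i).inner = σ.tallHeight q i := rfl
  have hkind : (σ.itemKey q (B a) ρ i).kind = 1 := hk
  have hy0 := hlt 0 hw
  rw [add_zero] at hy0
  have hk0 := hkey 0 hw
  rw [add_zero] at hk0
  set y0 := Λ.p a ρ x0 with hy0def
  set T := Λ.rowBreaks a ρ with hT
  set t := blockLo T y0 with ht
  have htmem : t ∈ blockStarts T (B a).w := blockLo_mem hy0
  have hkt : Λ.key a ρ t = σ.itemKey q (B a) ρ i := (key_rowBreaks Λ a ρ hy0).trans hk0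
  have hbh : (Λ.tallBlock a ρ t).h = σ.tallHeight q i := by
    simp only [Layout.tallBlock]
    rw [hkt, if_pos (by omega), hinner]
  have hby : (Λ.tallBlock a ρ t).y = Λ.base a y0 (layerOf ρ) := base_rowBreaks Λ a ρ hy0
  refine ⟨⟨(B a).x + y0, σ.w i, Λ.base a y0 (layerOf ρ), σ.tallHeight q i⟩, ⟨rfl, rfl⟩,
    Or.inr ⟨a, ρ, t, htmem, ⟨?_, ?_⟩, hbh.symm⟩, ?_⟩
  · have h1 := (mem_block_iff htmem (y := y0)).2 ⟨hy0, rfl⟩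
    -- The key is constant along the columns of the item, so no break of its row separates them.
    have h2 : blockLo T (y0 + (σ.w i - 1)) = t := by
      refine blockLo_eq (by omega) fun s hs1 hs2 hs3 => ?_
      have h3 := (Finset.mem_filter.1 hs3).2
      obtain ⟨d, rfl⟩ := Nat.exists_eq_add_of_le hs1.le
      refine h3 ?_
      rw [hkey d (by omega), show y0 + d - 1 = y0 + (d - 1) by omega, hkey (d - 1) (by omega)]
    have h3 := (mem_block_iff htmem (y := y0 + (σ.w i - 1))).2 ⟨hlt _ (by omega), h2⟩
    constructor
    · change (B a).x + t ≤ (B a).x + y0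
      omega
    · change (B a).x + y0 + σ.w i ≤ (B a).x + t + (blockHi T (B a).w t - t)
      omega
  · rw [Box.YWithin, hby, hbh]
    exact ⟨le_rfl, le_rfl⟩
  · rintro x v ⟨h1, h2, h3, h4⟩
    dsimp only at h1 h2 h3 h4
    obtain ⟨d, rfl⟩ := Nat.exists_eq_add_of_le h1
    have hd : d < σ.w i := by omega
    refine ⟨a, ρ, x0 + d, by omega, (hp d hd).2, ?_⟩
    rw [(hp d hd).1]
    refine ⟨hlt d hd, by omega, by rw [hbase d hd]; exact h3, ?_⟩
    rw [base_add_inner, hbase d hd, hkey d hd, hinner]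
    exact h4

omit ha hq hB in
theorem layerOf_le (ρ : Bool) : layerOf ρ ≤ 4 := by cases ρ <;> simp [layerOf]

omit ha hq hB in
theorem layerOf_injective {ρ ρ' : Bool} (h : layerOf ρ = layerOf ρ') : ρ = ρ' := by
  cases ρ <;> cases ρ' <;> simp_all [layerOf]

/-- The new places of different tall items do not overlap. -/
theorem eq_of_slots {i j : ι} {x : ℕ} {v : ℝ}
    (h1 : ∃ a ρ x', x' < (B a).w ∧ σ.TallAt q (B a) ρ x' i ∧ Λ.At a (layerOf ρ) (Λ.p a ρ x') x v)
    (h2 : ∃ a ρ x', x' < (B a).w ∧ σ.TallAt q (B a) ρ x' j ∧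
      Λ.At a (layerOf ρ) (Λ.p a ρ x') x v) : i = j := by
  obtain ⟨a, ρ, x', h3, h4, h5⟩ := h1
  obtain ⟨b, ρ', x'', h6, h7, h8⟩ := h2
  obtain ⟨rfl, h9, h10⟩ := ha.at_unique hq hB Λ (layerOf_le _) (layerOf_le _) h5 h8
  obtain rfl := layerOf_injective h9
  obtain rfl := (Λ.arr a).inj ρ _ _ h3 h6 h10
  exact ha.tallAt_unique hq (hB.valid a) h4 h7

end Admissible

end Setting

/-! ### Fractional packing of the vertical items -/

namespace Setting

/-- The vertical item `j` meets column `x` of the box `B`. -/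
structure VertAt {ι : Type*} (σ : Setting ι) (q : Rounding ι) (B : Box) (x : ℕ) (j : ι) :
    Prop where
  isV : σ.IsV j
  col : q.x j ≤ B.x + x ∧ B.x + x < q.x j + σ.w j
  y_le : B.y ≤ q.y j
  le_top : q.y j + q.height j ≤ B.y + B.h

/-- The item `j` avoids the reserved parts of column `x` of the box `B`. -/
def Unreserved {ι : Type*} (σ : Setting ι) (q : Rounding ι) (B : Box) (x : ℕ) (j : ι) : Prop :=
  ∀ ρ, q.y j + q.height j ≤ σ.rowLo q B ρ x ∨ σ.rowHi q B ρ x ≤ q.y j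

/-- The slice of the vertical item `j` in column `x` is placed at `s` in the container `c`, where
`idx` numbers the columns whose stacks go to the extra box. -/
def Layout.Placed {ι : Type*} {σ : Setting ι} {q : Rounding ι} {m : ℕ} {B : Fin m → Box} {M : ℕ}
    (Λ : σ.Layout q B M) (idx : (Σ _ : Fin m, ℕ) → ℕ) (j : ι) (x : ℕ) (s : Box)
    (c : Option (Σ _ : Fin m × Fin 3, ℕ)) : Prop :=
  (∃ a x' f, c = some ⟨(a, f), blockLo (Λ.S a) x'⟩ ∧
    s = ⟨(B a).x + x', 1, σ.stretch (q.y j), q.height j⟩ ∧ x' < (B a).w ∧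
    σ.VertAt q (B a) x' j ∧ x = (B a).x + x' ∧
    (f = 0 ∧ 2 ≤ (Λ.key a false x').kind ∨ f = 2 ∧ 2 ≤ (Λ.key a true x').kind) ∧
    Λ.base a x' (2 * (f : ℕ)) ≤ σ.stretch (q.y j) ∧
    σ.stretch (q.y j) + q.height j ≤ Λ.base a x' (2 * (f : ℕ) + 1)) ∨
  (∃ a x₀ x' f, c = some ⟨(a, f), blockLo (Λ.S a) x'⟩ ∧
    s = ⟨(B a).x + x', 1, Λ.base a x' (2 * (f : ℕ)) + σ.stackPos q (B a) x₀ (q.y j), q.height j⟩ ∧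
    x₀ < (B a).w ∧ σ.VertAt q (B a) x₀ j ∧ x = (B a).x + x₀ ∧
    Λ.dest a x₀ = some (2 * (f : ℕ), x') ∧ σ.Unreserved q (B a) x₀ j) ∨
  ∃ a x₀, c = none ∧ s = ⟨idx ⟨a, x₀⟩, 1, σ.stackPos q (B a) x₀ (q.y j), q.height j⟩ ∧
    x₀ < (B a).w ∧ σ.VertAt q (B a) x₀ j ∧ x = (B a).x + x₀ ∧ Λ.dest a x₀ = none ∧
    σ.Unreserved q (B a) x₀ j

open Classical in
/-- The columns whose stacks go to the extra box. -/
noncomputable def Layout.unsaved {ι : Type*} {σ : Setting ι} {q : Rounding ι} {m : ℕ}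
    {B : Fin m → Box} {M : ℕ} (Λ : σ.Layout q B M) : Finset (Σ _ : Fin m, ℕ) :=
  Finset.univ.sigma fun a => {x ∈ Finset.range (B a).w | Λ.dest a x = none}

namespace Admissible

variable {ι : Type*} {σ : Setting ι} {N k : ℕ} (ha : σ.Admissible N k) {q : Rounding ι}
  (hq : σ.IsRounded q)
include ha hq

/-- For an item inside the box only the item itself is reserved, and vertical items avoid it. If a
tall item sticks out, the pocket between it and the floor (bottom row) or the ceiling (top row) is
reserved as well, so the exceptions are exactly slices in a pocket. -/
theorem unreserved_or {B : Box} (hB : σ.BoxValid B) {x : ℕ} {j : ι} (h : σ.VertAt q B x j) :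
    σ.Unreserved q B x j ∨ ∃ ρ i, σ.TallAt q B ρ x i ∧ σ.itemKind q B i ≠ 1 ∧
      (ρ = false → q.y j + q.height j ≤ q.y i) ∧ (ρ = true → q.y i + q.height i ≤ q.y j) := by
  by_contra! hc
  refine hc.1 fun ρ => ?_
  rcases ho : σ.occ q B ρ x with _ | b
  · obtain ⟨e1, e2⟩ := row_of_occ_none ho
    rw [e1, e2]
    cases ρ
    · exact Or.inr h.y_le
    · exact Or.inl h.le_top
  · obtain ⟨i, hi, -⟩ := ha.exists_tallAt hq hB ho
    have hij : i ≠ j := by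
      rintro rfl
      exact h.isV.1 hi.1
    have h1 := column_disjoint hq (kept_of_isT hi.1) (kept_of_isV h.isV) hij hi.2.1 h.col
      (ha.height_pos hq (kept_of_isT hi.1)) (ha.height_pos hq (kept_of_isV h.isV))
    have h2 := hc.2 ρ i hi
    rw [ha.rowLo_of_tallAt hq hB hi, ha.rowHi_of_tallAt hq hB hi]
    by_cases hk : σ.itemKind q B i = 1
    · simp only [hk, ne_eq, not_true_eq_false, false_and, if_false]
      exact h1.symm
    · have h3 := h2 hk
      cases ρ
      · simp only [hk, ne_eq, not_false_eq_true, true_and, if_true, Bool.false_eq_true, if_false]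
        rcases h1 with h1 | h1
        · exact Or.inr h1
        · exact absurd (h3 fun _ => h1).1 Bool.false_ne_true
      · simp only [hk, ne_eq, not_false_eq_true, true_and, if_true, Bool.true_eq_false, if_false]
        rcases h1 with h1 | h1
        · exact absurd h1 (not_le.2 (h3 fun h => Bool.noConfusion h).2)
        · exact Or.inl h1

omit ha hq in
theorem stackPos_add_height {B : Box} {x : ℕ} {j : ι} (h0 : 0 ≤ q.height j)
    (h : σ.Unreserved q B x j) : σ.stackPos q B x (q.y j + q.height j) =
      σ.stackPos q B x (q.y j) + q.height j :=
  stackPos_add h0 h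

theorem stackPos_mem {B : Box} (hB : σ.BoxValid B) {x : ℕ} {j : ι} (h : σ.VertAt q B x j)
    (hu : σ.Unreserved q B x j) : 0 ≤ σ.stackPos q B x (q.y j) ∧
      σ.stackPos q B x (q.y j) + q.height j ≤ σ.gap q B x := by
  have h0 := ha.height_pos hq (kept_of_isV h.isV)
  constructor
  · rw [← ha.stackPos_bottom hq hB x]
    exact ha.stackPos_mono hq hB x h.y_le
  · rw [← stackPos_add_height h0.le hu, ← ha.stackPos_top hq hB x]
    exact ha.stackPos_mono hq hB x h.le_top

variable {m : ℕ} {B : Fin m → Box} (hB : σ.Houses q B) {M : ℕ} (Λ : σ.Layout q B M)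
include hB

theorem exists_placed (idx : (Σ _ : Fin m, ℕ) → ℕ) {j : ι} (hj : σ.IsV j) {x : ℕ}
    (h1 : q.x j ≤ x) (h2 : x < q.x j + σ.w j) : ∃ s c, Λ.Placed idx j x s c := by
  obtain ⟨a, h3, h4⟩ := hB.cover j (Or.inr hj) x h1 h2
  obtain ⟨x₀, rfl⟩ := Nat.exists_eq_add_of_le h3.1
  have hx₀ : x₀ < (B a).w := by omega
  have hv : σ.VertAt q (B a) x₀ j := ⟨hj, ⟨h1, h2⟩, h4.1, h4.2⟩
  have hh := ha.height_pos hq (kept_of_isV hj)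
  rcases ha.unreserved_or hq (hB.valid a) hv with hu | ⟨ρ, i, hi, hk, hb, ht⟩
  · rcases hd : Λ.dest a x₀ with _ | ⟨l, x'⟩
    · exact ⟨_, _, Or.inr (Or.inr ⟨a, x₀, rfl, rfl, hx₀, hv, rfl, hd, hu⟩)⟩
    · have hl : ∃ f : Fin 3, l = 2 * (f : ℕ) := by
        rcases ((Λ.arr a).dest_lt x₀ l x' hx₀ hd).2.1 with rfl | rfl | rfl
        · exact ⟨0, rfl⟩
        · exact ⟨1, rfl⟩
        · exact ⟨2, rfl⟩
      obtain ⟨f, rfl⟩ := hl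
      exact ⟨_, _, Or.inr (Or.inl ⟨a, x₀, x', f, rfl, rfl, hx₀, hv, rfl, hd, hu⟩)⟩
  · have hp := ha.p_of_kind_ne hq hB Λ a hx₀ hi hk
    have hbase := ha.base_layer hq hB Λ a hx₀ hi
    have hkey := ha.key_of_tallAt hq hB Λ hx₀ hi
    rw [hp, if_neg hk] at hbase
    rw [hp] at hkey
    have hstep := ha.base_step hq hB Λ a hx₀
    have hkind : 2 ≤ (Λ.key a ρ x₀).kind := by
      rw [hkey, Setting.itemKey, Key.kind_mk]
      rcases itemKind_cases (σ := σ) q (B a) i with h | h | h <;> omega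
    have hy := ha.stretch_mono hv.y_le
    have hadd := ha.add_stretch_le (y := q.y j) hh.le
    have htop := ha.stretch_mono hv.le_top
    cases ρ
    · refine ⟨_, _, Or.inl ⟨a, x₀, 0, rfl, rfl, hx₀, hv, rfl, Or.inl ⟨rfl, hkind⟩, ?_, ?_⟩⟩
      · change Λ.base a x₀ 0 ≤ _
        linarith
      · have h5 := hbase.1
        change Λ.base a x₀ 1 = _ at h5
        change _ ≤ Λ.base a x₀ 1
        have := ha.stretch_mono (hb rfl)
        linarith
    · refine ⟨_, _, Or.inl ⟨a, x₀, 2, rfl, rfl, hx₀, hv, rfl, Or.inr ⟨rfl, hkind⟩, ?_, ?_⟩⟩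
      · have h5 := hbase.2
        rw [hbase.1] at h5
        change Λ.base a x₀ 4 = _ at h5
        change Λ.base a x₀ 4 ≤ _
        have e1 := ht rfl
        have e2 := ha.tallMin_le hq hi.1
        have e3 := hi.2.2.1.1
        have e4 := (hB.valid a).y_nonneg
        have e5 := (hB.valid a).top_le
        have e6 := hv.le_top
        -- The vertical item starts at least τ above the bottom of the tall one, so it is lifted by
        -- u more. This makes room for the rounding of the tall item below it.
        have e7 := ha.shift_add_le (y := q.y i) (z := q.y j) (by linarith) (by linarith)
          (by linarith)
        have e8 := ha.tallHeight_mem q (i := i) (by linarith [ha.tallMin_pos])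
        rw [h5, Setting.stretch, Setting.stretch]
        linarith
      · change _ ≤ Λ.base a x₀ 5
        linarith

omit ha hq hB in
-- Stacks enter the outer layers only at fillers, of kind 0, whereas pockets occur at kinds 2 and 3.
-- Hence the two uses of layers 0 and 4 never conflict.
theorem placed_layer {a : Fin m} {x₀ x' : ℕ} {f : Fin 3} (hx₀ : x₀ < (B a).w)
    (hd : Λ.dest a x₀ = some (2 * (f : ℕ), x')) : x' < (B a).w ∧
      (f = 0 → (Λ.key a false x').kind = 0) ∧ (f = 2 → (Λ.key a true x').kind = 0) ∧
      Λ.base a x' (2 * (f : ℕ)) + σ.gap q (B a) x₀ ≤ Λ.base a x' (2 * (f : ℕ) + 1) := by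
  obtain ⟨h1, -, h2, h3, h4⟩ := (Λ.arr a).dest_lt x₀ _ x' hx₀ hd
  refine ⟨h1, ?_, ?_, ?_⟩
  · rintro rfl
    exact h2 rfl
  · rintro rfl
    exact h3 rfl
  · rw [Layout.base, Layout.base]
    linarith

theorem placed_within {idx : (Σ _ : Fin m, ℕ) → ℕ} {j : ι} {x : ℕ} {s : Box}
    {z : Σ _ : Fin m × Fin 3, ℕ} (h : Λ.Placed idx j x s (some z)) :
    z.2 ∈ blockStarts (Λ.S z.1.1) (B z.1.1).w ∧ s.Within (Λ.vertBlock z.1.1 (2 * (z.1.2 : ℕ)) z.2) := by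
  have key : ∀ (a : Fin m) (x' : ℕ) (f : Fin 3) (y h : ℝ), x' < (B a).w →
      Λ.base a x' (2 * (f : ℕ)) ≤ y → y + h ≤ Λ.base a x' (2 * (f : ℕ) + 1) →
      Box.Within ⟨(B a).x + x', 1, y, h⟩ (Λ.vertBlock a (2 * (f : ℕ)) (blockLo (Λ.S a) x')) := by
    intro a x' f y h hx' h1 h2
    have h3 := (mem_block_iff (blockLo_mem (T := Λ.S a) hx')).2 ⟨hx', rfl⟩
    refine ⟨⟨?_, ?_⟩, ?_, ?_⟩
    · change (B a).x + blockLo (Λ.S a) x' ≤ (B a).x + x'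
      omega
    · change (B a).x + x' + 1 ≤ (B a).x + blockLo (Λ.S a) x' +
        (blockHi (Λ.S a) (B a).w (blockLo (Λ.S a) x') - blockLo (Λ.S a) x')
      omega
    · change Λ.base a (blockLo (Λ.S a) x') (2 * (f : ℕ)) ≤ y
      rwa [base_S Λ a _ hx']
    · change y + h ≤ Λ.base a (blockLo (Λ.S a) x') (2 * (f : ℕ)) +
        (Λ.base a (blockLo (Λ.S a) x') (2 * (f : ℕ) + 1) - Λ.base a (blockLo (Λ.S a) x') (2 * (f : ℕ)))
      rwa [add_sub_cancel, base_S Λ a _ hx']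
  rcases h with ⟨a, x', f, hz, rfl, hx', -, -, -, h1, h2⟩ |
    ⟨a, x₀, x', f, hz, rfl, hx₀, hv, -, hd, hu⟩ | ⟨a, x₀, hz, -⟩
  · obtain rfl := Option.some.inj hz
    exact ⟨blockLo_mem hx', key _ _ _ _ _ hx' h1 h2⟩
  · obtain rfl := Option.some.inj hz
    obtain ⟨hx', -, -, h1⟩ := placed_layer Λ hx₀ hd
    have h2 := ha.stackPos_mem hq (hB.valid a) hv hu
    exact ⟨blockLo_mem hx', key _ _ _ _ _ hx' (by linarith) (by linarith)⟩
  · exact absurd hz (by simp)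

/-- A stack without destination comes from a column with two tall items. These take 2τ of a total
height below 3τ. -/
theorem gap_le_tallMin {a : Fin m} {x : ℕ} (hx : x < (B a).w) (hd : Λ.dest a x = none) :
    σ.gap q (B a) x ≤ σ.tallMin ∧ 2 * σ.tallMin ≤ (B a).h := by
  obtain ⟨h0, h1⟩ := (Λ.arr a).dest_none x hx hd
  obtain ⟨b0, hb0⟩ := Option.ne_none_iff_exists'.1 h0
  obtain ⟨b1, hb1⟩ := Option.ne_none_iff_exists'.1 h1
  obtain ⟨i, hi, -⟩ := ha.exists_tallAt hq (hB.valid a) hb0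
  obtain ⟨j, hj, -⟩ := ha.exists_tallAt hq (hB.valid a) hb1
  refine ⟨?_, ha.two_tallMin_le hq (hB.valid a) hi hj⟩
  have e1 := ha.tallMin_le_row hq (hB.valid a) hi
  have e2 := ha.tallMin_le_row hq (hB.valid a) hj
  have e3 := (hB.valid a).y_nonneg
  have e4 := (hB.valid a).top_le
  have e5 := ha.area_lt
  rw [Setting.gap]
  linarith

/-- Boxes contributing to `V₀` are at least 2τ high, more than half of the area. Two of them cannot
lie above each other, so their widths add up to at most W, and each contributes at most a fraction 1
- 2ε of its width. -/
theorem card_unsaved_le : (Λ.unsaved.card : ℝ) ≤ (1 - 2 * σ.ε) * σ.W := by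
  classical
  have hε : 0 ≤ 1 - 2 * σ.ε := by linarith [ha.ε_le]
  set n : Fin m → ℕ := fun a => ({x ∈ Finset.range (B a).w | Λ.dest a x = none}).card with hn
  set A : Finset (Fin m) := {a | n a ≠ 0} with hA
  have h1 : Λ.unsaved.card = ∑ a ∈ A, n a := by
    rw [Layout.unsaved, Finset.card_sigma, hA, Finset.sum_filter_ne_zero]
  have h2 : ∑ a ∈ A, (B a).w ≤ σ.W := by
    have hd : Set.PairwiseDisjoint (A : Set (Fin m))
        (fun a => Finset.Ico (B a).x ((B a).x + (B a).w)) := by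
      intro a haA b hbA hab
      rw [Function.onFun, Finset.disjoint_left]
      intro x hx hx'
      rw [Finset.mem_Ico] at hx hx'
      have key : ∀ a ∈ A, 2 * σ.tallMin ≤ (B a).h := by
        intro a haA
        obtain ⟨x, hx⟩ := Finset.card_ne_zero.1 (Finset.mem_filter.1 haA).2
        rw [Finset.mem_filter, Finset.mem_range] at hx
        exact (ha.gap_le_tallMin hq hB Λ hx.1 hx.2).2
      have e1 := key a (Finset.mem_coe.1 haA)
      have e2 := key b (Finset.mem_coe.1 hbA)
      have e3 := (hB.valid a).y_nonneg
      have e4 := (hB.valid a).top_le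
      have e5 := (hB.valid b).y_nonneg
      have e6 := (hB.valid b).top_le
      have e7 := ha.area_lt
      have e8 := ha.tallMin_pos
      exact hab (hB.eq_of_mem a b x (max (B a).y (B b).y)
        ⟨hx.1, hx.2, le_max_left _ _, max_lt (by linarith) (by linarith)⟩
        ⟨hx'.1, hx'.2, le_max_right _ _, max_lt (by linarith) (by linarith)⟩)
    have h3 : A.biUnion (fun a => Finset.Ico (B a).x ((B a).x + (B a).w)) ⊆
        Finset.range σ.W := by
      intro x hx
      obtain ⟨a, -, hx⟩ := Finset.mem_biUnion.1 hx
      have := hB.x_le a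
      rw [Finset.mem_Ico] at hx
      exact Finset.mem_range.2 (by omega)
    have h4 := Finset.card_le_card h3
    rw [Finset.card_biUnion hd, Finset.card_range] at h4
    simpa using h4
  rw [h1, Nat.cast_sum]
  calc ∑ a ∈ A, (n a : ℝ) ≤ ∑ a ∈ A, (1 - 2 * σ.ε) * ((B a).w : ℝ) :=
        Finset.sum_le_sum fun a _ => by
          convert (Λ.arr a).card_none
    _ = (1 - 2 * σ.ε) * ((∑ a ∈ A, (B a).w : ℕ) : ℝ) := by
        rw [Nat.cast_sum, Finset.mul_sum]
    _ ≤ _ := mul_le_mul_of_nonneg_left (Nat.cast_le.2 h2) hε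

theorem placed_withinV0 {idx : (Σ _ : Fin m, ℕ) → ℕ}
    (hidx : ∀ z ∈ Λ.unsaved, idx z < Λ.unsaved.card) {j : ι} {x : ℕ} {s : Box}
    (h : Λ.Placed idx j x s none) : σ.WithinV0 s := by
  rcases h with ⟨a, x', f, hz, -⟩ | ⟨a, x₀, x', f, hz, -⟩ | ⟨a, x₀, -, rfl, hx₀, hv, -, hd, hu⟩
  · exact absurd hz (by simp)
  · exact absurd hz (by simp)
  have h1 := hidx ⟨a, x₀⟩ (Finset.mem_sigma.2 ⟨Finset.mem_univ _,
    Finset.mem_filter.2 ⟨Finset.mem_range.2 hx₀, hd⟩⟩)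
  have h2 := ha.stackPos_mem hq (hB.valid a) hv hu
  refine ⟨?_, h2.1, h2.2.trans (ha.gap_le_tallMin hq hB Λ hx₀ hd).1⟩
  refine le_trans ?_ (ha.card_unsaved_le hq hB Λ)
  exact_mod_cast h1

omit hB in
/-- Different slices in the same stack do not overlap. -/
theorem eq_of_stack {B : Box} (hB : σ.BoxValid B) {x₀ : ℕ} {j j' : ι} (h : σ.VertAt q B x₀ j)
    (h' : σ.VertAt q B x₀ j') (hu : σ.Unreserved q B x₀ j) (hu' : σ.Unreserved q B x₀ j')
    {b v : ℝ} (h1 : b + σ.stackPos q B x₀ (q.y j) ≤ v)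
    (h2 : v < b + σ.stackPos q B x₀ (q.y j) + q.height j)
    (h3 : b + σ.stackPos q B x₀ (q.y j') ≤ v)
    (h4 : v < b + σ.stackPos q B x₀ (q.y j') + q.height j') : j = j' := by
  by_contra hne
  have e1 := ha.height_pos hq (kept_of_isV h.isV)
  have e2 := ha.height_pos hq (kept_of_isV h'.isV)
  have e3 := stackPos_add_height e1.le hu
  have e4 := stackPos_add_height e2.le hu'
  rcases column_disjoint hq (kept_of_isV h.isV) (kept_of_isV h'.isV) hne h.col h'.col e1 e2
    with h5 | h5
  · have := ha.stackPos_mono hq hB x₀ h5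
    linarith
  · have := ha.stackPos_mono hq hB x₀ h5
    linarith

/-- Overlapping slices in the same container come from the same column: pocket slices stay in
theirs, and distinct stacks have distinct destinations. Within a column, lifting and stacking both
preserve the vertical order and leave every slice its full height. -/
theorem eq_of_placed {idx : (Σ _ : Fin m, ℕ) → ℕ} (hidx : Set.InjOn idx Λ.unsaved) {j j' : ι}
    {x x' : ℕ} {s s' : Box} {c : Option (Σ _ : Fin m × Fin 3, ℕ)} (h : Λ.Placed idx j x s c)
    (h' : Λ.Placed idx j' x' s' c) (ho : s.Overlap s') : j = j' ∧ x = x' := by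
  obtain ⟨t, v, ⟨o1, o2, o3, o4⟩, o5, o6, o7, o8⟩ := (Box.overlap_iff _ _).1 ho
  have mixed : ∀ {a b : Fin m} {f g : Fin 3} {y y' x₀ : ℕ} {j : ι},
      some (⟨(a, f), blockLo (Λ.S a) y⟩ : Σ _ : Fin m × Fin 3, ℕ) =
        some ⟨(b, g), blockLo (Λ.S b) y'⟩ → (B a).x + y = (B b).x + y' →
      (f = 0 ∧ 2 ≤ (Λ.key a false y).kind ∨ f = 2 ∧ 2 ≤ (Λ.key a true y).kind) →
      x₀ < (B b).w → Λ.dest b x₀ = some (2 * (g : ℕ), y') → σ.VertAt q (B b) x₀ j → False := by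
    intro a b f g y y' x₀ j hz hy hk hx₀ hd _
    have hz := congrArg Sigma.fst (Option.some.inj hz)
    obtain ⟨rfl, rfl⟩ := Prod.mk.inj hz
    obtain rfl : y = y' := by omega
    obtain ⟨-, h1, h2, -⟩ := placed_layer Λ hx₀ hd
    rcases hk with ⟨hf, hk⟩ | ⟨hf, hk⟩
    · have := h1 hf; omega
    · have := h2 hf; omega
  rcases h with ⟨a, y, f, hz, rfl, hy, hv, rfl, hk, -⟩ |
    ⟨a, x₀, y, f, hz, rfl, hx₀, hv, rfl, hd, hu⟩ | ⟨a, x₀, hz, rfl, hx₀, hv, rfl, hd, hu⟩ <;>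
  rcases h' with ⟨b, y', g, hz', rfl, hy', hv', rfl, hk', -⟩ |
    ⟨b, x₁, y', g, hz', rfl, hx₁, hv', rfl, hd', hu'⟩ | ⟨b, x₁, hz', rfl, hx₁, hv', rfl, hd', hu'⟩ <;>
  dsimp only at o1 o2 o3 o4 o5 o6 o7 o8
  · rw [hz] at hz'
    have hz := congrArg Sigma.fst (Option.some.inj hz')
    obtain ⟨rfl, rfl⟩ := Prod.mk.inj hz
    obtain rfl : y = y' := by omega
    refine ⟨?_, rfl⟩
    by_contra hne
    have e1 := ha.height_pos hq (kept_of_isV hv.isV)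
    have e2 := ha.height_pos hq (kept_of_isV hv'.isV)
    have e3 := ha.add_stretch_le (y := q.y j) e1.le
    have e4 := ha.add_stretch_le (y := q.y j') e2.le
    rcases column_disjoint hq (kept_of_isV hv.isV) (kept_of_isV hv'.isV) hne hv.col hv'.col e1 e2
      with h5 | h5
    · have := ha.stretch_mono h5
      linarith
    · have := ha.stretch_mono h5
      linarith
  · exact (mixed (hz.symm.trans hz') (by omega) hk hx₁ hd' hv').elim
  · exact absurd (hz.symm.trans hz') (by simp)
  · exact (mixed (hz'.symm.trans hz) (by omega) hk' hx₀ hd hv).elim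
  · rw [hz] at hz'
    have hz := congrArg Sigma.fst (Option.some.inj hz')
    obtain ⟨rfl, rfl⟩ := Prod.mk.inj hz
    obtain rfl : y = y' := by omega
    obtain rfl := (Λ.arr a).dest_inj x₀ x₁ hx₀ hx₁ (by rw [hd]; simp) (hd.trans hd'.symm)
    exact ⟨ha.eq_of_stack hq (hB.valid a) hv hv' hu hu' o3 o4 o7 o8, rfl⟩
  · exact absurd (hz.symm.trans hz') (by simp)
  · exact absurd (hz.symm.trans hz') (by simp)
  · exact absurd (hz.symm.trans hz') (by simp)
  · have hmem : ∀ {a : Fin m} {x₀ : ℕ}, x₀ < (B a).w → Λ.dest a x₀ = none →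
        (⟨a, x₀⟩ : Σ _ : Fin m, ℕ) ∈ (Λ.unsaved : Set (Σ _ : Fin m, ℕ)) := fun hx₀ hd =>
      Finset.mem_coe.2 (Finset.mem_sigma.2 ⟨Finset.mem_univ _,
        Finset.mem_filter.2 ⟨Finset.mem_range.2 hx₀, hd⟩⟩)
    have e := hidx (hmem hx₀ hd) (hmem hx₁ hd') (by omega)
    obtain ⟨rfl, e'⟩ := Sigma.mk.inj e
    obtain rfl := eq_of_heq e'
    exact ⟨ha.eq_of_stack hq (b := 0) (v := v) (hB.valid a) hv hv' hu hu' (by linarith) (by linarith)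
      (by linarith) (by linarith), rfl⟩

end Admissible

end Setting

/-! ### Counting the boxes and assembling the packing -/

namespace Setting

section Index

variable {ι : Type*} {σ : Setting ι} {q : Rounding ι} {m : ℕ} {B : Fin m → Box} {M : ℕ}
  (Λ : σ.Layout q B M)

/-- The blocks for tall items. -/
noncomputable def Layout.tallStarts : Finset (Σ _ : Fin m × Bool, ℕ) :=
  Finset.univ.sigma fun z => blockStarts (Λ.rowBreaks z.1 z.2) (B z.1).w

/-- The blocks for vertical items. -/
noncomputable def Layout.vertStarts : Finset (Σ _ : Fin m × Fin 3, ℕ) :=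
  Finset.univ.sigma fun z => blockStarts (Λ.S z.1) (B z.1).w

/-- The boxes for tall items. -/
noncomputable def Layout.tallBox : Λ.tallStarts ⊕ {i // σ.IsT i ∧ σ.Fixed q B i} → Box :=
  Sum.elim (fun z => Λ.tallBlock z.1.1.1 z.1.1.2 z.1.2) fun i => σ.fixedBox q i

/-- The boxes for vertical items. -/
noncomputable def Layout.vertBox (z : Λ.vertStarts) : Box :=
  Λ.vertBlock z.1.1.1 (2 * (z.1.1.2 : ℕ)) z.1.2

theorem card_tallStarts_le : Λ.tallStarts.card ≤ 2 * m * (M + 1) := by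
  rw [Layout.tallStarts, Finset.card_sigma]
  refine (Finset.sum_le_card_nsmul _ _ (M + 1) fun z _ => ?_).trans ?_
  · refine (card_blockStarts_le _ _).trans (Nat.succ_le_succ ?_)
    exact (Finset.card_filter_le _ _).trans (Λ.card_le _)
  · simp [mul_comm]

theorem card_vertStarts_le : Λ.vertStarts.card ≤ 3 * m * (M + 1) := by
  rw [Layout.vertStarts, Finset.card_sigma]
  refine (Finset.sum_le_card_nsmul _ _ (M + 1) fun z _ => ?_).trans ?_
  · exact (card_blockStarts_le _ _).trans (Nat.succ_le_succ (Λ.card_le _))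
  · simp [mul_comm]

end Index

namespace Admissible

variable {ι : Type*} {σ : Setting ι} {N k : ℕ} (ha : σ.Admissible N k) {q : Rounding ι}
  (hq : σ.IsRounded q) {m : ℕ} {B : Fin m → Box} (hB : σ.Houses q B)
include ha hq hB

/-- In the box containing its leftmost column, a fixed item must stick out to the right. It then
occupies the last column there, and box and row determine it. -/
theorem card_fixed_le [Finite ι] : Nat.card {i // σ.IsT i ∧ σ.Fixed q B i} ≤ 2 * m := by
  have h : ∀ i : {i // σ.IsT i ∧ σ.Fixed q B i}, ∃ z : Fin m × Bool,
      σ.TallAt q (B z.1) z.2 ((B z.1).w - 1) i := by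
    rintro ⟨i, hi, hf⟩
    have hw := σ.w_pos i
    obtain ⟨a, ρ, x, hx, e, h⟩ := exists_box_tallAt hB hi (x := q.x i) le_rfl (by omega)
    have hk := kind_ne_of_fixed hB hf h (ha.height_pos hq (kept_of_isT hi))
    refine ⟨(a, ρ), h.1, ?_, h.2.2⟩
    rcases itemKind_cases (σ := σ) q (B a) i with h2 | h2 | h2
    · omega
    · dsimp only; omega
    · omega
  choose f hf using h
  have := Nat.card_le_card_of_injective f fun i j hij => by
    have h1 := hf i
    rw [hij] at h1
    exact Subtype.ext (ha.tallAt_unique hq (hB.valid _) h1 (hf j))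
  simpa [Nat.card_eq_fintype_card, mul_comm] using this

variable {M : ℕ} (Λ : σ.Layout q B M)

theorem at_of_tallBox {j} {x : ℕ} {v : ℝ}
    (h : (Λ.tallBox j).x ≤ x ∧ x < (Λ.tallBox j).x + (Λ.tallBox j).w ∧
      (Λ.tallBox j).y ≤ v ∧ v < (Λ.tallBox j).y + (Λ.tallBox j).h) :
    ∃ a ρ x', Λ.At a (layerOf ρ) x' x v := by
  rcases j with z | i
  · obtain ⟨x', h1, -⟩ := (tallBlock_point Λ _ _ (Finset.mem_sigma.1 z.2).2 x v).1 h
    exact ⟨_, _, _, h1⟩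
  · obtain ⟨a, ρ, x', h1, -⟩ := (ha.fixedBox_point hq hB Λ i.2.1 i.2.2 x v).1 h
    exact ⟨_, _, _, h1⟩

omit ha hq hB in
theorem at_of_vertBox {z} {x : ℕ} {v : ℝ}
    (h : (Λ.vertBox z).x ≤ x ∧ x < (Λ.vertBox z).x + (Λ.vertBox z).w ∧
      (Λ.vertBox z).y ≤ v ∧ v < (Λ.vertBox z).y + (Λ.vertBox z).h) :
    ∃ x', Λ.At z.1.1.1 (2 * (z.1.1.2 : ℕ)) x' x v ∧ blockLo (Λ.S z.1.1.1) x' = z.1.2 :=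
  (vertBlock_point Λ _ _ (Finset.mem_sigma.1 z.2).2 x v).1 h

omit ha hq hB in
theorem even_le (f : Fin 3) : 2 * (f : ℕ) ≤ 4 := by omega

theorem tallBox_disjoint {j j'} (hj : j ≠ j') :
    Disjoint (Λ.tallBox j).region (Λ.tallBox j').region := by
  rw [Box.disjoint_iff, Box.overlap_iff]
  rintro ⟨x, v, h, h'⟩
  refine hj ?_
  have mixed : ∀ (z : Λ.tallStarts) (i : {i // σ.IsT i ∧ σ.Fixed q B i}),
      ((Λ.tallBox (Sum.inl z)).x ≤ x ∧ x < (Λ.tallBox (Sum.inl z)).x + (Λ.tallBox (Sum.inl z)).w ∧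
      (Λ.tallBox (Sum.inl z)).y ≤ v ∧
      v < (Λ.tallBox (Sum.inl z)).y + (Λ.tallBox (Sum.inl z)).h) →
      ((Λ.tallBox (Sum.inr i)).x ≤ x ∧ x < (Λ.tallBox (Sum.inr i)).x + (Λ.tallBox (Sum.inr i)).w ∧
      (Λ.tallBox (Sum.inr i)).y ≤ v ∧
      v < (Λ.tallBox (Sum.inr i)).y + (Λ.tallBox (Sum.inr i)).h) → False := by
    intro z i h h'
    obtain ⟨y, h1, h2, h3⟩ := (tallBlock_point Λ _ _ (Finset.mem_sigma.1 z.2).2 x v).1 h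
    obtain ⟨a, ρ, y', h4, -, -, h5⟩ := (ha.fixedBox_point hq hB Λ i.2.1 i.2.2 x v).1 h'
    obtain ⟨rfl, e1, rfl⟩ := ha.at_unique hq hB Λ (layerOf_le _) (layerOf_le _) h1 h4
    rw [layerOf_injective e1] at h3
    omega
  rcases j with z | i <;> rcases j' with z' | i'
  · obtain ⟨y, h1, h2, -⟩ := (tallBlock_point Λ _ _ (Finset.mem_sigma.1 z.2).2 x v).1 h
    obtain ⟨y', h1', h2', -⟩ := (tallBlock_point Λ _ _ (Finset.mem_sigma.1 z'.2).2 x v).1 h'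
    obtain ⟨e0, e1, rfl⟩ := ha.at_unique hq hB Λ (layerOf_le _) (layerOf_le _) h1 h1'
    have e1 := layerOf_injective e1
    rw [e0, e1] at h2
    exact congrArg Sum.inl (Subtype.ext (Sigma.ext (Prod.ext e0 e1)
      (heq_of_eq (h2.symm.trans h2'))))
  · exact (mixed z i' h h').elim
  · exact (mixed z' i h' h).elim
  · obtain ⟨a, ρ, y, h1, h2, -⟩ := (ha.fixedBox_point hq hB Λ i.2.1 i.2.2 x v).1 h
    obtain ⟨b, ρ', y', h1', h2', -⟩ := (ha.fixedBox_point hq hB Λ i'.2.1 i'.2.2 x v).1 h'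
    obtain ⟨rfl, e1, rfl⟩ := ha.at_unique hq hB Λ (layerOf_le _) (layerOf_le _) h1 h1'
    obtain rfl := layerOf_injective e1
    exact congrArg Sum.inr (Subtype.ext (ha.tallAt_unique hq (hB.valid _) h2 h2'))

theorem vertBox_disjoint {z z'} (hz : z ≠ z') :
    Disjoint (Λ.vertBox z).region (Λ.vertBox z').region := by
  rw [Box.disjoint_iff, Box.overlap_iff]
  rintro ⟨x, v, h, h'⟩
  refine hz ?_
  obtain ⟨y, h1, h2⟩ := at_of_vertBox Λ h
  obtain ⟨y', h1', h2'⟩ := at_of_vertBox Λ h'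
  obtain ⟨e0, e1, rfl⟩ := ha.at_unique hq hB Λ (even_le _) (even_le _) h1 h1'
  rw [e0] at h2
  exact Subtype.ext (Sigma.ext (Prod.ext e0 (Fin.ext (by omega))) (heq_of_eq (h2.symm.trans h2')))

theorem tallBox_disjoint_vertBox (j z) :
    Disjoint (Λ.tallBox j).region (Λ.vertBox z).region := by
  rw [Box.disjoint_iff, Box.overlap_iff]
  rintro ⟨x, v, h, h'⟩
  obtain ⟨a, ρ, y, h1⟩ := ha.at_of_tallBox hq hB Λ h
  obtain ⟨y', h1', -⟩ := at_of_vertBox Λ h'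
  obtain ⟨-, e, -⟩ := ha.at_unique hq hB Λ (layerOf_le _) (even_le _) h1 h1'
  cases ρ <;> simp only [layerOf, if_true, if_false, Bool.false_eq_true] at e <;> omega

/-- Every point of an enlarged box lies in one of five layers. Even layers are covered by the blocks
for vertical items. Odd layers are covered by blocks for tall items if the kind is at most 1 and
otherwise by the fixed item there, which has not moved sideways. -/
theorem union_boxes : (⋃ j, (Λ.tallBox j).region) ∪ (⋃ z, (Λ.vertBox z).region) =
    ⋃ a, (σ.stretchBox (B a)).region := by
  ext ⟨p, v⟩
  simp only [Set.mem_union, Set.mem_iUnion, Box.mem_region_iff]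
  constructor
  · rintro (⟨j, hp, h⟩ | ⟨z, hp, h⟩)
    · obtain ⟨a, ρ, x', h1⟩ := ha.at_of_tallBox hq hB Λ h
      exact ⟨a, hp, ha.at_mem hq hB Λ (layerOf_le _) h1⟩
    · obtain ⟨x', h1, -⟩ := at_of_vertBox Λ h
      exact ⟨_, hp, ha.at_mem hq hB Λ (even_le _) h1⟩
  · rintro ⟨a, hp, h⟩
    obtain ⟨l, x', hl, h1⟩ := ha.exists_at hq hB Λ h
    have hcases : (∃ ρ, l = layerOf ρ) ∨ ∃ f : Fin 3, l = 2 * (f : ℕ) := by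
      interval_cases l
      · exact Or.inr ⟨0, rfl⟩
      · exact Or.inl ⟨false, rfl⟩
      · exact Or.inr ⟨1, rfl⟩
      · exact Or.inl ⟨true, rfl⟩
      · exact Or.inr ⟨2, rfl⟩
    rcases hcases with ⟨ρ, rfl⟩ | ⟨f, rfl⟩
    · left
      rcases Nat.lt_or_ge (Λ.key a ρ x').kind 2 with hk | hk
      · have hmem := blockLo_mem (T := Λ.rowBreaks a ρ) h1.lt_w
        exact ⟨Sum.inl ⟨⟨(a, ρ), _⟩, Finset.mem_sigma.2 ⟨Finset.mem_univ _, hmem⟩⟩, hp,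
          (tallBlock_point Λ a ρ hmem _ v).2 ⟨x', h1, rfl, by omega⟩⟩
      · obtain ⟨x₀, i, hx₀, h2, h3, h4⟩ := ha.exists_tallAt_of_kind hq hB Λ (a := a) (ρ := ρ)
          h1.lt_w (by omega)
        have hk' := hk
        rw [h4, Setting.itemKey, Key.kind_mk] at hk'
        have h5 := ha.p_of_kind_ne hq hB Λ a hx₀ h3 (by omega)
        obtain rfl : x₀ = x' := h5.symm.trans h2
        have hf : σ.Fixed q B i := ⟨a, ρ, x₀, hx₀, h3, by omega⟩
        exact ⟨Sum.inr ⟨i, h3.1, hf⟩, hp,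
          (ha.fixedBox_point hq hB Λ h3.1 hf _ v).2 ⟨a, ρ, x₀, h1, h3, h2, hk⟩⟩
    · right
      have hmem := blockLo_mem (T := Λ.S a) h1.lt_w
      exact ⟨⟨⟨(a, f), _⟩, Finset.mem_sigma.2 ⟨Finset.mem_univ _, hmem⟩⟩, hp,
        (vertBlock_point Λ a _ hmem _ v).2 ⟨x', h1, rfl⟩⟩

theorem packsTall {nT : ℕ} (e : Λ.tallStarts ⊕ {i // σ.IsT i ∧ σ.Fixed q B i} ≃ Fin nT) :
    σ.PacksTall q (Λ.tallBox ∘ e.symm) := by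
  choose s hs hc hp using fun i : {i // σ.IsT i} => ha.exists_slot hq hB Λ i.2
  have hc' : ∀ i, ∃ c, (s i).Within (Λ.tallBox c) ∧ (s i).h = (Λ.tallBox c).h := by
    intro i
    rcases hc i with ⟨hf, e⟩ | ⟨a, ρ, t, ht, hw, hh⟩
    · refine ⟨Sum.inr ⟨i, i.2, hf⟩, ?_⟩
      rw [e]
      exact ⟨⟨⟨le_rfl, le_rfl⟩, le_rfl, le_rfl⟩, rfl⟩
    · exact ⟨Sum.inl ⟨⟨(a, ρ), t⟩, Finset.mem_sigma.2 ⟨Finset.mem_univ _, ht⟩⟩, hw, hh⟩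
  choose c hc' using hc'
  refine ⟨s, fun i => e (c i), hs, fun i => ?_, fun i j hij ho => ?_⟩
  · simp only [Function.comp_apply, Equiv.symm_apply_apply]
    exact hc' i
  · obtain ⟨x, v, h1, h2⟩ := (Box.overlap_iff _ _).1 ho
    exact hij (Subtype.ext (ha.eq_of_slots hq hB Λ (hp i x v h1) (hp j x v h2)))

omit ha hq hB in
theorem placed_size {idx : (Σ _ : Fin m, ℕ) → ℕ} {j : ι} {x : ℕ} {s : Box}
    {c : Option (Σ _ : Fin m × Fin 3, ℕ)} (h : Λ.Placed idx j x s c) :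
    s.w = 1 ∧ s.h = q.height j := by
  rcases h with ⟨a, x', f, -, rfl, -⟩ | ⟨a, x₀, x', f, -, rfl, -⟩ | ⟨a, x₀, -, rfl, -⟩ <;>
    exact ⟨rfl, rfl⟩

theorem packsVertical [Fintype ι] {nV : ℕ} (e : Λ.vertStarts ≃ Fin nV) :
    σ.PacksVerticalFractionally q (Λ.vertBox ∘ e.symm) := by
  classical
  set idx : (Σ _ : Fin m, ℕ) → ℕ := fun z =>
    if h : z ∈ Λ.unsaved then (Λ.unsaved.equivFin ⟨z, h⟩ : ℕ) else 0 with hidx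
  have hlt : ∀ z ∈ Λ.unsaved, idx z < Λ.unsaved.card := fun z hz => by
    simp only [hidx, dif_pos hz]
    exact Fin.is_lt _
  have hinj : Set.InjOn idx Λ.unsaved := fun z hz z' hz' h => by
    have hz := Finset.mem_coe.1 hz
    have hz' := Finset.mem_coe.1 hz'
    simp only [hidx, dif_pos hz, dif_pos hz'] at h
    exact congrArg Subtype.val (Λ.unsaved.equivFin.injective (Fin.ext h))
  choose s c hs using fun z : Σ j : {j // σ.IsV j}, Fin (σ.w j) =>
    ha.exists_placed hq hB Λ idx z.1.2 (x := q.x z.1 + z.2) (Nat.le_add_right _ _)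
      (Nat.add_lt_add_left z.2.2 _)
  have hmem : ∀ z y, c z = some y → y ∈ Λ.vertStarts := by
    intro z y hy
    have h1 := hs z
    rw [hy] at h1
    exact Finset.mem_sigma.2 ⟨Finset.mem_univ _, (ha.placed_within hq hB Λ h1).1⟩
  set E := Fintype.equivFin (Σ j : {j // σ.IsV j}, Fin (σ.w j)) with hE
  set c' : (Σ j : {j // σ.IsV j}, Fin (σ.w j)) → Option (Fin nV) := fun z =>
    (c z).pmap (fun y hy => e ⟨y, hy⟩) (fun y hy => hmem z y hy) with hc'
  have hcsome : ∀ z b, c' z = some b → c z = some (e.symm b).1 := by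
    intro z b h
    simp only [hc', Option.pmap_eq_some_iff] at h
    obtain ⟨y, hy, h1, h2⟩ := h
    rw [h1, h2, Equiv.symm_apply_apply]
  have hcnone : ∀ z, c' z = none → c z = none := by
    intro z h
    simpa only [hc', Option.pmap_eq_none_iff] using h
  refine ⟨_, fun r => (E.symm r).1, fun r => s (E.symm r), fun r => c' (E.symm r),
    fun r => ⟨(E.symm r).1.2, (placed_size Λ (hs _)).2⟩, fun i hi => ?_, fun r b h => ?_,
    fun r h => ?_, fun r r' hr hc ho => ?_⟩
  · rw [Finset.sum_filter, Equiv.sum_comp E.symm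
      (fun z => if ((z.1 : {j // σ.IsV j}) : ι) = i then (s z).w else 0), Fintype.sum_sigma,
      Finset.sum_eq_single ⟨i, hi⟩]
    · simp [(placed_size Λ (hs _)).1]
    · intro j _ hj
      refine Finset.sum_eq_zero fun t _ => if_neg fun h => hj (Subtype.ext h)
    · exact fun h => absurd (Finset.mem_univ _) h
  · have h1 := hs (E.symm r)
    rw [hcsome _ _ h] at h1
    exact (ha.placed_within hq hB Λ h1).2
  · have h1 := hs (E.symm r)
    rw [hcnone _ h] at h1
    exact ha.placed_withinV0 hq hB Λ hlt h1
  · have hcc : c (E.symm r) = c (E.symm r') := by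
      dsimp only at hc
      rcases h : c' (E.symm r) with _ | b
      · rw [hcnone _ h, hcnone _ (hc.symm.trans h)]
      · rw [hcsome _ _ h, hcsome _ _ (hc.symm.trans h)]
    have h1 := hs (E.symm r)
    rw [hcc] at h1
    obtain ⟨h2, h3⟩ := ha.eq_of_placed hq hB Λ hinj h1 (hs (E.symm r')) ho
    refine hr (E.symm.injective ?_)
    generalize E.symm r = z at h2 h3
    generalize E.symm r' = z' at h2 h3
    obtain ⟨⟨j, hj⟩, t⟩ := z
    obtain ⟨⟨j', hj'⟩, t'⟩ := z'
    dsimp only at h2 h3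
    subst h2
    obtain rfl : t = t' := Fin.ext (by omega)
    rfl

omit hB

theorem exists_packing [Fintype ι] {nH nTV : ℕ} {P : σ.BoxFamily nH nTV}
    (hP : σ.IsBoxPartition q P) :
    ∃ (nT nV : ℕ) (BT : Fin nT → Box) (BV : Fin nV → Box),
      σ.IsSubdivision (σ.stretchBoxes P) BT BV ∧
      nT ≤ 3 * nTV * (breakBound (N + 7) + 1) ∧ nV ≤ 3 * nTV * (breakBound (N + 7) + 1) ∧
      σ.PacksTall q BT ∧ σ.PacksVerticalFractionally q BV := by
  have hB := ha.houses_boxTV hq hP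
  obtain ⟨Λ⟩ := ha.exists_layout_boxes hq hB
  set eT := Finite.equivFin (Λ.tallStarts ⊕ {i // σ.IsT i ∧ σ.Fixed q P.boxTV i}) with heT
  set eV := Λ.vertStarts.equivFin with heV
  refine ⟨_, _, Λ.tallBox ∘ eT.symm, Λ.vertBox ∘ eV.symm, ⟨?_, ?_, ?_, ?_⟩, ?_,
    card_vertStarts_le Λ, ha.packsTall hq hB Λ eT, ha.packsVertical hq hB Λ eV⟩
  · exact fun a b hab => ha.tallBox_disjoint hq hB Λ (eT.symm.injective.ne hab)
  · exact fun a b hab => ha.vertBox_disjoint hq hB Λ (eV.symm.injective.ne hab)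
  · exact fun a b => ha.tallBox_disjoint_vertBox hq hB Λ _ _
  · have h1 : (⋃ a, ((Λ.tallBox ∘ eT.symm) a).region) = ⋃ j, (Λ.tallBox j).region :=
      eT.symm.surjective.iUnion_comp fun j => (Λ.tallBox j).region
    have h2 : (⋃ a, ((Λ.vertBox ∘ eV.symm) a).region) = ⋃ j, (Λ.vertBox j).region :=
      eV.symm.surjective.iUnion_comp fun j => (Λ.vertBox j).region
    rw [h1, h2, ha.union_boxes hq hB Λ]
    rfl
  · rw [Nat.card_sum, Nat.card_eq_fintype_card, Fintype.card_coe]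
    have h1 := card_tallStarts_le Λ
    have h2 := ha.card_fixed_le hq hB
    -- There are at most two fixed items per box, which the third multiple of `nTV * (breakBound (N
    -- + 7) + 1)` absorbs.
    have h3 : 2 * nTV ≤ nTV * (breakBound (N + 7) + 1) := by
      rw [mul_comm]
      refine Nat.mul_le_mul_left _ ?_
      rw [breakBound]
      omega
    linarith

omit hq in
-- `breakBound (N + 7)` is quadratic in N = 1/ε with leading coefficient 32, so 600N² is a generous
-- bound for N ≥ 24. Since 3(1 + 2ε) ≤ 4, the constant is 4 · 600 = 2400.
theorem card_bound {n nTV : ℕ} (hTV : (nTV : ℝ) ≤ 3 * (1 + 2 * σ.ε) / (σ.ε * σ.δ ^ 2))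
    (hn : n ≤ 3 * nTV * (breakBound (N + 7) + 1)) :
    (n : ℝ) ≤ 2400 / (σ.ε ^ 3 * σ.δ ^ 2) := by
  have hε := ha.ε_pos
  have hδ := ha.δ_pos
  have hN : (24 : ℝ) ≤ N := by exact_mod_cast ha.N_ge
  have h1 : ((3 * (breakBound (N + 7) + 1) : ℕ) : ℝ) ≤ 600 * (N : ℝ) ^ 2 := by
    rw [breakBound]
    push_cast
    nlinarith
  have h2 : (nTV : ℝ) ≤ 4 / (σ.ε * σ.δ ^ 2) := by
    refine hTV.trans (div_le_div_of_nonneg_right ?_ (by positivity))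
    linarith [ha.ε_le]
  have h3 : (n : ℝ) ≤ nTV * ((3 * (breakBound (N + 7) + 1) : ℕ) : ℝ) := by
    have : (n : ℝ) ≤ ((3 * nTV * (breakBound (N + 7) + 1) : ℕ) : ℝ) := Nat.cast_le.2 hn
    refine this.trans_eq ?_
    push_cast
    ring
  calc (n : ℝ) ≤ 4 / (σ.ε * σ.δ ^ 2) * (600 * (N : ℝ) ^ 2) :=
        h3.trans (mul_le_mul h2 h1 (Nat.cast_nonneg _) (by positivity))
    _ = 2400 / (σ.ε ^ 3 * σ.δ ^ 2) := by
        have hN0 := ha.N_pos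
        rw [ha.ε_eq]
        field_simp
        norm_num

end Admissible

theorem admissible_of_nonempty {ι : Type*} [Fintype ι] [Nonempty ι] {σ : Setting ι} {N k : ℕ}
    {y : ι → ℕ} (hy : σ.toInstance.packingHeight y = σ.OPT) (hN : 24 ≤ N) (hε : σ.ε = 1 / N)
    (hk : 1 ≤ k) (hδ : σ.δ = σ.ε ^ k) (hμ : 0 < σ.μ) (hμδ : σ.μ < σ.δ) :
    σ.Admissible N k ∧ ∀ i, y i + σ.h i ≤ σ.OPT := by
  have h1 : ∀ i, y i + σ.h i ≤ σ.OPT := fun i =>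
    hy ▸ Finset.le_sup (f := fun i => y i + σ.h i) (Finset.mem_univ i)
  obtain ⟨i⟩ := ‹Nonempty ι›
  have h2 := h1 i
  have h3 := σ.h_pos i
  exact ⟨⟨hN, hε, hk, hδ, hμ, hμδ, fun j => (Nat.le_add_left _ _).trans (h1 j), by omega,
    (σ.w_pos i).trans_le (σ.w_le i)⟩, h1⟩

theorem isRounded_of_isEmpty {ι : Type*} [IsEmpty ι] (σ : Setting ι) (q : Rounding ι) :
    σ.IsRounded q :=
  ⟨isEmptyElim, isEmptyElim, isEmptyElim, isEmptyElim, isEmptyElim, isEmptyElim⟩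

theorem isBoxPartition_of_isEmpty {ι : Type*} [IsEmpty ι] {σ : Setting ι} (hσ : σ.OPT = 0)
    (hε : 0 < σ.ε) (q : Rounding ι) (P : σ.BoxFamily 0 0) : σ.IsBoxPartition q P := by
  refine ⟨isEmptyElim, isEmptyElim, ?_, ?_, ?_, isEmptyElim, isEmptyElim, isEmptyElim,
    isEmptyElim, isEmptyElim, fun _ => isEmptyElim, fun _ => isEmptyElim⟩
  · rw [Set.iUnion_of_empty, hσ]
    simp
  · rw [Nat.cast_zero]
    positivity
  · rw [Nat.cast_zero]
    positivity

end Setting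

end StripPacking

theorem mainTheorem5 :
    ∃ C : ℝ, ∀ (ι : Type*) [Fintype ι] (σ : StripPacking.Setting ι) (N k : ℕ),
      σ.toInstance.IsOptimalHeight σ.OPT →
      24 ≤ N → σ.ε = 1 / N → 1 ≤ k → σ.δ = σ.ε ^ k → 0 < σ.μ → σ.μ < σ.δ →
      (∃ (q : StripPacking.Rounding ι) (nH nTV : ℕ) (P : σ.BoxFamily nH nTV),
        σ.IsRounded q ∧ σ.IsBoxPartition q P) ∧
      ∀ (q : StripPacking.Rounding ι) (nH nTV : ℕ) (P : σ.BoxFamily nH nTV),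
        σ.IsRounded q → σ.IsBoxPartition q P →
        ∃ (P' : σ.BoxFamily nH nTV) (nT nV : ℕ)
          (BT : Fin nT → StripPacking.Box) (BV : Fin nV → StripPacking.Box),
          σ.IsEnlargement P P' ∧ σ.IsSubdivision P' BT BV ∧
          (nT : ℝ) ≤ C / (σ.ε ^ 3 * σ.δ ^ 2) ∧ (nV : ℝ) ≤ C / (σ.ε ^ 3 * σ.δ ^ 2) ∧
          σ.PacksTall q BT ∧ σ.PacksVerticalFractionally q BV := by
  refine ⟨2400, fun ι _ σ N k hopt hN hε hk hδ hμ hμδ => ?_⟩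
  have hN0 : (0 : ℝ) < N := Nat.cast_pos.2 (by omega)
  have hε0 : 0 < σ.ε := hε ▸ one_div_pos.2 hN0
  obtain ⟨⟨x, y, hf, hy⟩, -⟩ := hopt
  rcases isEmpty_or_nonempty ι with hι | hι
  -- Without items OPT is 0 and the area is empty, so no box of positive size exists and all
  -- families are empty.
  · have h0 : σ.OPT = 0 := by
      rw [← hy, StripPacking.Instance.packingHeight, Finset.univ_eq_empty, Finset.sup_empty]
      rfl
    refine ⟨⟨⟨fun _ => 0, fun _ => 0, fun _ => 0⟩, 0, 0, isEmptyElim,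
      σ.isRounded_of_isEmpty _, StripPacking.Setting.isBoxPartition_of_isEmpty h0 hε0 _ _⟩, ?_⟩
    intro q nH nTV P _ hP
    have hno : ∀ a, False := fun a => by
      have h1 := (StripPacking.Setting.box_valid hP a).1
      have h2 := h1.top_le
      rw [h0, Nat.cast_zero, mul_zero] at h2
      linarith [h1.y_nonneg, h1.h_pos]
    have hC : 0 ≤ 2400 / (σ.ε ^ 3 * σ.δ ^ 2) := by positivity
    refine ⟨P, 0, 0, isEmptyElim, isEmptyElim, ?_, ?_, ?_, ?_, ?_, ?_⟩
    · exact ⟨fun a => (hno a).elim, fun a => (hno a).elim, fun a => (hno a).elim, isEmptyElim,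
        fun a => (hno (Sum.inr (Sum.inl a))).elim, fun a => (hno (Sum.inr (Sum.inr a))).elim,
        fun a => (hno a).elim, fun a => (hno a).elim⟩
    · refine ⟨isEmptyElim, isEmptyElim, isEmptyElim, ?_⟩
      have : IsEmpty (Fin nTV) := ⟨fun a => hno (Sum.inr (Sum.inr a))⟩
      simp only [Set.iUnion_of_empty, Set.union_empty]
    · rwa [Nat.cast_zero]
    · rwa [Nat.cast_zero]
    · exact ⟨isEmptyElim, isEmptyElim, isEmptyElim, isEmptyElim, isEmptyElim⟩
    · exact ⟨0, isEmptyElim, isEmptyElim, isEmptyElim, isEmptyElim, isEmptyElim, isEmptyElim,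
        isEmptyElim, isEmptyElim⟩
  · obtain ⟨ha, hyo⟩ :=
      StripPacking.Setting.admissible_of_nonempty hy hN hε hk hδ hμ hμδ
    constructor
    · obtain ⟨q, hq⟩ := ha.exists_isRounded hf hyo
      obtain ⟨nH, nTV, P, hP⟩ := ha.exists_isBoxPartition hq
      exact ⟨q, nH, nTV, P, hq, hP⟩
    · intro q nH nTV P hq hP
      obtain ⟨nT, nV, BT, BV, h1, h2, h3, h4, h5⟩ := ha.exists_packing hq hP
      exact ⟨_, nT, nV, BT, BV, ha.isEnlargement_stretchBoxes hP, h1,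
        ha.card_bound hP.card_TV h2, ha.card_bound hP.card_TV h3, h4, h5⟩
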